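/- Let $G$ be a finite simple graph with vertex set $V$, $|V|=n$, let $\ell\ge 0$ be a number of colors, let $p$ be a partial coloring of $V$ with colors from $[\ell]=\{1,\dots,\ell\}$ (a function from some subset of $V$ to $[\ell]$), and let $k\ge 0$ be an integer. A vertex $v$ is \emph{happy} with respect to a coloring $c:V\to[\ell]$ if every neighbour of $v$ has the color $c(v)$ (in particular, isolated vertices are happy). \textsc{Maximum Happy Vertices} asks, given $(G,p,k)$ and $\ell$, whether there is a coloring $c:V\to[\ell]$ that extends $p$ and with respect to which at least $k$ vertices of $G$ are happy. A graph is an \emph{interval graph} if its vertices can be represented by nonempty closed intervals of the real line so that two distinct vertices are adjacent if and only if their intervals intersect. \textbf{Theorem.} \textsc{Maximum Happy Vertices} on interval graphs can be solved in $O(\ell n^2)$ time. More precisely, there are a single program for a random access machine and constants $d, C$ such that, for all $n,\ell,k\ge 0$, every interval graph $G$ on $n$ vertices and every partial coloring $p$ of its vertices with colors from $[\ell]$, the program, given $n$, $\ell$, $k$, the adjacency matrix of $G$ and the table of $p$ (but no interval representation of $G$), halts after at most $C(\ell n^2+1)$ steps with output $1$ if $(G,p,k)$ is a yes-instance and with output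 $0$ otherwise. (The summand $1$ only matters if $n=0$ or $\ell=0$.) Here the machine has finitely many registers and finitely many banks of random access memory; each addition, truncated subtraction, multiplication, comparison, memory access, assignment and test costs one step; and all numbers it computes, addresses included, are smaller than $(n+\ell+k+2)^d$, so that words of $O(\log(n+\ell+k+2))$ bits suffice. -/

import Mathlib

/-! ### Interval graphs and happy vertices -/

/-- `G` is an interval graph: it is the intersection graph of a family of
nonempty closed intervals of the real line. -/
def IsIntervalGraph {V : Type*} (G : SimpleGraph V) : Prop :=
  ∃ a b : V → ℝ, (∀ v, a v ≤ b v) ∧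
    ∀ u v, G.Adj u v ↔ u ≠ v ∧ (Set.Icc (a u) (b u) ∩ Set.Icc (a v) (b v)).Nonempty

/-- The set of happy vertices of `G` with respect to the colouring `c`: those all of
whose neighbours have their own colour. (An isolated vertex is happy.) -/
def happyVertices {V κ : Type*} (G : SimpleGraph V) (c : V → κ) : Set V :=
  {v | ∀ u, G.Adj v u → c u = c v}

/-- The full colouring `c` extends the partial colouring `p`
(`p v = none` means that `v` is not precoloured). -/
def ExtendsPrecoloring {V κ : Type*} (p : V → Option κ) (c : V → κ) : Prop :=
  ∀ v j, p v = some j → c v = j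

/-- `(G, p, k)` is a yes-instance of Maximum Happy Vertices with `ℓ` colours: some
full colouring that extends `p` makes at least `k` vertices happy. -/
def IsYesMHV {n ℓ : ℕ} (G : SimpleGraph (Fin n)) (p : Fin n → Option (Fin ℓ)) (k : ℕ) : Prop :=
  ∃ c : Fin n → Fin ℓ, ExtendsPrecoloring p c ∧ k ≤ (happyVertices G c).ncard

/-! ### A random access machine with words of bounded size

A program uses finitely many registers and finitely many banks of random access memory
(only those that its text mentions), all of whose cells hold natural numbers. Its control
flow is structured. Every elementary operation, every memory access, every assignment and
every test costs one step. The semantics has a parameter `W`, the number of different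
values of a machine word: every value that a program computes, addresses included, has to
be smaller than `W`; a program that violates this is stuck. -/

namespace WordRAM

/-- The contents of the registers (`reg r`) and of the memory banks (`mem b i`: cell `i`
of bank `b`). -/
structure State where
  reg : ℕ → ℕ
  mem : ℕ → ℕ → ℕ

/-- Elementary operations on words. -/
inductive Op where
  | plus
  | minus
  | times
  | less
  | equal

/-- The value of an elementary operation: subtraction is truncated at zero, and the result
of a comparison is `1` if it holds and `0` if not. -/
def Op.eval : Op → ℕ → ℕ → ℕ
  | .plus, x, y => x + y
  | .minus, x, y => x - y
  | .times, x, y => x * y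
  | .less, x, y => if x < y then 1 else 0
  | .equal, x, y => if x = y then 1 else 0

/-- Right-hand sides: constants, registers, memory cells at a computed address, and
elementary operations. -/
inductive Term where
  | const (x : ℕ)
  | reg (r : ℕ)
  | load (bank : ℕ) (addr : Term)
  | op (o : Op) (s t : Term)

/-- The value of a term. -/
def Term.eval (σ : State) : Term → ℕ
  | .const x => x
  | .reg r => σ.reg r
  | .load b a => σ.mem b (a.eval σ)
  | .op o s t => o.eval (s.eval σ) (t.eval σ)

/-- Every value that occurs in the evaluation of a term fits into a machine word. -/
def Term.Fits (W : ℕ) (σ : State) : Term → Prop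
  | .const x => x < W
  | .reg r => σ.reg r < W
  | .load b a => a.Fits W σ ∧ σ.mem b (a.eval σ) < W
  | .op o s t => s.Fits W σ ∧ t.Fits W σ ∧ o.eval (s.eval σ) (t.eval σ) < W

/-- The number of steps that the evaluation of a term takes. -/
def Term.cost : Term → ℕ
  | .const _ => 1
  | .reg _ => 1
  | .load _ a => a.cost + 1
  | .op _ s t => s.cost + t.cost + 1

/-- Programs. A test succeeds if the value of the tested term is not zero. -/
inductive Program where
  | skip
  | assign (r : ℕ) (t : Term)
  | store (bank : ℕ) (addr t : Term)
  | seq (P Q : Program)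
  | ite (t : Term) (P Q : Program)
  | while (t : Term) (P : Program)

/-- Write `x` into register `r`. -/
def State.setReg (σ : State) (r x : ℕ) : State :=
  { σ with reg := Function.update σ.reg r x }

/-- Write `x` into cell `i` of bank `b`. -/
def State.setMem (σ : State) (b i x : ℕ) : State :=
  { σ with mem := Function.update σ.mem b (Function.update (σ.mem b) i x) }

/-- `Exec W P σ τ T`: with word bound `W` and started in the state `σ`, the program `P`
halts in the state `τ` after exactly `T` steps. -/
inductive Exec (W : ℕ) : Program → State → State → ℕ → Prop
  | skip (σ : State) : Exec W .skip σ σ 1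
  | assign (σ : State) (r : ℕ) (t : Term) (ht : t.Fits W σ) :
      Exec W (.assign r t) σ (σ.setReg r (t.eval σ)) (t.cost + 1)
  | store (σ : State) (b : ℕ) (a t : Term) (ha : a.Fits W σ) (ht : t.Fits W σ) :
      Exec W (.store b a t) σ (σ.setMem b (a.eval σ) (t.eval σ)) (a.cost + t.cost + 1)
  | seq (P Q : Program) (σ σ' τ : State) (T T' : ℕ)
      (hP : Exec W P σ σ' T) (hQ : Exec W Q σ' τ T') :
      Exec W (.seq P Q) σ τ (T + T')
  | ite_true (t : Term) (P Q : Program) (σ τ : State) (T : ℕ)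
      (ht : t.Fits W σ) (h : t.eval σ ≠ 0) (hP : Exec W P σ τ T) :
      Exec W (.ite t P Q) σ τ (t.cost + 1 + T)
  | ite_false (t : Term) (P Q : Program) (σ τ : State) (T : ℕ)
      (ht : t.Fits W σ) (h : t.eval σ = 0) (hQ : Exec W Q σ τ T) :
      Exec W (.ite t P Q) σ τ (t.cost + 1 + T)
  | while_true (t : Term) (P : Program) (σ σ' τ : State) (T T' : ℕ)
      (ht : t.Fits W σ) (h : t.eval σ ≠ 0)
      (hP : Exec W P σ σ' T) (hrec : Exec W (.while t P) σ' τ T') :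
      Exec W (.while t P) σ τ (t.cost + 1 + T + T')
  | while_false (t : Term) (P : Program) (σ : State)
      (ht : t.Fits W σ) (h : t.eval σ = 0) :
      Exec W (.while t P) σ σ (t.cost + 1)

end WordRAM

/-! ### The encoding of instances -/

open scoped Classical in
/-- The adjacency matrix of `G`, stored row by row. -/
noncomputable def adjacencyCell {n : ℕ} (G : SimpleGraph (Fin n)) (i : ℕ) : ℕ :=
  if ∃ u v : Fin n, i = u.val * n + v.val ∧ G.Adj u v then 1 else 0

/-- The precolouring: cell `v` holds `0` if the vertex `v` is not precoloured, and the
number from `{1, …, ℓ}` of its colour otherwise. -/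
def precoloringCell {n ℓ : ℕ} (p : Fin n → Option (Fin ℓ)) (i : ℕ) : ℕ :=
  if h : i < n then
    match p ⟨i, h⟩ with
    | none => 0
    | some j => j.val + 1
  else 0

/-- The initial state for the instance `(G, p, k)` with `n` vertices and `ℓ` colours:
registers `0`, `1`, `2` hold `n`, `ℓ`, `k`, bank `0` holds the adjacency matrix, bank `1`
the precolouring, and everything else is zero. -/
noncomputable def encodeMHV {n ℓ : ℕ} (G : SimpleGraph (Fin n)) (p : Fin n → Option (Fin ℓ))
    (k : ℕ) : WordRAM.State where
  reg := fun r => if r = 0 then n else if r = 1 then ℓ else if r = 2 then k else 0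
  mem := fun b => if b = 0 then adjacencyCell G else if b = 1 then precoloringCell p else 0

/-! ### Closed neighbourhoods that meet -/

/-! A vertex is happy exactly when its closed neighbourhood is monochromatic, so happy vertices
whose closed neighbourhoods meet share a colour. Conversely, a set of vertices can be made happy as
soon as its members receive colours that agree whenever closed neighbourhoods meet and that respect
the precolouring on each closed neighbourhood: colour these neighbourhoods accordingly and the
remaining vertices freely, subject to the precolouring. Hence only the relation `Close`, the square
of the graph, and the compatibility of vertices with colours matter.

The square of an interval graph is an interval graph. Suppose that half-open intervals with ends in
`{0, …, n}` represent it. Then the happy vertices of any colouring split into monochromatic blocks,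
each lying between two successive cuts of the line (`card_happy_le_cutValue`). Conversely, vertices
on different sides of a cut are never close, so the colours of different blocks can be chosen
independently (`exists_coloring_of_cutValue`). The optimum is therefore a heaviest chain of cuts.
There are `n + 1` left cuts and `ℓ` colours, and all right cuts of a pair are handled in linear time
by bucketing vertices by right end and taking prefix sums.

No representation of the graph is given, so one of its square is extracted from two breadth-first
searches. In each component the second one starts at a vertex `s` of the last layer of the first,
one with the fewest neighbours in the layer before. Such an `s` behaves like an end of the line: the
vertices close to it are dominated by one vertex, and all others lie on one side of it
(`IsLayering.exists_dominating`). A search from `s` thus sweeps in one direction, which gives the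
layer properties collected in `IsTidy`: vertices of one layer are close, and the neighbourhoods in
the next layer are nested, except that around the first layer a dominating vertex may take over.
Sorted by decreasing number of neighbours in the layer before, a layer is met in initial segments,
so among the vertices of the same or later layers those close to a given one form an initial
segment. The ends of these segments are the right ends of the representation (`IsTidy.close_iff`).

The machine side is a Hoare-style calculus, `Runs`, that carries step bounds and word bounds along
with invariants. Searches and tables cost quadratic time, and only the dynamic program depends on
the number of colours. -/

/-- The closed neighbourhoods of `u` and `v` meet. -/
def Close {V : Type*} (G : SimpleGraph V) (u v : V) : Prop :=
  ∃ w, (w = u ∨ G.Adj w u) ∧ (w = v ∨ G.Adj w v)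

theorem Close.symm {V : Type*} {G : SimpleGraph V} {u v : V} (h : Close G u v) : Close G v u := by
  obtain ⟨w, h1, h2⟩ := h
  exact ⟨w, h2, h1⟩

/-! ### Interval representations -/

/-- The intervals `[a v, b v]` represent `G`. -/
structure IsRep {V : Type*} (G : SimpleGraph V) (a b : V → ℝ) : Prop where
  le : ∀ v, a v ≤ b v
  adj_iff : ∀ u v, G.Adj u v ↔ u ≠ v ∧ a u ≤ b v ∧ a v ≤ b u

theorem IsIntervalGraph.exists_isRep {V : Type*} {G : SimpleGraph V} (h : IsIntervalGraph G) :
    ∃ a b : V → ℝ, IsRep G a b := by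
  obtain ⟨a, b, hab, h⟩ := h
  refine ⟨a, b, hab, fun u v => ?_⟩
  rw [h, Set.Icc_inter_Icc, Set.nonempty_Icc, sup_le_iff, le_inf_iff, le_inf_iff]
  have := hab u
  have := hab v
  tauto

/-- Reflecting the real line. -/
theorem IsRep.reflect {V : Type*} {G : SimpleGraph V} {a b : V → ℝ} (h : IsRep G a b) :
    IsRep G (fun v => -b v) (fun v => -a v) := by
  refine ⟨fun v => neg_le_neg (h.le v), fun u v => ?_⟩
  rw [h.adj_iff]
  simp only [neg_le_neg_iff]
  tauto

theorem IsRep.adj {V : Type*} {G : SimpleGraph V} {a b : V → ℝ} (h : IsRep G a b) {u v : V}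
    (hne : u ≠ v) (h1 : a u ≤ b v) (h2 : a v ≤ b u) : G.Adj u v :=
  (h.adj_iff u v).2 ⟨hne, h1, h2⟩

/-! ### Breadth-first layerings -/

/-- `lab` numbers the layers of breadth-first searches in all components of `G`. The search
of the component of `v` starts in `root v`, a vertex of maximal key of the component, and
different components use different labels. -/
structure IsLayering {V : Type*} (G : SimpleGraph V) (key : V → ℕ) (root : V → V)
    (lab : V → ℕ) : Prop where
  root_eq_of_adj : ∀ u v, G.Adj u v → root u = root v
  root_eq_of_lab_eq : ∀ u v, lab u = lab v → root u = root v
  root_root : ∀ v, root (root v) = root v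
  key_le : ∀ v, key v ≤ key (root v)
  lab_root_lt : ∀ v, v ≠ root v → lab (root v) < lab v
  exists_parent : ∀ v, v ≠ root v → ∃ w, G.Adj w v ∧ lab v = lab w + 1
  lab_le : ∀ u v, G.Adj u v → lab v ≤ lab u + 1

namespace IsLayering

variable {V : Type*} {G : SimpleGraph V} {key : V → ℕ} {root : V → V} {lab : V → ℕ}

theorem lab_root_le (h : IsLayering G key root lab) (v : V) : lab (root v) ≤ lab v := by
  by_cases hv : v = root v
  · rw [← hv]
  · exact (h.lab_root_lt v hv).le

theorem eq_root (h : IsLayering G key root lab) {v : V} (hv : lab v ≤ lab (root v)) :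
    v = root v := by
  by_contra hne
  exact absurd (h.lab_root_lt v hne) (not_lt.2 hv)

/-- A function that is constant along edges is constant on the components. -/
theorem eq_root_of_adj_invariant {κ : Type*} (h : IsLayering G key root lab) (f : V → κ)
    (hf : ∀ u v, G.Adj u v → f u = f v) (v : V) : f v = f (root v) := by
  induction hm : lab v using Nat.strong_induction_on generalizing v with
  | _ m ih =>
    by_cases hv : v = root v
    · rw [← hv]
    · obtain ⟨w, hw, hl⟩ := h.exists_parent v hv
      rw [← hf w v hw, ih (lab w) (by omega) w rfl, h.root_eq_of_adj w v hw]

theorem root_adj (h : IsLayering G key root lab) {v : V} (hv : lab v = lab (root v) + 1) :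
    G.Adj (root v) v := by
  obtain ⟨w, hw, hl⟩ := h.exists_parent v (by intro hc; rw [← hc] at hv; omega)
  have hr := h.root_eq_of_adj w v hw
  have := h.eq_root (v := w) (by rw [hr]; omega)
  rwa [← hr, ← this]

theorem close_root (h : IsLayering G key root lab) {v : V} (hv : lab v ≤ lab (root v) + 2) :
    Close G v (root v) := by
  have h0 := h.lab_root_le v
  rcases (by omega : lab v ≤ lab (root v) ∨ lab v = lab (root v) + 1 ∨
    lab v = lab (root v) + 2) with h1 | h1 | h1
  · rw [← h.eq_root h1]
    exact ⟨v, Or.inl rfl, Or.inl rfl⟩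
  · exact ⟨root v, Or.inr (h.root_adj h1), Or.inl rfl⟩
  · obtain ⟨w, hw, hl⟩ := h.exists_parent v (by intro hc; rw [← hc] at h1; omega)
    have hr := h.root_eq_of_adj w v hw
    have := h.root_adj (v := w) (by rw [hr]; omega)
    rw [hr] at this
    exact ⟨w, Or.inr hw, Or.inr this.symm⟩

variable {a b : V → ℝ}

/-- On the right of the root, labels increase with left endpoints. -/
theorem lab_mono (h : IsLayering G key root lab) (hab : IsRep G a b) {u v : V}
    (hr : root u = root v) (hu : a (root v) ≤ b u) (huv : a u ≤ a v) (hv : v ≠ root v) :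
    lab u ≤ lab v := by
  induction hm : lab v using Nat.strong_induction_on generalizing v with
  | _ m ih =>
    subst hm
    -- If `u` meets the root, it is at most one layer above it. Otherwise look at a parent `w` of
    -- `v`: if `w` starts before `u`, it meets `u` because `a u ≤ a v ≤ b w`; if it starts after
    -- `u`, the induction hypothesis applies to `w`.
    by_cases h1 : a u ≤ b (root v)
    · have h2 := h.lab_root_lt v hv
      by_cases h3 : root v = u
      · rw [← h3]; exact h2.le
      · have := h.lab_le _ _ (hab.adj h3 hu h1)
        omega
    · obtain ⟨w, hw, hl⟩ := h.exists_parent v hv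
      have hrw := h.root_eq_of_adj w v hw
      obtain ⟨-, h4, h5⟩ := (hab.adj_iff w v).1 hw
      by_cases h6 : a w ≤ a u
      · by_cases h7 : w = u
        · rw [← h7]; omega
        · have := h.lab_le _ _ (hab.adj h7 (h6.trans (hab.le u)) (huv.trans h5))
          omega
      · have := ih (lab w) (by omega) (v := w) (by rw [hr, hrw]) (by rwa [hrw])
          (not_le.1 h6).le (by
            intro hc
            rw [hrw] at hc
            rw [hc] at h5
            exact h1 (huv.trans h5)) rfl
        omega

/-- On the right of the root, the parents of a vertex are parents of all vertices of its
layer that start earlier. -/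
theorem parent_adj (h : IsLayering G key root lab) (hab : IsRep G a b) {u v w : V}
    (hu : a (root v) ≤ b u) (huv : a u ≤ a v) (hl : lab u = lab v)
    (hw : G.Adj w v) (hlw : lab v = lab w + 1) : G.Adj w u := by
  have hr := h.root_eq_of_lab_eq u v hl
  have hrw := h.root_eq_of_adj w v hw
  by_cases hc : w = root v
  · have := h.root_adj (v := u) (by rw [hr, ← hc]; omega)
    rwa [hr, ← hc] at this
  -- If `w` started after `u`, monotonicity would put `u` no later than the layer of its supposed
  -- parent `w`.
  · have h6 : a w ≤ a u := by
      by_contra h6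
      have := h.lab_mono hab (u := u) (v := w) (by rw [hr, hrw]) (by rwa [hrw])
        (not_le.1 h6).le (by rwa [hrw])
      omega
    obtain ⟨-, h4, h5⟩ := (hab.adj_iff w v).1 hw
    exact hab.adj (by rintro rfl; omega) (h6.trans (hab.le u)) (huv.trans h5)

/-- On the right of the root, the vertices of a layer that have neighbours in the next layer
form a clique. -/
theorem adj_of_adj_succ (h : IsLayering G key root lab) (hab : IsRep G a b) {u y w v : V}
    (hl : lab u = lab y) (hy : y ≠ root y) (huw : G.Adj u w) (hyv : G.Adj y v)
    (hlw : lab w = lab u + 1) (hlv : lab v = lab u + 1)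
    (hw : a (root y) ≤ b w) (hv : a (root y) ≤ b v) : u = y ∨ G.Adj u y := by
  by_contra! hc
  have hr := h.root_eq_of_lab_eq u y hl
  have hrw := h.root_eq_of_adj u w huw
  have hrv := h.root_eq_of_adj y v hyv
  have h1 := (hab.adj_iff _ _).1 huw
  have h2 := (hab.adj_iff _ _).1 hyv
  have h3 : ¬ (a u ≤ b y ∧ a y ≤ b u) := fun h3 => hc.2 (hab.adj hc.1 h3.1 h3.2)
  -- The intervals of `u` and `y` are disjoint. The next-layer neighbour of the left one starts
  -- before the right one does, so by monotonicity it cannot lie in a later layer.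
  rcases not_and_or.1 h3 with h3 | h3
  · have := h.lab_mono hab (u := v) (v := u) (by rw [← hrv, hr]) (by rwa [hr])
      (by linarith) (by
        intro hu
        have := h.lab_root_lt y hy
        rw [← hr, ← hu] at this
        omega)
    omega
  · have := h.lab_mono hab (u := w) (v := y) (by rw [← hrw, hr]) hw (by linarith) hy
    omega

end IsLayering

/-! ### The second search starts at an end -/

section Extreme

open scoped Classical in
/-- The number of neighbours in the previous layer. -/
noncomputable def downDegree {V : Type*} [Fintype V] (G : SimpleGraph V) (lab : V → ℕ) (v : V) :
    ℕ :=
  (Finset.univ.filter fun w => G.Adj v w ∧ lab w + 1 = lab v).card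

open scoped Classical in
/-- The number of neighbours in the next layer. -/
noncomputable def upDegree {V : Type*} [Fintype V] (G : SimpleGraph V) (lab : V → ℕ) (v : V) :
    ℕ :=
  (Finset.univ.filter fun w => G.Adj v w ∧ lab w = lab v + 1).card

variable {V : Type*} [Fintype V] {G : SimpleGraph V} {key : V → ℕ} {root : V → V} {lab : V → ℕ}
  {a b : V → ℝ}

/-- A vertex of the last layer with the fewest neighbours in the layer before, on the right of
the root, is dominated together with its second neighbourhood, and everything else lies on
its left. -/
theorem IsLayering.exists_dominating_right (h : IsLayering G key root lab) (hab : IsRep G a b)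
    {s : V} (hmax : ∀ v, root v = root s → lab v ≤ lab s)
    (hmin : ∀ v, lab v = lab s → downDegree G lab s ≤ downDegree G lab v)
    (hs : b (root s) < a s) :
    ∃ c, (∀ u, Close G u s → u = c ∨ G.Adj u c) ∧
      ∀ u, root u = root s → ¬ Close G u s → b u < a s := by
  classical
  set t := root s with ht
  have hat := hab.le t
  have hst : s ≠ root s := by
    intro hc; rw [← hc] at ht; rw [ht] at hs
    exact absurd (hab.le s) (not_le.2 hs)
  obtain ⟨w0, hw0, hl0⟩ := h.exists_parent s hst
  -- The dominating vertex is the neighbour of `s` in the previous layer that reaches furthest to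
  -- the left.
  obtain ⟨c, hcm, hcmin⟩ := Finset.exists_min_image
    (Finset.univ.filter fun w => G.Adj s w ∧ lab w + 1 = lab s) a
    ⟨w0, by simp [hw0.symm, hl0]⟩
  simp only [Finset.mem_filter, Finset.mem_univ, true_and] at hcm hcmin
  obtain ⟨hsc, hlc⟩ := hcm
  have hrc := h.root_eq_of_adj s c hsc
  have hct : c ≠ root c := by
    rw [← hrc, ← ht]
    intro hc
    have := (hab.adj_iff s c).1 hsc
    rw [hc] at this
    linarith
  obtain ⟨-, hsc1, hsc2⟩ := (hab.adj_iff s c).1 hsc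
  -- A vertex starting after `s` is in the last layer too, and its parents are parents of `s`. As
  -- `s` has the fewest parents, the two sets of parents coincide, so `c` is among them.
  have key1 : ∀ u, root u = t → a s ≤ a u → lab u = lab s ∧ G.Adj u c := by
    intro u hu hle
    have hut : u ≠ root u := by
      rw [hu]; rintro rfl; linarith
    have h1 := h.lab_mono hab (u := s) (v := u) (by rw [hu]) (by
      rw [hu]; have := hab.le s; linarith) hle hut
    have h2 : lab u = lab s := le_antisymm (hmax u hu) h1
    refine ⟨h2, ?_⟩
    have hsub : (Finset.univ.filter fun w => G.Adj u w ∧ lab w + 1 = lab u) ⊆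
        (Finset.univ.filter fun w => G.Adj s w ∧ lab w + 1 = lab s) := by
      intro w
      simp only [Finset.mem_filter, Finset.mem_univ, true_and]
      rintro ⟨hw, hlw⟩
      refine ⟨(h.parent_adj hab (u := s) (v := u) ?_ hle h2.symm hw.symm hlw.symm).symm,
        by omega⟩
      rw [hu]; have := hab.le s; linarith
    have heq := Finset.eq_of_subset_of_card_le hsub (hmin u h2)
    have hmem : c ∈ (Finset.univ.filter fun w => G.Adj u w ∧ lab w + 1 = lab u) := by
      rw [heq]; simp [hsc, hlc]
    exact (by simpa using hmem : G.Adj u c ∧ _).1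
  have hcs : a c < a s := by
    by_contra hcs
    have := (key1 c hrc.symm (not_lt.1 hcs)).1
    omega
  have key2 : ∀ u, root u = t → a s ≤ b u → u = c ∨ G.Adj u c := by
    intro u hu hle
    by_cases h1 : a s ≤ a u
    · exact Or.inr (key1 u hu h1).2
    · by_cases h2 : u = c
      · exact Or.inl h2
      · exact Or.inr (hab.adj h2 (by linarith) (by linarith))
  have hrs : ∀ u, Close G u s → root u = t := by
    rintro u ⟨w, h1, h2⟩
    have h3 : root w = root u := by
      rcases h1 with rfl | h1
      · rfl
      · exact h.root_eq_of_adj _ _ h1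
    have h4 : root w = root s := by
      rcases h2 with rfl | h2
      · rfl
      · exact h.root_eq_of_adj _ _ h2
    rw [← h3, h4]
  refine ⟨c, fun u hu => ?_, fun u hu hcl => ?_⟩
  · by_cases h1 : a s ≤ b u
    · exact key2 u (hrs u hu) h1
    · have hus : ¬ G.Adj u s := fun hc => h1 ((hab.adj_iff u s).1 hc).2.2
      have hne : u ≠ s := by rintro rfl; exact h1 (hab.le u)
      obtain ⟨w, hwu, hws⟩ := hu
      have hwu' : G.Adj w u := by
        rcases hwu with rfl | hwu
        · rcases hws with rfl | hws
          · exact absurd rfl hne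
          · exact absurd hws hus
        · exact hwu
      have hws' : G.Adj w s := by
        rcases hws with rfl | hws
        · exact absurd hwu'.symm hus
        · exact hws
      obtain ⟨-, h2, h3⟩ := (hab.adj_iff w u).1 hwu'
      obtain ⟨-, h4, h5⟩ := (hab.adj_iff w s).1 hws'
      have hrw := h.root_eq_of_adj w s hws'
      have hlw1 := h.lab_le w s hws'
      have hlw2 := hmax w hrw
      -- A common neighbour in the previous layer competes with `c` in the minimum; one in the last
      -- layer cannot start before `c` by monotonicity.
      have hcw : a c ≤ a w := by
        by_cases h6 : lab w + 1 = lab s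
        · exact hcmin w ⟨hws'.symm, h6⟩
        · by_contra h7
          have := h.lab_mono hab (u := w) (v := c) (by rw [hrw, hrc])
            (by rw [← hrc, ← ht]; linarith) (not_le.1 h7).le hct
          omega
      right
      have := hab.le u
      refine hab.adj ?_ (by linarith) (by linarith)
      rintro rfl
      linarith
  · by_contra h1
    rcases key2 u hu (not_lt.1 h1) with h2 | h2
    · exact hcl ⟨u, Or.inl rfl, Or.inr (h2 ▸ hsc.symm)⟩
    · exact hcl ⟨c, Or.inr h2.symm, Or.inr hsc.symm⟩

/-- A vertex of the last layer with the fewest neighbours in the layer before is dominated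
together with its second neighbourhood, and everything else lies on one side of it. -/
theorem IsLayering.exists_dominating (h : IsLayering G key root lab) (hab : IsRep G a b)
    {s : V} (hmax : ∀ v, root v = root s → lab v ≤ lab s)
    (hmin : ∀ v, lab v = lab s → downDegree G lab s ≤ downDegree G lab v) :
    ∃ c, (∀ u, Close G u s → u = c ∨ G.Adj u c) ∧
      ((∀ u, root u = root s → ¬ Close G u s → b u < a s) ∨
        ∀ u, root u = root s → ¬ Close G u s → b s < a u) := by
  by_cases h1 : b (root s) < a s
  · obtain ⟨c, hc, h2⟩ := h.exists_dominating_right hab hmax hmin h1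
    exact ⟨c, hc, Or.inl h2⟩
  by_cases h1' : b s < a (root s)
  · obtain ⟨c, hc, h2⟩ := h.exists_dominating_right hab.reflect hmax hmin (neg_lt_neg h1')
    exact ⟨c, hc, Or.inr fun u hu hu' => neg_lt_neg_iff.1 (h2 u hu hu')⟩
  -- In the remaining case `s` meets the root. The last layer is then at most the first one, so the
  -- root dominates the whole component and nothing is far from `s`.
  have hs : lab s ≤ lab (root s) + 1 := by
    by_cases hc : root s = s
    · rw [hc]; omega
    · exact h.lab_le _ _ (hab.adj hc (not_lt.1 h1') (not_lt.1 h1))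
  have key : ∀ u, root u = root s → u = root s ∨ G.Adj u (root s) := by
    intro u hu
    have h2 := hmax u hu
    have h3 := h.lab_root_le u
    have h5 : lab (root u) = lab (root s) := by rw [hu]
    rcases (by omega : lab u ≤ lab (root u) ∨ lab u = lab (root u) + 1) with h4 | h4
    · left; rw [← hu]; exact h.eq_root h4
    · right; rw [← hu]; exact (h.root_adj h4).symm
  refine ⟨root s, fun u hu => key u ?_, Or.inl fun u hu hcl => ?_⟩
  · obtain ⟨w, h1, h2⟩ := hu
    have h3 : root w = root u := by
      rcases h1 with rfl | h1
      · rfl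
      · exact h.root_eq_of_adj _ _ h1
    have h4 : root w = root s := by
      rcases h2 with rfl | h2
      · rfl
      · exact h.root_eq_of_adj _ _ h2
    rw [← h3, h4]
  · refine absurd ⟨root s, ?_, ?_⟩ hcl
    · rcases key u hu with h | h
      · exact Or.inl h.symm
      · exact Or.inr h.symm
    · rcases key s rfl with h | h
      · exact Or.inl h.symm
      · exact Or.inr h.symm

end Extreme

/-! ### The layering of the second search -/

section Tidy

/-- The properties of the layers of a breadth-first search of an interval graph that starts
at an end. -/
structure IsTidy {V : Type*} (G : SimpleGraph V) (lab : V → ℕ) : Prop where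
  lab_le : ∀ u v, G.Adj u v → lab v ≤ lab u + 1
  close_of_eq : ∀ u v, lab u = lab v → Close G u v
  close_of_succ : ∀ u v w, G.Adj u w → lab w = lab u + 1 → lab v = lab u + 1 → Close G u v
  nested : ∀ m, (∀ w w' v v', lab w = m → lab w' = m → lab v = m + 1 → lab v' = m + 1 →
      G.Adj w v → G.Adj w' v' → G.Adj w v' ∨ G.Adj w' v) ∨
    ∃ c, lab c = m ∧ ∀ u, u ≠ c → lab u ≤ m + 1 → m ≤ lab u + 1 → G.Adj u c

variable {V : Type*} {G : SimpleGraph V} {a b : V → ℝ}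

/-! ### Tidiness of a search that starts at an end. -/

namespace IsLayering

variable {key : V → ℕ} {root : V → V} {lab : V → ℕ}

/-- Of two vertices of a layer on the right of the root, the one that starts first is adjacent to
every parent of the other, so they share a parent. -/
theorem close_of_lab_eq_left (h : IsLayering G key root lab) (hab : IsRep G a b) {u v : V}
    (hu : a (root u) ≤ b u) (hv : a (root v) ≤ b v) (hl : lab u = lab v) : Close G u v := by
  wlog huv : a u ≤ a v generalizing u v
  · exact (this hv hu hl.symm (not_le.1 huv).le).symm
  have hr := h.root_eq_of_lab_eq u v hl
  by_cases hc : v = root v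
  · have := h.eq_root (v := u) (by rw [hr, ← hc, hl])
    exact ⟨u, Or.inl rfl, Or.inl (by rw [this, hr, ← hc])⟩
  · obtain ⟨w, hw, hlw⟩ := h.exists_parent v hc
    exact ⟨w, Or.inr (h.parent_adj hab (hr ▸ hu) huv hl hw hlw), Or.inr hw⟩

/-- If everything far from the root lies on its right, and the second neighbourhood of the
root is dominated, then the layering is tidy. -/
theorem isTidy_of_right (h : IsLayering G key root lab) (hab : ∀ v, ∃ a b, IsRep G a b ∧
      ∀ u, root u = root v → ¬ Close G u (root v) → a (root v) ≤ b u)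
    (hdom : ∀ v, ∃ c, ∀ u, Close G u (root v) → u = c ∨ G.Adj u c) :
    IsTidy G lab := by
  -- Used in the contrapositive: from the third layer above the root on, vertices are not close to
  -- the root and hence lie on its right. The lower layers are left to the dominating vertex.
  have hfar : ∀ u, Close G u (root u) → lab u ≤ lab (root u) + 2 := by
    rintro u ⟨w, h1, h2⟩
    have h3 : lab u ≤ lab w + 1 := by
      rcases h1 with rfl | h1
      · omega
      · exact h.lab_le _ _ h1
    have h4 : lab w ≤ lab (root u) + 1 := by
      rcases h2 with rfl | h2
      · omega
      · exact h.lab_le _ _ h2.symm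
    omega
  refine ⟨h.lab_le, fun u v hl => ?_, fun u v w huw hw hv => ?_, fun m => ?_⟩
  · have hr := h.root_eq_of_lab_eq u v hl
    have hlr : lab (root u) = lab (root v) := by rw [hr]
    by_cases h2 : lab v ≤ lab (root v) + 2
    · obtain ⟨c, hc⟩ := hdom v
      refine ⟨c, ?_, ?_⟩
      · exact (hc u (by rw [← hr]; exact h.close_root (by omega))).imp Eq.symm SimpleGraph.Adj.symm
      · exact (hc v (h.close_root h2)).imp Eq.symm SimpleGraph.Adj.symm
    · obtain ⟨a, b, hab, hri⟩ := hab v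
      refine h.close_of_lab_eq_left hab ?_ ?_ hl
      · rw [hr]
        exact hri u hr fun hc => by
          have := hfar u (by rwa [hr]); omega
      · exact hri v rfl fun hc => by have := hfar v hc; omega
  · have hr1 := h.root_eq_of_adj u w huw
    have hr2 := h.root_eq_of_lab_eq v w (by omega)
    have hl1 : lab (root u) = lab (root v) := by rw [hr1, hr2]
    have hl2 : lab (root w) = lab (root v) := by rw [hr2]
    have h0 := h.lab_root_le u
    by_cases h2 : lab v ≤ lab (root v) + 2
    · obtain ⟨c, hc⟩ := hdom v
      refine ⟨c, ?_, ?_⟩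
      · exact (hc u (by rw [hr2, ← hr1]; exact h.close_root (by omega))).imp
          Eq.symm SimpleGraph.Adj.symm
      · exact (hc v (h.close_root h2)).imp Eq.symm SimpleGraph.Adj.symm
    -- Both `u` and the parent `y` of `v` have neighbours in the next layer, so they are equal or
    -- adjacent, and `y` witnesses closeness.
    · obtain ⟨y, hy, hly⟩ := h.exists_parent v (by intro hc; rw [← hc] at h2; omega)
      have hry := h.root_eq_of_adj y v hy
      have hl3 : lab (root y) = lab (root v) := by rw [hry]
      obtain ⟨a, b, hab, hri⟩ := hab v
      have := h.adj_of_adj_succ hab (u := u) (y := y) (w := w) (v := v) (by omega)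
        (by intro hc; rw [← hc] at hl3; omega) huw hy hw hv
        (by
          rw [hry]
          exact hri w hr2.symm fun hc => by have := hfar w (by rwa [← hr2]); omega)
        (by
          rw [hry]
          exact hri v rfl fun hc => by have := hfar v hc; omega)
      exact ⟨y, this.imp Eq.symm SimpleGraph.Adj.symm, Or.inr hy⟩
  -- The case that `m` is the first layer above a root and that root also has a second layer. Here
  -- nestedness is not claimed; the dominating vertex takes its place.
  · by_cases hex : ∃ v, lab v = m + 1 ∧ lab (root v) + 1 = m
    · obtain ⟨v, hv, hrv⟩ := hex
      obtain ⟨c, hc⟩ := hdom v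
      by_cases hcr : c = root v
      · rcases hc v (h.close_root (by omega)) with h1 | h1
        · rw [← hcr, ← h1] at hrv; omega
        · rw [hcr] at h1
          have := h.lab_le _ _ h1.symm
          omega
      · have hrc : G.Adj (root v) c := by
          rcases hc (root v) ⟨_, Or.inl rfl, Or.inl rfl⟩ with h1 | h1
          · exact absurd h1.symm hcr
          · exact h1
        have hcroot : root c = root v := by rw [← h.root_eq_of_adj _ _ hrc, h.root_root]
        have hlc : lab c = m := by
          have h1 := h.lab_le _ _ hrc
          have h2 := h.lab_root_lt c (by rwa [hcroot])
          rw [hcroot] at h2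
          omega
        refine Or.inr ⟨c, hlc, fun u hne h1 h2 => ?_⟩
        have hru : root u = root v := by
          rcases (by omega : lab u = lab (root v) ∨ lab u = lab c ∨ lab u = lab v) with h3 | h3 | h3
          · rw [h.root_eq_of_lab_eq _ _ h3, h.root_root]
          · rw [h.root_eq_of_lab_eq _ _ h3, hcroot]
          · rw [h.root_eq_of_lab_eq _ _ h3]
        rcases hc u (by rw [← hru]; exact h.close_root (by rw [hru]; omega)) with h3 | h3
        · exact absurd h3 hne
        · exact h3
    · left
      intro w w' v v' hw hw' hv hv' hwv hwv'
      have hrv := h.root_eq_of_adj _ _ hwv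
      have hrw := h.root_eq_of_lab_eq w w' (by omega)
      have hrv' := h.root_eq_of_lab_eq v v' (by omega)
      have hl0 := h.lab_root_le w
      have hl1 : lab (root w) = lab (root v) := by rw [hrv]
      have hl2 : lab (root v') = lab (root v) := by rw [hrv']
      -- Either `m` is the layer of the root alone, or `v` and `v'` are at least three layers above
      -- the root, hence on its right, where the one starting first inherits the parents of the
      -- other.
      have hne : lab (root v) + 1 ≠ m := fun hc => hex ⟨v, hv, hc⟩
      by_cases h0 : lab (root v) = m
      · have e1 := h.eq_root (v := w) (by omega)
        have e2 := h.eq_root (v := w') (by rw [← hrw]; omega)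
        rw [e1, hrw, ← e2]
        exact Or.inl hwv'
      · obtain ⟨a, b, hab, hri⟩ := hab v
        have g1 : a (root v) ≤ b v := hri v rfl fun hc => by have := hfar v hc; omega
        have g2 : a (root v) ≤ b v' := hri v' hrv'.symm fun hc => by
          have := hfar v' (by rwa [← hrv']); omega
        rcases le_total (a v) (a v') with hle | hle
        · exact Or.inr (h.parent_adj hab (by rwa [← hrv']) hle (by omega) hwv' (by omega))
        · exact Or.inl (h.parent_adj hab (by assumption) hle (by omega) hwv (by omega))

end IsLayering

/-! ### The choice of the start of the second search. -/

variable [Fintype V]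

/-- The rank of a vertex with respect to a layering: layers first, and within a layer by
decreasing number of neighbours in the layer before. -/
noncomputable def layerKey (G : SimpleGraph V) (lab : V → ℕ) (v : V) : ℕ :=
  lab v * (Fintype.card V + 1) + (Fintype.card V - downDegree G lab v)

theorem downDegree_le (G : SimpleGraph V) (lab : V → ℕ) (v : V) :
    downDegree G lab v ≤ Fintype.card V := Finset.card_le_univ _

theorem layerKey_lt_iff (G : SimpleGraph V) (lab : V → ℕ) (u v : V) :
    layerKey G lab u < layerKey G lab v ↔
      lab u < lab v ∨ lab u = lab v ∧ downDegree G lab v < downDegree G lab u := by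
  have hu := downDegree_le G lab u
  have hv := downDegree_le G lab v
  unfold layerKey
  rcases lt_trichotomy (lab u) (lab v) with h | h | h
  · have : (lab u + 1) * (Fintype.card V + 1) ≤ lab v * (Fintype.card V + 1) :=
      Nat.mul_le_mul_right _ h
    simp only [h, true_or, iff_true]
    rw [add_mul] at this
    omega
  · simp only [h, lt_irrefl, true_and, false_or]
    omega
  · have : (lab v + 1) * (Fintype.card V + 1) ≤ lab u * (Fintype.card V + 1) :=
      Nat.mul_le_mul_right _ h
    rw [add_mul] at this
    constructor
    · intro; omega
    · rintro (h1 | h1) <;> omega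

/-- A search from starts of maximal `layerKey` of a first search is tidy. -/
theorem IsLayering.isTidy_of_layerKey {key : V → ℕ} {root₁ root₂ : V → V} {lab₁ lab₂ : V → ℕ}
    (hG : IsIntervalGraph G) (h₁ : IsLayering G key root₁ lab₁)
    (h₂ : IsLayering G (layerKey G lab₁) root₂ lab₂) : IsTidy G lab₂ := by
  obtain ⟨a, b, hab⟩ := hG.exists_isRep
  have main : ∀ v, ∃ c, (∀ u, Close G u (root₂ v) → u = c ∨ G.Adj u c) ∧
      ((∀ u, root₁ u = root₁ (root₂ v) → ¬ Close G u (root₂ v) → b u < a (root₂ v)) ∨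
        ∀ u, root₁ u = root₁ (root₂ v) → ¬ Close G u (root₂ v) → b (root₂ v) < a u) := by
    intro v
    -- Each root function is constant along edges, hence on the components of the other search. So
    -- both searches have the same components, and `root₂ v` has maximal key among the vertices that
    -- the first search reaches from the same root.
    have hk : ∀ u, root₁ u = root₁ (root₂ v) →
        layerKey G lab₁ u ≤ layerKey G lab₁ (root₂ v) := by
      intro u hu
      have e1 := h₁.eq_root_of_adj_invariant root₂ h₂.root_eq_of_adj u
      have e2 := h₁.eq_root_of_adj_invariant root₂ h₂.root_eq_of_adj (root₂ v)
      rw [hu, ← e2, h₂.root_root] at e1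
      rw [← e1]
      exact h₂.key_le u
    apply h₁.exists_dominating hab
    · intro u hu
      by_contra hc
      exact absurd (hk u hu) (not_le.2 ((layerKey_lt_iff _ _ _ _).2 (Or.inl (not_le.1 hc))))
    · intro u hu
      by_contra hc
      exact absurd (hk u (h₁.root_eq_of_lab_eq _ _ hu))
        (not_le.2 ((layerKey_lt_iff _ _ _ _).2 (Or.inr ⟨hu.symm, (not_le.1 hc)⟩)))
  have hroot : ∀ u v, root₂ u = root₂ v → root₁ u = root₁ (root₂ v) := by
    intro u v huv
    rw [h₂.eq_root_of_adj_invariant root₁ h₁.root_eq_of_adj u, huv]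
  -- The side on which the far vertices lie may vary with the component, so the representation is
  -- reflected, or not, for each `v` separately.
  refine h₂.isTidy_of_right (fun v => ?_) (fun v => ?_)
  · obtain ⟨c, -, hc | hc⟩ := main v
    · refine ⟨_, _, hab.reflect, fun u hu hcl => ?_⟩
      have := hc u (hroot u v hu) hcl
      have := hab.le u
      have := hab.le (root₂ v)
      linarith
    · refine ⟨_, _, hab, fun u hu hcl => ?_⟩
      have := hc u (hroot u v hu) hcl
      have := hab.le u
      have := hab.le (root₂ v)
      linarith
  · obtain ⟨c, hc, -⟩ := main v
    exact ⟨c, hc⟩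

/-! ### An interval representation of the square -/

open scoped Classical in
/-- The number of vertices in the layers before layer `m`. -/
noncomputable def belowCard (lab : V → ℕ) (m : ℕ) : ℕ :=
  (Finset.univ.filter fun w => lab w < m).card

open scoped Classical in
/-- `1` if there is a neighbour in the next layer, and `0` if not. -/
noncomputable def upStep (G : SimpleGraph V) (lab : V → ℕ) (v : V) : ℕ :=
  if 0 < upDegree G lab v then 1 else 0

open scoped Classical in
/-- The left end of a vertex in the representation of the square of the graph. -/
noncomputable def leftEnd (G : SimpleGraph V) (lab : V → ℕ) (v : V) : ℕ :=
  (Finset.univ.filter fun w => layerKey G lab w < layerKey G lab v).card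

open scoped Classical in
/-- How far into the layer after layer `lab v + upStep G lab v` the vertex reaches. -/
noncomputable def maxUp (G : SimpleGraph V) (lab : V → ℕ) (v : V) : ℕ :=
  (Finset.univ.filter fun w => G.Adj v w ∧ lab w = lab v + upStep G lab v).sup
    (upDegree G lab)

/-- The right end of a vertex in the representation of the square of the graph. -/
noncomputable def rightEnd (G : SimpleGraph V) (lab : V → ℕ) (v : V) : ℕ :=
  belowCard lab (lab v + 1 + upStep G lab v) + maxUp G lab v

open scoped Classical in
/-- The position of a vertex in its layer. -/
noncomputable def layerRank (G : SimpleGraph V) (lab : V → ℕ) (v : V) : ℕ :=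
  (Finset.univ.filter fun w => lab w = lab v ∧ downDegree G lab v < downDegree G lab w).card

variable {lab : V → ℕ}

theorem belowCard_mono (lab : V → ℕ) {m m' : ℕ} (h : m ≤ m') :
    belowCard lab m ≤ belowCard lab m' := by
  classical
  refine Finset.card_le_card fun w => ?_
  simp only [Finset.mem_filter, Finset.mem_univ, true_and]
  omega

open scoped Classical in
theorem belowCard_succ (lab : V → ℕ) (m : ℕ) :
    belowCard lab (m + 1) = belowCard lab m + (Finset.univ.filter fun w => lab w = m).card := by
  unfold belowCard
  rw [← Finset.card_union_of_disjoint]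
  · congr 1
    ext w
    simp only [Finset.mem_filter, Finset.mem_univ, true_and, Finset.mem_union]
    omega
  · rw [Finset.disjoint_left]
    intro w
    simp only [Finset.mem_filter, Finset.mem_univ, true_and]
    omega

theorem leftEnd_eq (G : SimpleGraph V) (lab : V → ℕ) (v : V) :
    leftEnd G lab v = belowCard lab (lab v) + layerRank G lab v := by
  classical
  unfold leftEnd belowCard layerRank
  rw [← Finset.card_union_of_disjoint]
  · congr 1
    ext w
    simp only [Finset.mem_filter, Finset.mem_univ, true_and, Finset.mem_union, layerKey_lt_iff]
  · rw [Finset.disjoint_left]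
    intro w
    simp only [Finset.mem_filter, Finset.mem_univ, true_and]
    omega

/-- Strict because `v` belongs to its layer but does not precede itself. -/
theorem layerRank_lt (G : SimpleGraph V) (lab : V → ℕ) (v : V) :
    belowCard lab (lab v) + layerRank G lab v < belowCard lab (lab v + 1) := by
  classical
  rw [belowCard_succ]
  apply Nat.add_lt_add_left
  refine Finset.card_lt_card ⟨fun w => ?_, fun h => ?_⟩
  · simp only [Finset.mem_filter, Finset.mem_univ, true_and]
    exact fun h => h.1
  · have := h (by simp : v ∈ _)
    simp at this

theorem leftEnd_lt_rightEnd_of_lab_le (G : SimpleGraph V) (lab : V → ℕ) {u v : V}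
    (h : lab u ≤ lab v) : leftEnd G lab u < rightEnd G lab v := by
  rw [leftEnd_eq]
  have := layerRank_lt G lab u
  have := belowCard_mono lab (by omega : lab u + 1 ≤ lab v + 1 + upStep G lab v)
  unfold rightEnd
  omega

theorem upDegree_le (G : SimpleGraph V) (lab : V → ℕ) (w : V) :
    belowCard lab (lab w + 1) + upDegree G lab w ≤ belowCard lab (lab w + 2) := by
  classical
  rw [belowCard_succ lab (lab w + 1)]
  apply Nat.add_le_add_left
  unfold upDegree
  refine Finset.card_le_card fun x => ?_
  simp only [Finset.mem_filter, Finset.mem_univ, true_and]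
  exact fun h => h.2

theorem maxUp_le (G : SimpleGraph V) (lab : V → ℕ) (v : V) :
    rightEnd G lab v ≤ belowCard lab (lab v + 2 + upStep G lab v) := by
  classical
  unfold rightEnd
  have : maxUp G lab v ≤ belowCard lab (lab v + 2 + upStep G lab v) -
      belowCard lab (lab v + 1 + upStep G lab v) := by
    refine Finset.sup_le fun w hw => ?_
    simp only [Finset.mem_filter, Finset.mem_univ, true_and] at hw
    have := upDegree_le G lab w
    rw [hw.2, (by omega : lab v + upStep G lab v + 1 = lab v + 1 + upStep G lab v),
      (by omega : lab v + upStep G lab v + 2 = lab v + 2 + upStep G lab v)] at this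
    omega
  have := belowCard_mono lab (by omega : lab v + 1 + upStep G lab v ≤ lab v + 2 + upStep G lab v)
  omega

theorem belowCard_le (lab : V → ℕ) (m : ℕ) : belowCard lab m ≤ Fintype.card V :=
  Finset.card_le_univ _

theorem rightEnd_le (G : SimpleGraph V) (lab : V → ℕ) (v : V) :
    rightEnd G lab v ≤ Fintype.card V :=
  (maxUp_le G lab v).trans (belowCard_le _ _)

theorem exists_of_upDegree_pos {u : V} (h : 0 < upDegree G lab u) :
    ∃ w, G.Adj u w ∧ lab w = lab u + 1 := by
  classical
  obtain ⟨w, hw⟩ := Finset.card_pos.1 h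
  exact ⟨w, by simpa using hw⟩

theorem upDegree_pos {u w : V} (h : G.Adj u w) (hl : lab w = lab u + 1) :
    0 < upDegree G lab u := by
  classical
  exact Finset.card_pos.2 ⟨w, by simp [h, hl]⟩

/-- A layer is reached from the vertices before it in the order of the layer. -/
theorem IsTidy.layerRank_lt_maxUp_iff (h : IsTidy G lab) {u v : V} {m : ℕ}
    (hm : m = lab u + upStep G lab u) (hv : lab v = m + 1) :
    layerRank G lab v < maxUp G lab u ↔ ∃ w, G.Adj u w ∧ lab w = m ∧ G.Adj w v := by
  classical
  have hstep : upStep G lab u ≤ 1 := by unfold upStep; split_ifs <;> omega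
  unfold maxUp
  rw [← hm, Finset.lt_sup_iff]
  simp only [Finset.mem_filter, Finset.mem_univ, true_and]
  rcases h.nested m with hn | ⟨c, hc, hdom⟩
  -- If `w` sees `x` but not `y`, nestedness makes every parent of `y` a parent of `x`, and `w` is
  -- one more. Hence the neighbours of `w` in the next layer form an initial segment in the order of
  -- decreasing `downDegree`, and rank below `upDegree` means adjacency.
  · have hlt : ∀ w x y, lab w = m → lab x = m + 1 → lab y = m + 1 → G.Adj w x → ¬ G.Adj w y →
        downDegree G lab y < downDegree G lab x := by
      intro w x y hw hx hy hwx hwy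
      refine Finset.card_lt_card ⟨fun z => ?_, fun hsub => ?_⟩
      · simp only [Finset.mem_filter, Finset.mem_univ, true_and]
        rintro ⟨h1, h2⟩
        refine ⟨?_, by omega⟩
        rcases hn w z x y hw (by omega) hx hy hwx h1.symm with h3 | h3
        · exact absurd h3 hwy
        · exact h3.symm
      · have := hsub (by simp [hwx.symm, hw, hx] : w ∈ _)
        simp only [Finset.mem_filter, Finset.mem_univ, true_and] at this
        exact hwy this.1.symm
    refine exists_congr fun w => ?_
    rw [and_assoc]
    refine and_congr_right fun huw => and_congr_right fun hw => ?_
    constructor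
    · intro h1
      by_contra h2
      refine absurd h1 (not_lt.2 (Finset.card_le_card fun x => ?_))
      simp only [Finset.mem_filter, Finset.mem_univ, true_and]
      rintro ⟨h3, h4⟩
      exact ⟨by omega, hlt w x v hw (by omega) hv h3 h2⟩
    · intro h1
      refine Finset.card_lt_card ⟨fun x => ?_, fun hsub => ?_⟩
      · simp only [Finset.mem_filter, Finset.mem_univ, true_and]
        rintro ⟨h3, h4⟩
        refine ⟨?_, by omega⟩
        by_contra h5
        have := hlt w v x hw hv (by omega) h1 h5
        omega
      · have := hsub (by simp [h1, hw, hv] : v ∈ _)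
        simp at this
  -- Here both sides hold: `c` lies in layer `m`, is adjacent to `u` and `v`, and its upward
  -- neighbourhood is all of the next layer. The case `u = c` is excluded, since `v` would then
  -- force `upStep` to be one.
  · have hcv : G.Adj c v := (hdom v (by rintro rfl; omega) (by omega) (by omega)).symm
    have huc : G.Adj u c := by
      refine hdom u ?_ (by omega) (by omega)
      rintro rfl
      have := upDegree_pos (lab := lab) hcv (by omega)
      simp [upStep, this] at hm
      omega
    refine iff_of_true ⟨c, ⟨huc, hc⟩, ?_⟩ ⟨c, huc, hc, hcv⟩
    have h1 := layerRank_lt G lab v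
    have h2 : upDegree G lab c = (Finset.univ.filter fun w => lab w = m + 1).card := by
      unfold upDegree
      congr 1
      ext x
      simp only [Finset.mem_filter, Finset.mem_univ, true_and, hc]
      refine ⟨fun hx => hx.2, fun hx => ⟨(hdom x ?_ (by omega) (by omega)).symm, hx⟩⟩
      rintro rfl
      omega
    rw [belowCard_succ, hv] at h1
    omega

/-- The layer `lab u + 1 + upStep` is the last one that can contain vertices close to `u`.
Everything from the layer of `u` up to just before it is close by tidiness. In that last layer a
common neighbour has to lie in layer `lab u + upStep`, and the rank decides. Layers beyond lie past
the right end. -/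
theorem IsTidy.close_iff_of_lab_le (h : IsTidy G lab) {u v : V} (huv : lab u ≤ lab v) :
    Close G u v ↔ leftEnd G lab v < rightEnd G lab u := by
  classical
  rw [leftEnd_eq]
  have hrank := layerRank_lt G lab v
  rcases huv.eq_or_lt with h0 | h0
  · refine iff_of_true (h.close_of_eq u v h0) ?_
    rw [← leftEnd_eq]
    exact leftEnd_lt_rightEnd_of_lab_le G lab h0.ge
  by_cases h1 : lab v = lab u + 1 + upStep G lab u
  · unfold rightEnd
    rw [h1, Nat.add_lt_add_iff_left, h.layerRank_lt_maxUp_iff (u := u) rfl (by omega)]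
    constructor
    · rintro ⟨w, hw1, hw2⟩
      have hv1 : w ≠ v → lab v ≤ lab w + 1 := fun hne => by
        rcases hw2 with rfl | hw2
        · exact absurd rfl hne
        · exact h.lab_le _ _ hw2
      have hu1 : w ≠ u → lab w ≤ lab u + 1 := fun hne => by
        rcases hw1 with rfl | hw1
        · exact absurd rfl hne
        · exact h.lab_le _ _ hw1.symm
      by_cases hup : 0 < upDegree G lab u
      · have hs : upStep G lab u = 1 := by simp [upStep, hup]
        rcases hw1 with rfl | hw1
        · have := hv1 (by rintro rfl; omega)
          omega
        rcases hw2 with rfl | hw2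
        · have := hu1 (by rintro rfl; omega)
          omega
        have := h.lab_le _ _ hw1.symm
        have := h.lab_le _ _ hw2
        exact ⟨w, hw1.symm, by omega, hw2⟩
      · have hs : upStep G lab u = 0 := by simp [upStep, hup]
        rcases hw1 with rfl | hw1
        · rcases hw2 with rfl | hw2
          · omega
          · exact absurd (upDegree_pos (lab := lab) hw2 (by omega)) hup
        rcases hw2 with rfl | hw2
        · exact absurd (upDegree_pos (lab := lab) hw1.symm (by omega)) hup
        have h2 := h.lab_le _ _ hw1.symm
        have h3 := h.lab_le _ _ hw2
        have h4 : lab w ≠ lab u + 1 := fun hc => hup (upDegree_pos hw1.symm hc)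
        exact ⟨w, hw1.symm, by omega, hw2⟩
    · rintro ⟨w, hw1, -, hw2⟩
      exact ⟨w, Or.inr hw1.symm, Or.inr hw2⟩
  by_cases h2 : lab v < lab u + 1 + upStep G lab u
  · have hup : 0 < upDegree G lab u := by
      by_contra hc
      have : upStep G lab u = 0 := by simp [upStep, hc]
      omega
    have hs : upStep G lab u = 1 := by simp [upStep, hup]
    obtain ⟨w, hw, hlw⟩ := exists_of_upDegree_pos hup
    refine iff_of_true (h.close_of_succ u v w hw hlw (by omega)) ?_
    have := belowCard_mono lab (by omega : lab v + 1 ≤ lab u + 1 + upStep G lab u)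
    unfold rightEnd
    omega
  · refine iff_of_false ?_ ?_
    · rintro ⟨w, hw1, hw2⟩
      have h3 : lab w ≤ lab u + 1 := by
        rcases hw1 with rfl | hw1
        · omega
        · exact h.lab_le _ _ hw1.symm
      have h4 : lab v ≤ lab w + 1 := by
        rcases hw2 with rfl | hw2
        · omega
        · exact h.lab_le _ _ hw2
      by_cases hup : 0 < upDegree G lab u
      · have hs : upStep G lab u = 1 := by simp [upStep, hup]
        omega
      · have hs : upStep G lab u = 0 := by simp [upStep, hup]
        apply hup
        rcases hw1 with rfl | hw1
        · omega
        · exact upDegree_pos hw1.symm (by omega)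
    · have h3 := maxUp_le G lab u
      have h4 := belowCard_mono lab (by omega : lab u + 2 + upStep G lab u ≤ lab v)
      omega

/-- The ends represent the square of the graph. -/
theorem IsTidy.close_iff (h : IsTidy G lab) (u v : V) :
    Close G u v ↔ leftEnd G lab v < rightEnd G lab u ∧ leftEnd G lab u < rightEnd G lab v := by
  rcases le_total (lab u) (lab v) with h1 | h1
  · rw [h.close_iff_of_lab_le h1]
    exact ⟨fun h2 => ⟨h2, leftEnd_lt_rightEnd_of_lab_le G lab h1⟩, fun h2 => h2.1⟩
  · rw [show Close G u v ↔ Close G v u from ⟨Close.symm, Close.symm⟩, h.close_iff_of_lab_le h1]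
    exact ⟨fun h2 => ⟨leftEnd_lt_rightEnd_of_lab_le G lab h1, h2⟩, fun h2 => h2.2⟩

end Tidy

/-! ### Dynamic programming over cuts -/

section CutRecursion

/-- Improve the value of every `y > x` by a block of value `f y` between the cuts `x` and `y`. -/
def relaxCuts (f : ℕ → ℕ) (x : ℕ) (D : ℕ → ℕ) (y : ℕ) : ℕ :=
  if x < y then max (D y) (D x + f y) else D y

/-- Improve by the blocks of the colours below `j` that start at the cut `x`. -/
def relaxColors (f : ℕ → ℕ → ℕ → ℕ) (x : ℕ) (D : ℕ → ℕ) : ℕ → ℕ → ℕ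
  | 0 => D
  | j + 1 => relaxCuts (f j x) x (relaxColors f x D j)

/-- Improve by the blocks of the colours below `l` that start at cuts below `x`. -/
def cutValue (f : ℕ → ℕ → ℕ → ℕ) (l : ℕ) : ℕ → ℕ → ℕ
  | 0 => fun _ => 0
  | x + 1 => relaxColors f x (cutValue f l x) l

variable {f : ℕ → ℕ → ℕ → ℕ} {l : ℕ}

/-- Relaxing from `x` changes only later cuts. In particular the value at `x` itself is the same for
all colours, which also makes an update in place correct. -/
theorem relaxColors_of_le {x y : ℕ} {D : ℕ → ℕ} (h : y ≤ x) (j : ℕ) :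
    relaxColors f x D j y = D y := by
  induction j with
  | zero => rfl
  | succ j ih => rw [relaxColors, relaxCuts, if_neg (not_lt.2 h), ih]

theorem relaxColors_mono {x y : ℕ} {D : ℕ → ℕ} {i j : ℕ} (h : i ≤ j) :
    relaxColors f x D i y ≤ relaxColors f x D j y := by
  induction j, h using Nat.le_induction with
  | base => exact le_rfl
  | succ j _ ih =>
    refine ih.trans ?_
    rw [relaxColors, relaxCuts]
    split_ifs
    · exact le_max_left _ _
    · exact le_rfl

theorem cutValue_mono {x x' y : ℕ} (h : x ≤ x') : cutValue f l x y ≤ cutValue f l x' y := by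
  induction x', h using Nat.le_induction with
  | base => exact le_rfl
  | succ x' _ ih => exact ih.trans (relaxColors_mono (Nat.zero_le _))

/-- The value of `y` is final once all cuts below `y` have been processed. -/
theorem cutValue_eq {x y : ℕ} (h : y ≤ x) : cutValue f l x y = cutValue f l y y := by
  induction x, h using Nat.le_induction with
  | base => rfl
  | succ x hx ih => rw [cutValue, relaxColors_of_le hx, ih]

theorem add_le_cutValue {x y m j : ℕ} (hxy : x < y) (hx : x < m) (hj : j < l) :
    cutValue f l m x + f j x y ≤ cutValue f l m y := by
  rw [cutValue_eq hx.le]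
  refine le_trans ?_ (cutValue_mono (f := f) (l := l) (y := y) hx)
  rw [cutValue]
  refine le_trans ?_ (relaxColors_mono (i := j + 1) (by omega))
  rw [relaxColors, relaxCuts, if_pos hxy, relaxColors_of_le le_rfl]
  exact le_max_right _ _

/-- Every value comes from a chain of blocks. A property of pairs of a cut and an attained value
therefore only has to hold for zero and survive appending a block. -/
theorem cutValue_induction {Q : ℕ → ℕ → Prop} (h0 : ∀ y, Q y 0)
    (hs : ∀ x y j d, x < y → j < l → Q x d → Q y (d + f j x y)) (m y : ℕ) :
    Q y (cutValue f l m y) := by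
  induction m generalizing y with
  | zero => exact h0 y
  | succ m ih =>
    rw [cutValue]
    have : ∀ j ≤ l, ∀ y, Q y (relaxColors f m (cutValue f l m) j y) := by
      intro j
      induction j with
      | zero => exact fun _ y => ih y
      | succ j ihj =>
        intro hj y
        have ihj := ihj (by omega)
        rw [relaxColors, relaxCuts]
        split_ifs with hy
        · rcases max_choice (relaxColors f m (cutValue f l m) j y)
            (relaxColors f m (cutValue f l m) j m + f j m y) with h | h
          · rw [h]; exact ihj y
          · rw [h]; exact hs m y j _ hy hj (ihj m)
        · exact ihj y
    exact this l le_rfl y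

theorem relaxColors_le {N x : ℕ} (hf : ∀ j x y, f j x y ≤ N) {D : ℕ → ℕ}
    (hD : ∀ y, D y ≤ x * N) (j y : ℕ) : relaxColors f x D j y ≤ (x + 1) * N := by
  induction j generalizing y with
  | zero => exact (hD y).trans (Nat.mul_le_mul_right _ (by omega))
  | succ j ih =>
    rw [relaxColors, relaxCuts]
    split_ifs
    · refine max_le (ih y) ?_
      rw [relaxColors_of_le le_rfl, add_mul, one_mul]
      exact add_le_add (hD x) (hf j x y)
    · exact ih y

theorem cutValue_le {N : ℕ} (hf : ∀ j x y, f j x y ≤ N) (x y : ℕ) :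
    cutValue f l x y ≤ x * N := by
  induction x generalizing y with
  | zero => simp [cutValue]
  | succ x ih => exact relaxColors_le hf ih l y

end CutRecursion

/-! ### Monochromatic blocks of happy vertices. -/

section Blocks

variable {V : Type*} [Fintype V] {G : SimpleGraph V} {l : ℕ}

/-- The closed neighbourhood of `v` may get the colour number `j`. -/
def IsCompatible (G : SimpleGraph V) (p : V → Option (Fin l)) (v : V) (j : ℕ) : Prop :=
  ∀ w, (w = v ∨ G.Adj w v) → ∀ i, p w = some i → i.val = j

open scoped Classical in
/-- The number of vertices between the cuts `x` and `y` whose closed neighbourhood may get the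
colour `j`. -/
noncomputable def blockCard (G : SimpleGraph V) (p : V → Option (Fin l)) (A B : V → ℕ)
    (j x y : ℕ) : ℕ :=
  (Finset.univ.filter fun v => (x ≤ A v ∧ IsCompatible G p v j) ∧ B v ≤ y).card

variable {p : V → Option (Fin l)} {A B : V → ℕ}

theorem blockCard_le (j x y : ℕ) : blockCard G p A B j x y ≤ Fintype.card V :=
  Finset.card_le_univ _

/-- Induction over chains of blocks. The vertices chosen so far end at or before the cut `x`, the
new block starts at or after it, so no closed neighbourhood of the one meets one of the other and
the new block may take any colour. -/
theorem exists_coloring_of_cutValue (hclose : ∀ u v, Close G u v → A v < B u) (m y : ℕ) :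
    ∃ (S : Finset V) (col : V → ℕ), cutValue (blockCard G p A B) l m y ≤ S.card ∧
      (∀ v ∈ S, B v ≤ y ∧ col v < l ∧ IsCompatible G p v (col v)) ∧
      ∀ u ∈ S, ∀ v ∈ S, Close G u v → col u = col v := by
  classical
  refine cutValue_induction (Q := fun y d => ∃ (S : Finset V) (col : V → ℕ), d ≤ S.card ∧
      (∀ v ∈ S, B v ≤ y ∧ col v < l ∧ IsCompatible G p v (col v)) ∧
      ∀ u ∈ S, ∀ v ∈ S, Close G u v → col u = col v) (fun y => ?_) ?_ m y
  · exact ⟨∅, fun _ => 0, by simp⟩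
  · rintro x y j d hxy hj ⟨S, col, hd, hS, hcol⟩
    set T := Finset.univ.filter fun v => (x ≤ A v ∧ IsCompatible G p v j) ∧ B v ≤ y with hT
    have hself : ∀ v, A v < B v := fun v => hclose v v ⟨v, Or.inl rfl, Or.inl rfl⟩
    have hmem : ∀ v, v ∈ T ↔ (x ≤ A v ∧ IsCompatible G p v j) ∧ B v ≤ y := by simp [hT]
    have hdisj : ∀ u ∈ S, ∀ v ∈ T, ¬ Close G u v := by
      intro u hu v hv hc
      have := hclose u v hc
      have := (hS u hu).1
      have := ((hmem v).1 hv).1.1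
      omega
    have hST : Disjoint S T := Finset.disjoint_left.2 fun v hv hv' =>
      hdisj v hv v hv' ⟨v, Or.inl rfl, Or.inl rfl⟩
    refine ⟨S ∪ T, fun v => if v ∈ T then j else col v, ?_, fun v hv => ?_, fun u hu v hv h => ?_⟩
    · rw [Finset.card_union_of_disjoint hST]
      exact add_le_add hd le_rfl
    · by_cases hvT : v ∈ T
      · simp only [hvT, if_true]
        exact ⟨((hmem v).1 hvT).2, hj, ((hmem v).1 hvT).1.2⟩
      · simp only [hvT, if_false]
        have := hS v ((Finset.mem_union.1 hv).resolve_right hvT)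
        exact ⟨this.1.trans hxy.le, this.2⟩
    · by_cases huT : u ∈ T <;> by_cases hvT : v ∈ T <;> simp only [huT, hvT, if_true, if_false]
      · exact absurd h.symm (hdisj v ((Finset.mem_union.1 hv).resolve_right hvT) u huT)
      · exact absurd h (hdisj u ((Finset.mem_union.1 hu).resolve_right huT) v hvT)
      · exact hcol u ((Finset.mem_union.1 hu).resolve_right huT) v
          ((Finset.mem_union.1 hv).resolve_right hvT) h

-- The last block is split off: it has the colour of the happy vertex `t` with the largest left end,
-- and it begins at the last right end `x` of a happy vertex of another colour. The induction
-- hypothesis covers what ends by `x`.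
open scoped Classical in
theorem card_happy_le_cutValue (hclose : ∀ u v, A v < B u → A u < B v → Close G u v)
    (hself : ∀ v, A v < B v) {c : V → Fin l} (hc : ExtendsPrecoloring p c) {m : ℕ} (y : ℕ)
    (hy : y ≤ m) : (Finset.univ.filter fun v => v ∈ happyVertices G c ∧ B v ≤ y).card ≤
      cutValue (blockCard G p A B) l m y := by
  induction y using Nat.strong_induction_on with
  | _ y ih =>
    set H := Finset.univ.filter fun v => v ∈ happyVertices G c ∧ B v ≤ y with hH
    have hmem : ∀ v, v ∈ H ↔ v ∈ happyVertices G c ∧ B v ≤ y := by simp [hH]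
    rcases H.eq_empty_or_nonempty with h0 | hne
    · rw [h0]; simp
    obtain ⟨t, ht, htmax⟩ := Finset.exists_max_image H A hne
    -- The supremum is `0` if all vertices of `H` have the colour of `t`; the block then starts at
    -- the first cut.
    set x := (H.filter fun u => c u ≠ c t).sup B with hx
    have hcol : ∀ u ∈ H, ∀ v ∈ H, Close G u v → c u = c v := by
      rintro u hu v hv ⟨w, h1, h2⟩
      have e1 : c w = c u := by
        rcases h1 with rfl | h1
        · rfl
        · exact ((hmem u).1 hu).1 w h1.symm
      have e2 : c w = c v := by
        rcases h2 with rfl | h2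
        · rfl
        · exact ((hmem v).1 hv).1 w h2.symm
      rw [← e1, e2]
    have hxle : ∀ u ∈ H, c u ≠ c t → B u ≤ x := fun u hu hne =>
      Finset.le_sup (f := B) (Finset.mem_filter.2 ⟨hu, hne⟩)
    have hxat : x = 0 ∨ ∃ u ∈ H, c u ≠ c t ∧ B u = x := by
      rcases (H.filter fun u => c u ≠ c t).eq_empty_or_nonempty with h1 | h1
      · left; rw [hx, h1]; rfl
      · obtain ⟨u, hu, hux⟩ := Finset.exists_mem_eq_sup _ h1 B
        rw [Finset.mem_filter] at hu
        exact Or.inr ⟨u, hu.1, hu.2, hux.symm⟩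
    have hBt := ((hmem t).1 ht).2
    have hst := hself t
    have hxy : x < y := by
      rcases hxat with h1 | ⟨u, hu, hne, hux⟩
      · omega
      · have h2 := htmax u hu
        by_contra h3
        exact hne (hcol u hu t ht (hclose u t (by omega) (by omega)))
    -- A vertex ending after `x` has the colour of `t` by the choice of `x`. If it started before
    -- `x`, its interval would overlap that of the vertex of another colour that ends at `x`.
    have hcase : ∀ v ∈ H, ¬ B v ≤ x → c v = c t ∧ x ≤ A v := by
      intro v hv hvx
      have h1 : c v = c t := by
        by_contra h2
        exact hvx (hxle v hv h2)
      refine ⟨h1, ?_⟩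
      rcases hxat with h2 | ⟨u, hu, hne, hux⟩
      · omega
      · by_contra h3
        have := hself u
        exact hne ((hcol u hu v hv (hclose u v (by omega) (by omega))).trans h1)
    have hsub : H ⊆ (Finset.univ.filter fun v => v ∈ happyVertices G c ∧ B v ≤ x) ∪
        (Finset.univ.filter fun v => (x ≤ A v ∧ IsCompatible G p v (c t).val) ∧ B v ≤ y) := by
      intro v hv
      have hv' := (hmem v).1 hv
      simp only [Finset.mem_union, Finset.mem_filter, Finset.mem_univ, true_and]
      by_cases h1 : B v ≤ x
      · exact Or.inl ⟨hv'.1, h1⟩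
      · obtain ⟨h2, h3⟩ := hcase v hv h1
        refine Or.inr ⟨⟨h3, fun w hw i hi => ?_⟩, hv'.2⟩
        rw [← hc w i hi, ← h2]
        rcases hw with rfl | hw
        · rfl
        · rw [hv'.1 w hw.symm]
    refine (Finset.card_le_card hsub).trans ((Finset.card_union_le _ _).trans ?_)
    exact (add_le_add (ih x hxy (by omega)) le_rfl).trans
      (add_le_cutValue hxy (by omega) (c t).isLt)

/-- The value of the last cut is the maximum number of happy vertices. -/
theorem le_cutValue_iff (hclose : ∀ u v, Close G u v ↔ A v < B u ∧ A u < B v) {N : ℕ}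
    (hB : ∀ v, B v ≤ N) (hl : 0 < l) (k : ℕ) :
    k ≤ cutValue (blockCard G p A B) l (N + 1) N ↔
      ∃ c : V → Fin l, ExtendsPrecoloring p c ∧ k ≤ (happyVertices G c).ncard := by
  classical
  have hcard : ∀ c : V → Fin l, (happyVertices G c).ncard =
      (Finset.univ.filter fun v => v ∈ happyVertices G c).card := by
    intro c
    rw [← Set.ncard_coe_finset]
    congr 1
    ext v
    simp
  constructor
  · intro hk
    obtain ⟨S, col, hS, hc, hcl⟩ := exists_coloring_of_cutValue (p := p) (l := l)
      (fun u v h => ((hclose u v).1 h).1) (N + 1) N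
    -- All members of `S` whose closed neighbourhoods contain `w` are close to each other, so they
    -- prescribe one colour for `w`; compatibility makes it agree with the precolouring. A vertex in
    -- none of these neighbourhoods keeps its precolour, or gets the first colour.
    have hex : ∀ w, ∃ i : Fin l, (∀ v ∈ S, (w = v ∨ G.Adj w v) → i.val = col v) ∧
        ∀ j, p w = some j → i = j := by
      intro w
      by_cases hw : ∃ v ∈ S, w = v ∨ G.Adj w v
      · obtain ⟨v, hv, hwv⟩ := hw
        refine ⟨⟨col v, (hc v hv).2.1⟩, fun u hu hwu => ?_, fun j hj => ?_⟩
        · exact hcl v hv u hu ⟨w, hwv, hwu⟩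
        · exact Fin.ext ((hc v hv).2.2 w hwv j hj).symm
      · rcases hpw : p w with - | j
        · exact ⟨⟨0, hl⟩, fun v hv hwv => absurd ⟨v, hv, hwv⟩ hw, by simp⟩
        · exact ⟨j, fun v hv hwv => absurd ⟨v, hv, hwv⟩ hw, by simp⟩
    choose c hc1 hc2 using hex
    refine ⟨c, fun v j h => hc2 v j h, hk.trans (hS.trans ?_)⟩
    rw [hcard]
    refine Finset.card_le_card fun v hv => ?_
    simp only [Finset.mem_filter, Finset.mem_univ, true_and]
    intro u hu
    exact Fin.ext ((hc1 u v hv (Or.inr hu.symm)).trans (hc1 v v hv (Or.inl rfl)).symm)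
  · rintro ⟨c, hc, hk⟩
    have := card_happy_le_cutValue (G := G) (p := p) (A := A) (B := B)
      (fun u v h1 h2 => (hclose u v).2 ⟨h1, h2⟩)
      (fun v => ((hclose v v).1 ⟨v, Or.inl rfl, Or.inl rfl⟩).1) hc (m := N + 1) N (by omega)
    rw [hcard] at hk
    refine hk.trans (le_trans (le_of_eq ?_) this)
    congr 1
    ext v
    simp [hB v]

end Blocks

/-! ### Reasoning about programs -/

namespace WordRAM

@[simp] theorem State.setReg_reg (σ : State) (r x r' : ℕ) :
    (σ.setReg r x).reg r' = if r' = r then x else σ.reg r' := by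
  simp [State.setReg, Function.update_apply]

@[simp] theorem State.setReg_mem (σ : State) (r x : ℕ) : (σ.setReg r x).mem = σ.mem := rfl

@[simp] theorem State.setMem_reg (σ : State) (b i x : ℕ) : (σ.setMem b i x).reg = σ.reg := rfl

@[simp] theorem State.setMem_mem (σ : State) (b i x b' : ℕ) :
    (σ.setMem b i x).mem b' = if b' = b then Function.update (σ.mem b) i x else σ.mem b' := by
  simp [State.setMem, Function.update_apply]

/-- Started in `σ`, the program `P` halts after at most `T` steps in a state with property
`Q`. -/
def Runs (W : ℕ) (P : Program) (σ : State) (T : ℕ) (Q : State → Prop) : Prop :=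
  ∃ τ T', Exec W P σ τ T' ∧ T' ≤ T ∧ Q τ

variable {W T : ℕ} {σ : State} {P R : Program} {Q Q' : State → Prop}

theorem Runs.mono {T' : ℕ} (h : Runs W P σ T Q) (hT : T ≤ T') (hQ : ∀ τ, Q τ → Q' τ) :
    Runs W P σ T' Q' := by
  obtain ⟨τ, T₁, h1, h2, h3⟩ := h
  exact ⟨τ, T₁, h1, h2.trans hT, hQ τ h3⟩

theorem Runs.skip (hT : 1 ≤ T) (hQ : Q σ) : Runs W .skip σ T Q := ⟨σ, 1, .skip σ, hT, hQ⟩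

theorem Runs.assign {r : ℕ} {t : Term} (ht : t.Fits W σ) (hT : t.cost + 1 ≤ T)
    (hQ : Q (σ.setReg r (t.eval σ))) : Runs W (.assign r t) σ T Q :=
  ⟨_, _, .assign σ r t ht, hT, hQ⟩

theorem Runs.store {b : ℕ} {a t : Term} (ha : a.Fits W σ) (ht : t.Fits W σ)
    (hT : a.cost + t.cost + 1 ≤ T) (hQ : Q (σ.setMem b (a.eval σ) (t.eval σ))) :
    Runs W (.store b a t) σ T Q :=
  ⟨_, _, .store σ b a t ha ht, hT, hQ⟩

theorem Runs.seq {T₁ T₂ : ℕ} (h : Runs W P σ T₁ fun τ => Runs W R τ T₂ Q) (hT : T₁ + T₂ ≤ T) :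
    Runs W (.seq P R) σ T Q := by
  obtain ⟨τ, S, h1, h2, τ', S', h3, h4, h5⟩ := h
  exact ⟨τ', S + S', .seq _ _ _ _ _ _ _ h1 h3, by omega, h5⟩

theorem Runs.ite {t : Term} {T' : ℕ} (ht : t.Fits W σ) (hT : t.cost + 1 + T' ≤ T)
    (h1 : t.eval σ ≠ 0 → Runs W P σ T' Q) (h2 : t.eval σ = 0 → Runs W R σ T' Q) :
    Runs W (.ite t P R) σ T Q := by
  by_cases h : t.eval σ = 0
  · obtain ⟨τ, S, h3, h4, h5⟩ := h2 h
    exact ⟨τ, _, .ite_false _ _ _ _ _ _ ht h h3, by omega, h5⟩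
  · obtain ⟨τ, S, h3, h4, h5⟩ := h1 h
    exact ⟨τ, _, .ite_true _ _ _ _ _ _ ht h h3, by omega, h5⟩

/-- Run `P` with the values `0, …, N - 1` in register `i`, where `N` is the value of
register `r`. -/
def forLoop (i r : ℕ) (P : Program) : Program :=
  .seq (.assign i (.const 0)) (.while (.op .less (.reg i) (.reg r))
    (.seq P (.assign i (.op .plus (.reg i) (.const 1)))))

/-- The overhead of a round is eight steps, four for the test and four for the increment; six more
pay for the initialisation and the failing test. The body must leave the counter alone, and the
invariant is required after the increment. -/
theorem Runs.forLoop {i r N c : ℕ} (I : ℕ → State → Prop) (hN : N + 1 < W)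
    (h0 : I 0 (σ.setReg i 0)) (hr : ∀ m σ, I m σ → σ.reg i = m ∧ σ.reg r = N)
    (hstep : ∀ m < N, ∀ σ, I m σ →
      Runs W P σ c fun τ => τ.reg i = m ∧ I (m + 1) (τ.setReg i (m + 1)))
    (hT : N * (c + 8) + 6 ≤ T) (hQ : ∀ τ, I N τ → Q τ) : Runs W (forLoop i r P) σ T Q := by
  have main : ∀ d ≤ N, ∀ σ, I (N - d) σ → Runs W (.while (.op .less (.reg i) (.reg r))
      (.seq P (.assign i (.op .plus (.reg i) (.const 1))))) σ (d * (c + 8) + 4) Q := by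
    intro d
    induction d with
    | zero =>
      intro _ σ hσ
      obtain ⟨h1, h2⟩ := hr _ _ hσ
      refine ⟨σ, _, .while_false _ _ _ ?_ ?_, ?_, hQ _ hσ⟩
      · simp only [Term.Fits, Term.eval, Op.eval, h1, h2]
        split_ifs <;> omega
      · simp [Term.eval, Op.eval, h1, h2]
      · simp [Term.cost]
    | succ d ih =>
      intro hd σ hσ
      obtain ⟨h1, h2⟩ := hr _ _ hσ
      obtain ⟨τ, S, h3, h4, h5, h6⟩ := hstep _ (by omega) σ hσ
      rw [(by omega : N - (d + 1) + 1 = N - d)] at h6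
      obtain ⟨τ', S', h7, h8, h9⟩ := ih (by omega) _ h6
      have h10 : Term.eval τ (.op .plus (.reg i) (.const 1)) = N - d := by
        simp only [Term.eval, Op.eval, h5]
        omega
      refine ⟨τ', _, .while_true _ _ _ _ _ _ _ ?_ ?_ (.seq _ _ _ _ _ _ _ h3
        (.assign _ i _ ?_)) (h10.symm ▸ h7), ?_, h9⟩
      · simp only [Term.Fits, Term.eval, Op.eval, h1, h2]
        split_ifs <;> omega
      · simp [Term.eval, Op.eval, h1, h2]
        omega
      · simp only [Term.Fits, Term.eval, Op.eval, h5]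
        omega
      · simp only [Term.cost, add_mul, one_mul]
        omega
  refine Runs.seq (T₁ := 2) (T₂ := N * (c + 8) + 4) (Runs.assign ?_ le_rfl ?_) (by omega)
  · simp only [Term.Fits]; omega
  · exact main N le_rfl _ (by rw [Nat.sub_self]; exact h0)

/-- The contents of bank `b` start with the table `f`. -/
def Holds {n : ℕ} (σ : State) (b : ℕ) (f : Fin n → ℕ) : Prop := ∀ v : Fin n, σ.mem b v = f v

/-- The states `σ` and `τ` differ at most in bank `b` and in registers from `3` to `8`. -/
structure Agree (b : ℕ) (σ τ : State) : Prop where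
  reg : ∀ r, (r < 3 ∨ 8 < r) → τ.reg r = σ.reg r
  mem : ∀ b', b' ≠ b → τ.mem b' = σ.mem b'

theorem Agree.refl (b : ℕ) (σ : State) : Agree b σ σ := ⟨fun _ _ => rfl, fun _ _ => rfl⟩

theorem Agree.setReg {b r : ℕ} {τ : State} (h : Agree b σ τ) (hr : 3 ≤ r ∧ r ≤ 8) (x : ℕ) :
    Agree b σ (τ.setReg r x) := by
  refine ⟨fun r' hr' => ?_, fun b' hb' => h.mem b' hb'⟩
  rw [State.setReg_reg, if_neg (by omega), h.reg r' hr']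

theorem Agree.setMem {b : ℕ} {τ : State} (h : Agree b σ τ) (i x : ℕ) :
    Agree b σ (τ.setMem b i x) :=
  ⟨h.reg, fun b' hb' => by rw [State.setMem_mem, if_neg hb', h.mem b' hb']⟩

theorem Holds.of_agree {n b b' : ℕ} {f : Fin n → ℕ} {τ : State} (hf : Holds σ b' f)
    (h : Agree b σ τ) (hb : b' ≠ b) : Holds τ b' f := fun v => by rw [h.mem b' hb]; exact hf v

/-- Compute a table in bank `b`. The entry `v` (register `3`) is the value of `fin` after a
loop over `w` (register `4`) that changes the accumulator (register `5`) from `init` on: its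
new value is `t` if `c` holds. -/
def table (b : ℕ) (init c t fin : Term) : Program :=
  forLoop 3 0 (.seq (.assign 5 init) (.seq (forLoop 4 0 (.ite c (.assign 5 t) .skip))
    (.store b (.reg 3) fin)))

/-- Here `F v m` is the value of the accumulator before inner round `m`. The hypotheses concern
single evaluations of terms in any state that differs from the initial one in the scratch registers
and the target bank only, so tables in other banks remain readable. -/
theorem Runs.table {n b : ℕ} {init c t fin : Term} (F : Fin n → ℕ → ℕ) (f : Fin n → ℕ)
    (hn : 0 < n) (hW : n + 1 < W) (hσ : σ.reg 0 = n)
    (hcost : init.cost + c.cost + t.cost + fin.cost ≤ 60)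
    (hinit : ∀ τ v, Agree b σ τ → τ.reg 3 = v.val → init.Fits W τ ∧ init.eval τ = F v 0)
    (hstep : ∀ τ v (w : Fin n), Agree b σ τ → τ.reg 3 = v.val → τ.reg 4 = w.val →
      τ.reg 5 = F v w → c.Fits W τ ∧ (c.eval τ ≠ 0 → t.Fits W τ ∧ t.eval τ = F v (w + 1)) ∧
        (c.eval τ = 0 → F v w = F v (w + 1)))
    (hfin : ∀ τ v, Agree b σ τ → τ.reg 3 = v.val → τ.reg 5 = F v n →
      fin.Fits W τ ∧ fin.eval τ = f v) :
    Runs W (table b init c t fin) σ (220 * n ^ 2) fun τ => Agree b σ τ ∧ Holds τ b f := by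
  refine Runs.forLoop (N := n) (c := 200 * n) (fun m τ => (τ.reg 3 = m ∧ τ.reg 0 = n) ∧ Agree b σ τ ∧
    ∀ v : Fin n, v.val < m → τ.mem b v = f v) hW ?_ (fun m τ h => h.1) ?_ ?_ ?_
  · exact ⟨by simpa using hσ, (Agree.refl b σ).setReg (by omega) 0, fun v hv => by omega⟩
  · rintro m hm τ ⟨⟨h1, h2⟩, h3, h4⟩
    obtain ⟨h5, h6⟩ := hinit τ ⟨m, hm⟩ h3 h1
    refine Runs.seq (T₁ := 61) (T₂ := n * 70 + 68) (Runs.assign h5 (by omega) ?_) (by omega)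
    refine Runs.seq (T₁ := n * 70 + 6) (T₂ := 62) ?_ (by omega)
    refine Runs.forLoop (N := n) (c := 62) (fun w ρ => (ρ.reg 4 = w ∧ ρ.reg 0 = n) ∧ Agree b σ ρ ∧
      ρ.reg 3 = m ∧ ρ.reg 5 = F ⟨m, hm⟩ w ∧ ∀ v : Fin n, v.val < m → ρ.mem b v = f v) hW ?_
      (fun w ρ h => h.1) ?_ le_rfl ?_
    · refine ⟨by simpa using h2, (h3.setReg (by omega) _).setReg (by omega) _, ?_, ?_, ?_⟩
      · simpa using h1
      · simpa using h6
      · simpa using h4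
    · rintro w hw ρ ⟨⟨g1, g2⟩, g3, g4, g5, g6⟩
      obtain ⟨h7, h8, h9⟩ := hstep ρ ⟨m, hm⟩ ⟨w, hw⟩ g3 g4 g1 g5
      refine Runs.ite (T' := 61 - c.cost) h7 (by omega) (fun hc => ?_) (fun hc => ?_)
      · obtain ⟨h10, h11⟩ := h8 hc
        refine Runs.assign h10 (by omega) ⟨by simpa using g1, by simpa using g2,
          (g3.setReg (by omega) _).setReg (by omega) _, by simpa using g4, ?_, by simpa using g6⟩
        simpa using h11
      · refine Runs.skip (by omega) ⟨by simpa using g1, by simpa using g2,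
          g3.setReg (by omega) _, by simpa using g4, ?_, by simpa using g6⟩
        simpa [g5] using h9 hc
    · rintro ρ ⟨⟨g1, g2⟩, g3, g4, g5, g6⟩
      obtain ⟨h7, h8⟩ := hfin ρ ⟨m, hm⟩ g3 g4 g5
      refine Runs.store (by simp only [Term.Fits]; omega) h7 (by simp only [Term.cost]; omega) ?_
      refine ⟨by simpa using g4, ⟨by simp, by simpa using g2⟩,
        (g3.setMem _ _).setReg (by omega) _, fun v hv => ?_⟩
      simp only [State.setReg_mem, State.setMem_mem, if_true, Term.eval, g4, h8,
        Function.update_apply]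
      split_ifs with hvm
      · congr 1; exact Fin.ext hvm.symm
      · exact g6 v (by omega)
  · nlinarith
  · rintro τ ⟨-, h1, h2⟩
    exact ⟨h1, fun v => h2 v v.isLt⟩

end WordRAM

/-! ### Partial counts and suprema -/

section Partial

variable {n : ℕ}

open scoped Classical in
/-- The number of elements below `m` with property `P`. -/
noncomputable def countBelow (P : Fin n → Prop) (m : ℕ) : ℕ :=
  (Finset.univ.filter fun i : Fin n => i.val < m ∧ P i).card

open scoped Classical in
/-- The supremum of `g` over the elements below `m` with property `P`. -/
noncomputable def supBelow (P : Fin n → Prop) (g : Fin n → ℕ) (m : ℕ) : ℕ :=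
  (Finset.univ.filter fun i : Fin n => i.val < m ∧ P i).sup g

variable {P : Fin n → Prop} {g : Fin n → ℕ}

@[simp] theorem countBelow_zero : countBelow P 0 = 0 := by simp [countBelow]

@[simp] theorem supBelow_zero : supBelow P g 0 = 0 := by simp [supBelow]

open scoped Classical in
theorem filter_lt_succ (P : Fin n → Prop) (m : Fin n) :
    (Finset.univ.filter fun i : Fin n => i.val < m.val + 1 ∧ P i) =
      if P m then insert m (Finset.univ.filter fun i : Fin n => i.val < m.val ∧ P i)
      else Finset.univ.filter fun i : Fin n => i.val < m.val ∧ P i := by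
  ext i
  have h : i.val < m.val + 1 ↔ i = m ∨ i.val < m.val := by rw [Fin.ext_iff]; omega
  split_ifs with hm <;> simp only [Finset.mem_filter, Finset.mem_univ, true_and, h,
    Finset.mem_insert] <;> constructor
  · rintro ⟨rfl | h1, h2⟩
    · exact Or.inl rfl
    · exact Or.inr ⟨h1, h2⟩
  · rintro (rfl | h1)
    · exact ⟨Or.inl rfl, hm⟩
    · exact ⟨Or.inr h1.1, h1.2⟩
  · rintro ⟨rfl | h1, h2⟩
    · exact absurd h2 hm
    · exact ⟨h1, h2⟩
  · exact fun h1 => ⟨Or.inr h1.1, h1.2⟩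

theorem countBelow_succ (m : Fin n) [Decidable (P m)] :
    countBelow P (m.val + 1) = countBelow P m.val + if P m then 1 else 0 := by
  classical
  unfold countBelow
  rw [filter_lt_succ]
  split_ifs with h
  · rw [Finset.card_insert_of_notMem (by simp)]
  · rfl

theorem supBelow_succ (m : Fin n) [Decidable (P m)] :
    supBelow P g (m.val + 1) = if P m then max (supBelow P g m.val) (g m)
      else supBelow P g m.val := by
  classical
  unfold supBelow
  rw [filter_lt_succ]
  split_ifs with h
  · rw [Finset.sup_insert, max_comm]
  · rfl

theorem countBelow_le (m : ℕ) : countBelow P m ≤ n :=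
  (Finset.card_le_univ _).trans (by simp)

theorem countBelow_eq [DecidablePred P] :
    countBelow P n = (Finset.univ.filter P).card := by
  unfold countBelow
  congr 1
  ext i
  simp

theorem supBelow_eq [DecidablePred P] :
    supBelow P g n = (Finset.univ.filter P).sup g := by
  unfold supBelow
  congr 1
  ext i
  simp

theorem supBelow_le {N : ℕ} (h : ∀ i, g i ≤ N) (m : ℕ) : supBelow P g m ≤ N :=
  Finset.sup_le fun i _ => h i

end Partial

namespace WordRAM

/-! ### The tables of the algorithm -/

section Tables

variable {n W : ℕ} {G : SimpleGraph (Fin n)} {σ : State}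

/-- The adjacency of the vertices in registers `3` and `4`. -/
def adjTerm : Term := .load 0 (.op .plus (.op .times (.reg 3) (.reg 0)) (.reg 4))

theorem adjacencyCell_mul_add (G : SimpleGraph (Fin n)) (u v : Fin n) [Decidable (G.Adj u v)] :
    adjacencyCell G (u.val * n + v.val) = if G.Adj u v then 1 else 0 := by
  unfold adjacencyCell
  have : (∃ u' v' : Fin n, u.val * n + v.val = u'.val * n + v'.val ∧ G.Adj u' v') ↔
      G.Adj u v := by
    constructor
    · rintro ⟨u', v', h, hadj⟩
      have h1 : u.val = u'.val := by
        have := congrArg (· / n) h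
        simpa [mul_comm _ n, Nat.mul_add_div u.pos, Nat.div_eq_of_lt v.isLt,
          Nat.div_eq_of_lt v'.isLt] using this
      have h2 : v.val = v'.val := by rw [h1] at h; omega
      rwa [Fin.ext h1, Fin.ext h2]
    · exact fun h => ⟨u, v, rfl, h⟩
  simp [this]

/-- Words are large enough for `n` vertices. -/
def Large (n W : ℕ) : Prop := 4 * ((n + 2) * (n + 2)) ≤ W

theorem Large.lt (h : Large n W) : 4 * n + 4 < W := by
  unfold Large at h; nlinarith

theorem Large.mul_add_lt (h : Large n W) (u v : Fin n) : u.val * n + v.val < W := by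
  have : u.val * n ≤ n * n := Nat.mul_le_mul_right _ u.isLt.le
  have := v.isLt
  unfold Large at h; nlinarith

theorem adjTerm_spec (hW : Large n W) (h0 : σ.reg 0 = n) (hG : σ.mem 0 = adjacencyCell G)
    {u v : Fin n} (hu : σ.reg 3 = u.val) (hv : σ.reg 4 = v.val) [Decidable (G.Adj u v)] :
    adjTerm.Fits W σ ∧ adjTerm.eval σ = if G.Adj u v then 1 else 0 := by
  have h1 := hW.lt
  have h2 := hW.mul_add_lt u v
  have h3 := u.isLt
  have h4 := v.isLt
  simp only [adjTerm, Term.Fits, Term.eval, Op.eval, h0, hG, hu, hv, adjacencyCell_mul_add]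
  refine ⟨⟨⟨⟨by omega, by omega, by omega⟩, by omega, h2⟩, ?_⟩, trivial⟩
  split_ifs <;> omega

/-- The table of `layerKey` for the layers in bank `lb`. -/
def keyTable (lb kb : ℕ) : Program :=
  table kb (.reg 0)
    (.op .times adjTerm (.op .equal (.op .plus (.load lb (.reg 4)) (.const 1)) (.load lb (.reg 3))))
    (.op .minus (.reg 5) (.const 1))
    (.op .plus (.op .times (.load lb (.reg 3)) (.op .plus (.reg 0) (.const 1))) (.reg 5))

theorem runs_keyTable {lb kb : ℕ} (hW : Large n W) (hn : 0 < n) (h0 : σ.reg 0 = n)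
    (hG : σ.mem 0 = adjacencyCell G) {lab : Fin n → ℕ} (hlab : ∀ v, lab v ≤ n)
    (hσ : Holds σ lb lab) (hkb : 0 ≠ kb) (hne : lb ≠ kb) :
    Runs W (keyTable lb kb) σ (220 * n ^ 2) fun τ =>
      Agree kb σ τ ∧ Holds τ kb (layerKey G lab) := by
  classical
  have hl := hW.lt
  -- The accumulator counts down from `n`, so it ends as the part of the key that orders a layer by
  -- decreasing `downDegree`. Conjunctions of tests are products of zeros and ones.
  refine Runs.table (fun v m => n - countBelow (fun w => G.Adj v w ∧ lab w + 1 = lab v) m)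
    (layerKey G lab) hn (by omega) h0 (by simp [Term.cost, adjTerm]) ?_ ?_ ?_
  · intro τ v h h3
    simp only [Term.Fits, Term.eval, h.reg 0 (by omega), h0, countBelow_zero]
    omega
  · intro τ v w h h3 h4 h5
    have e3 := hσ.of_agree h hne v
    have e4 := hσ.of_agree h hne w
    have b3 := hlab v
    have b4 := hlab w
    have b5 := v.isLt
    have b6 := w.isLt
    obtain ⟨a1, a2⟩ := adjTerm_spec (G := G) hW (by rw [h.reg 0 (by omega), h0])
      (by rw [h.mem 0 hkb, hG]) h3 h4
    have b7 := countBelow_le (P := fun w => G.Adj v w ∧ lab w + 1 = lab v) w.val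
    rw [countBelow_succ]
    simp only [Term.Fits, Term.eval, Op.eval, h3, h4, h5, e3, e4, a1, a2]
    by_cases c1 : G.Adj v w <;> by_cases c2 : lab w + 1 = lab v <;> simp [c1, c2] <;> omega
  · intro τ v h h3 h5
    have e3 := hσ.of_agree h hne v
    have b3 := hlab v
    have b4 := v.isLt
    have b5 : lab v * (n + 1) ≤ n * (n + 1) := Nat.mul_le_mul_right _ b3
    have b6 : n * (n + 1) + n < W := by unfold Large at hW; nlinarith
    have b7 := countBelow_eq (P := fun w => G.Adj v w ∧ lab w + 1 = lab v)
    simp only [Term.Fits, Term.eval, Op.eval, h3, h5, e3, h.reg 0 (by omega), h0, layerKey,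
      downDegree, Fintype.card_fin, b7, and_true]
    omega

/-- The table of `upDegree` for the layers in bank `lb`. -/
def upTable (lb ub : ℕ) : Program :=
  table ub (.const 0)
    (.op .times adjTerm (.op .equal (.load lb (.reg 4)) (.op .plus (.load lb (.reg 3)) (.const 1))))
    (.op .plus (.reg 5) (.const 1)) (.reg 5)

theorem runs_upTable {lb ub : ℕ} (hW : Large n W) (hn : 0 < n) (h0 : σ.reg 0 = n)
    (hG : σ.mem 0 = adjacencyCell G) {lab : Fin n → ℕ} (hlab : ∀ v, lab v ≤ n)
    (hσ : Holds σ lb lab) (hub : 0 ≠ ub) (hne : lb ≠ ub) :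
    Runs W (upTable lb ub) σ (220 * n ^ 2) fun τ =>
      Agree ub σ τ ∧ Holds τ ub (upDegree G lab) := by
  classical
  have hl := hW.lt
  refine Runs.table (fun v m => countBelow (fun w => G.Adj v w ∧ lab w = lab v + 1) m)
    _ hn (by omega) h0 (by simp [Term.cost, adjTerm]) ?_ ?_ ?_
  · intro τ v h h3
    simp only [Term.Fits, Term.eval, countBelow_zero, and_true]
    omega
  · intro τ v w h h3 h4 h5
    have e3 := hσ.of_agree h hne v
    have e4 := hσ.of_agree h hne w
    have b3 := hlab v
    have b4 := hlab w
    have b5 := v.isLt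
    have b6 := w.isLt
    obtain ⟨a1, a2⟩ := adjTerm_spec (G := G) hW (by rw [h.reg 0 (by omega), h0])
      (by rw [h.mem 0 hub, hG]) h3 h4
    have b7 := countBelow_le (P := fun w => G.Adj v w ∧ lab w = lab v + 1) w.val
    rw [countBelow_succ]
    simp only [Term.Fits, Term.eval, Op.eval, h3, h4, h5, e3, e4, a1, a2]
    by_cases c1 : G.Adj v w <;> by_cases c2 : lab w = lab v + 1 <;> simp [c1, c2] <;> omega
  · intro τ v h h3 h5
    have b6 := countBelow_le (P := fun w => G.Adj v w ∧ lab w = lab v + 1) n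
    have b7 := countBelow_eq (P := fun w => G.Adj v w ∧ lab w = lab v + 1)
    simp only [Term.Fits, Term.eval, h5, upDegree, b7, and_true]
    omega

/-- The table of `leftEnd` for the keys in bank `kb`. -/
def leftTable (kb ab : ℕ) : Program :=
  table ab (.const 0) (.op .less (.load kb (.reg 4)) (.load kb (.reg 3)))
    (.op .plus (.reg 5) (.const 1)) (.reg 5)

theorem layerKey_le {lab : Fin n → ℕ} (hlab : ∀ v, lab v ≤ n) (v : Fin n) :
    layerKey G lab v ≤ n * (n + 1) + n := by
  have := hlab v
  have : lab v * (n + 1) ≤ n * (n + 1) := Nat.mul_le_mul_right _ this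
  simp only [layerKey, Fintype.card_fin]
  omega

theorem layerKey_lt (hW : Large n W) {lab : Fin n → ℕ} (hlab : ∀ v, lab v ≤ n) (v : Fin n) :
    layerKey G lab v < W := by
  have := layerKey_le (G := G) hlab v
  unfold Large at hW; nlinarith

theorem runs_leftTable {kb ab : ℕ} (hW : Large n W) (hn : 0 < n) (h0 : σ.reg 0 = n)
    {lab : Fin n → ℕ} (hlab : ∀ v, lab v ≤ n) (hσ : Holds σ kb (layerKey G lab)) (hne : kb ≠ ab) :
    Runs W (leftTable kb ab) σ (220 * n ^ 2) fun τ =>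
      Agree ab σ τ ∧ Holds τ ab (leftEnd G lab) := by
  classical
  have hl := hW.lt
  refine Runs.table (fun v m => countBelow (fun w => layerKey G lab w < layerKey G lab v) m)
    _ hn (by omega) h0 (by simp [Term.cost]) ?_ ?_ ?_
  · intro τ v h h3
    simp only [Term.Fits, Term.eval, countBelow_zero, and_true]
    omega
  · intro τ v w h h3 h4 h5
    have e3 := hσ.of_agree h hne v
    have e4 := hσ.of_agree h hne w
    have b3 := layerKey_lt (G := G) hW hlab v
    have b4 := layerKey_lt (G := G) hW hlab w
    have b5 := v.isLt
    have b6 := w.isLt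
    have b7 := countBelow_le (P := fun w => layerKey G lab w < layerKey G lab v) w.val
    rw [countBelow_succ]
    simp only [Term.Fits, Term.eval, Op.eval, h3, h4, h5, e3, e4]
    by_cases c1 : layerKey G lab w < layerKey G lab v <;> simp [c1] <;> omega
  · intro τ v h h3 h5
    have b6 := countBelow_le (P := fun w => layerKey G lab w < layerKey G lab v) n
    have b7 := countBelow_eq (P := fun w => layerKey G lab w < layerKey G lab v)
    simp only [Term.Fits, Term.eval, h5, leftEnd, b7, and_true]
    omega

/-- The table of the numbers of vertices in the layers that a vertex surely reaches. -/
def baseTable (lb ub sb : ℕ) : Program :=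
  table sb (.const 0) (.op .less (.load lb (.reg 4))
      (.op .plus (.op .plus (.load lb (.reg 3)) (.const 1)) (.op .less (.const 0) (.load ub (.reg 3)))))
    (.op .plus (.reg 5) (.const 1)) (.reg 5)

theorem upDegree_le_n (lab : Fin n → ℕ) (v : Fin n) : upDegree G lab v ≤ n :=
  (Finset.card_le_univ _).trans (by simp)

theorem runs_baseTable {lb ub sb : ℕ} (hW : Large n W) (hn : 0 < n) (h0 : σ.reg 0 = n)
    {lab : Fin n → ℕ} (hlab : ∀ v, lab v ≤ n) (hσ : Holds σ lb lab)
    (hup : Holds σ ub (upDegree G lab)) (hne : lb ≠ sb) (hne' : ub ≠ sb) :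
    Runs W (baseTable lb ub sb) σ (220 * n ^ 2) fun τ =>
      Agree sb σ τ ∧ Holds τ sb fun v => belowCard lab (lab v + 1 + upStep G lab v) := by
  classical
  have hl := hW.lt
  refine Runs.table (fun v m => countBelow (fun w => lab w < lab v + 1 + upStep G lab v) m)
    _ hn (by omega) h0 (by simp [Term.cost]) ?_ ?_ ?_
  · intro τ v h h3
    simp only [Term.Fits, Term.eval, countBelow_zero, and_true]
    omega
  · intro τ v w h h3 h4 h5
    have e3 := hσ.of_agree h hne v
    have e4 := hσ.of_agree h hne w
    have e6 := hup.of_agree h hne' v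
    have b3 := hlab v
    have b4 := hlab w
    have b5 := v.isLt
    have b6 := w.isLt
    have b8 := upDegree_le_n (G := G) lab v
    have b7 := countBelow_le (P := fun w => lab w < lab v + 1 + upStep G lab v) w.val
    rw [countBelow_succ]
    have hs : (if 0 < upDegree G lab v then 1 else 0) = upStep G lab v := by
      simp only [upStep]
    have hs' : upStep G lab v ≤ 1 := by rw [← hs]; split_ifs <;> omega
    simp only [Term.Fits, Term.eval, Op.eval, h3, h4, h5, e3, e4, e6, hs]
    by_cases c1 : lab w < lab v + 1 + upStep G lab v <;> simp [c1] <;> omega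
  · intro τ v h h3 h5
    have b6 := countBelow_le (P := fun w => lab w < lab v + 1 + upStep G lab v) n
    have b7 := countBelow_eq (P := fun w => lab w < lab v + 1 + upStep G lab v)
    simp only [Term.Fits, Term.eval, h5, belowCard, b7, and_true]
    omega

/-- The table of `rightEnd`. -/
def rightTable (lb ub sb rb : ℕ) : Program :=
  table rb (.load sb (.reg 3))
    (.op .times adjTerm (.op .equal (.load lb (.reg 4))
      (.op .plus (.load lb (.reg 3)) (.op .less (.const 0) (.load ub (.reg 3))))))
    (.op .plus (.reg 5) (.op .minus (.op .plus (.load sb (.reg 3)) (.load ub (.reg 4))) (.reg 5)))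
    (.reg 5)

/-- With truncated subtraction, `s + (y - s)` is the maximum of `s` and `y`. The base is part of the
accumulator from the start, so each candidate is shifted by the base before it is compared. -/
theorem runs_rightTable {lb ub sb rb : ℕ} (hW : Large n W) (hn : 0 < n) (h0 : σ.reg 0 = n)
    (hG : σ.mem 0 = adjacencyCell G) {lab : Fin n → ℕ} (hlab : ∀ v, lab v ≤ n)
    (hσ : Holds σ lb lab) (hup : Holds σ ub (upDegree G lab))
    (hs : Holds σ sb fun v => belowCard lab (lab v + 1 + upStep G lab v))
    (hrb : 0 ≠ rb) (hne : lb ≠ rb) (hne' : ub ≠ rb) (hne'' : sb ≠ rb) :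
    Runs W (rightTable lb ub sb rb) σ (220 * n ^ 2) fun τ =>
      Agree rb σ τ ∧ Holds τ rb (rightEnd G lab) := by
  classical
  have hl := hW.lt
  have hbel : ∀ m, belowCard lab m ≤ n := fun m => (belowCard_le lab m).trans (by simp)
  refine Runs.table (fun v m => belowCard lab (lab v + 1 + upStep G lab v) +
      supBelow (fun w => G.Adj v w ∧ lab w = lab v + upStep G lab v) (upDegree G lab) m)
    _ hn (by omega) h0 (by simp [Term.cost, adjTerm]) ?_ ?_ ?_
  · intro τ v h h3
    have e3 := hs.of_agree h hne'' v
    have := hbel (lab v + 1 + upStep G lab v)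
    have := v.isLt
    simp only [Term.Fits, Term.eval, supBelow_zero, h3, e3]
    omega
  · intro τ v w h h3 h4 h5
    have e3 := hσ.of_agree h hne v
    have e4 := hσ.of_agree h hne w
    have e6 := hup.of_agree h hne' v
    have e7 := hup.of_agree h hne' w
    have e8 := hs.of_agree h hne'' v
    have b3 := hlab v
    have b4 := hlab w
    have b5 := v.isLt
    have b6 := w.isLt
    have b8 := upDegree_le_n (G := G) lab v
    have b9 := upDegree_le_n (G := G) lab w
    have b10 := hbel (lab v + 1 + upStep G lab v)
    obtain ⟨a1, a2⟩ := adjTerm_spec (G := G) hW (by rw [h.reg 0 (by omega), h0])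
      (by rw [h.mem 0 hrb, hG]) h3 h4
    have b7 := supBelow_le (P := fun w => G.Adj v w ∧ lab w = lab v + upStep G lab v)
      (upDegree_le_n (G := G) lab) w.val
    rw [supBelow_succ]
    have hs : (if 0 < upDegree G lab v then 1 else 0) = upStep G lab v := by
      simp only [upStep]
    have hs' : upStep G lab v ≤ 1 := by rw [← hs]; split_ifs <;> omega
    simp only [Term.Fits, Term.eval, Op.eval, h3, h4, h5, e3, e4, e6, e7, e8, a1, a2, hs]
    by_cases c1 : G.Adj v w <;> by_cases c2 : lab w = lab v + upStep G lab v <;>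
      simp [c1, c2] <;> omega
  · intro τ v h h3 h5
    have b6 := supBelow_le (P := fun w => G.Adj v w ∧ lab w = lab v + upStep G lab v)
      (upDegree_le_n (G := G) lab) n
    have b7 := supBelow_eq (P := fun w => G.Adj v w ∧ lab w = lab v + upStep G lab v)
      (g := upDegree G lab)
    have b10 := hbel (lab v + 1 + upStep G lab v)
    simp only [Term.Fits, Term.eval, h5, rightEnd, maxUp, ← b7, and_true]
    omega

/-- The largest colour number in the closed neighbourhood of a vertex. -/
def maxColorTable (mb : ℕ) : Program :=
  table mb (.const 0) (.op .plus adjTerm (.op .equal (.reg 3) (.reg 4)))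
    (.op .plus (.reg 5) (.op .minus (.load 1 (.reg 4)) (.reg 5))) (.reg 5)

open scoped Classical in
/-- The largest colour number in the closed neighbourhood of `v`. -/
noncomputable def maxColor (G : SimpleGraph (Fin n)) (q : Fin n → ℕ) (v : Fin n) : ℕ :=
  (Finset.univ.filter fun w => w = v ∨ G.Adj w v).sup q

open scoped Classical in
/-- The number of vertices in the closed neighbourhood of `v` with a smaller colour number. -/
noncomputable def conflicts (G : SimpleGraph (Fin n)) (q : Fin n → ℕ) (v : Fin n) : ℕ :=
  (Finset.univ.filter fun w => (w = v ∨ G.Adj w v) ∧ 0 < q w ∧ q w < maxColor G q v).card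

theorem runs_maxColorTable {mb : ℕ} (hW : Large n W) (hn : 0 < n) (h0 : σ.reg 0 = n)
    (hG : σ.mem 0 = adjacencyCell G) {q : Fin n → ℕ} (hq : ∀ v, q v < W)
    (hσ : Holds σ 1 q) (hmb : 0 ≠ mb) (hne : 1 ≠ mb) :
    Runs W (maxColorTable mb) σ (220 * n ^ 2) fun τ =>
      Agree mb σ τ ∧ Holds τ mb (maxColor G q) := by
  classical
  have hl := hW.lt
  have hqW : ∀ (P : Fin n → Prop) m, supBelow P q m < W := fun P m => by
    have := supBelow_le (P := P) (fun i => Nat.le_sub_one_of_lt (hq i)) m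
    omega
  refine Runs.table (fun v m => supBelow (fun w => w = v ∨ G.Adj w v) q m)
    _ hn (by omega) h0 (by simp [Term.cost, adjTerm]) ?_ ?_ ?_
  · intro τ v h h3
    simp only [Term.Fits, Term.eval, supBelow_zero, and_true]
    omega
  · intro τ v w h h3 h4 h5
    have e4 := hσ.of_agree h hne w
    have b3 := hq v
    have b4 := hq w
    have b5 := v.isLt
    have b6 := w.isLt
    obtain ⟨a1, a2⟩ := adjTerm_spec (G := G) hW (by rw [h.reg 0 (by omega), h0])
      (by rw [h.mem 0 hmb, hG]) h3 h4
    have b7 := hqW (fun w => w = v ∨ G.Adj w v) w.val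
    rw [supBelow_succ]
    simp only [Term.Fits, Term.eval, Op.eval, h3, h4, h5, e4, a1, a2, G.adj_comm w v]
    by_cases c2 : w = v
    · subst c2
      simp
      omega
    · by_cases c1 : G.Adj v w <;> simp [c1, c2, ← Fin.ext_iff, eq_comm (a := v)] <;> omega
  · intro τ v h h3 h5
    have b6 := hqW (fun w => w = v ∨ G.Adj w v) n
    have b7 := supBelow_eq (P := fun w => w = v ∨ G.Adj w v) (g := q)
    simp only [Term.Fits, Term.eval, h5, maxColor, ← b7, and_true]
    omega

/-- The table of `conflicts`. -/
def conflictTable (mb cb : ℕ) : Program :=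
  table cb (.const 0) (.op .times (.op .plus adjTerm (.op .equal (.reg 3) (.reg 4)))
      (.op .times (.op .less (.const 0) (.load 1 (.reg 4)))
        (.op .less (.load 1 (.reg 4)) (.load mb (.reg 3)))))
    (.op .plus (.reg 5) (.const 1)) (.reg 5)

theorem runs_conflictTable {mb cb : ℕ} (hW : Large n W) (hn : 0 < n) (h0 : σ.reg 0 = n)
    (hG : σ.mem 0 = adjacencyCell G) {q : Fin n → ℕ} (hq : ∀ v, q v < W)
    (hσ : Holds σ 1 q) (hm : Holds σ mb (maxColor G q)) (hcb : 0 ≠ cb) (hne : 1 ≠ cb)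
    (hne' : mb ≠ cb) :
    Runs W (conflictTable mb cb) σ (220 * n ^ 2) fun τ =>
      Agree cb σ τ ∧ Holds τ cb (conflicts G q) := by
  classical
  have hl := hW.lt
  have hqW : ∀ v, maxColor G q v < W := fun v => by
    have : maxColor G q v ≤ W - 1 := Finset.sup_le fun i _ => Nat.le_sub_one_of_lt (hq i)
    omega
  refine Runs.table (fun v m => countBelow
      (fun w => (w = v ∨ G.Adj w v) ∧ 0 < q w ∧ q w < maxColor G q v) m)
    _ hn (by omega) h0 (by simp [Term.cost, adjTerm]) ?_ ?_ ?_
  · intro τ v h h3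
    simp only [Term.Fits, Term.eval, countBelow_zero, and_true]
    omega
  · intro τ v w h h3 h4 h5
    have e4 := hσ.of_agree h hne w
    have e5 := hm.of_agree h hne' v
    have b2 := hqW v
    have b4 := hq w
    have b5 := v.isLt
    have b6 := w.isLt
    obtain ⟨a1, a2⟩ := adjTerm_spec (G := G) hW (by rw [h.reg 0 (by omega), h0])
      (by rw [h.mem 0 hcb, hG]) h3 h4
    have b7 := countBelow_le
      (P := fun w => (w = v ∨ G.Adj w v) ∧ 0 < q w ∧ q w < maxColor G q v) w.val
    rw [countBelow_succ]
    simp only [Term.Fits, Term.eval, Op.eval, h3, h4, h5, e4, e5, a1, a2, G.adj_comm w v]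
    by_cases c3 : 0 < q w <;> by_cases c4 : q w < maxColor G q v <;> by_cases c2 : w = v
    all_goals first
      | (subst c2
         simp [c3, c4]
         omega)
      | (by_cases c1 : G.Adj v w <;>
          simp [c1, c2, c3, c4, ← Fin.ext_iff, eq_comm (a := v)] <;> omega)
  · intro τ v h h3 h5
    have b6 := countBelow_le
      (P := fun w => (w = v ∨ G.Adj w v) ∧ 0 < q w ∧ q w < maxColor G q v) n
    have b7 := countBelow_eq
      (P := fun w => (w = v ∨ G.Adj w v) ∧ 0 < q w ∧ q w < maxColor G q v)
    simp only [Term.Fits, Term.eval, h5, conflicts, ← b7, and_true]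
    omega

end Tables

end WordRAM

/-! ### Breadth-first search -/

section Search

variable {V : Type*}

/-- The invariant of a breadth-first search: `lab` is zero on the vertices that have not been
found, the neighbours of the vertices in `done` have been found, and `cur` is the label of the
last vertex that was taken up. -/
structure SearchInv (G : SimpleGraph V) (key lab : V → ℕ) (done : Finset V) (root : V → V)
    (cur : ℕ) : Prop where
  found : ∀ u ∈ done, lab u ≠ 0
  le_cur : ∀ u ∈ done, lab u ≤ cur
  near_cur : ∀ u ∉ done, lab u ≠ 0 → cur ≤ lab u ∧ lab u ≤ cur + 1
  root_eq : ∀ u ∉ done, ∀ v ∉ done, lab u ≠ 0 → lab v ≠ 0 → root u = root v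
  handled : ∀ u ∈ done, ∀ v, G.Adj u v → lab v ≠ 0 ∧ root v = root u ∧ lab v ≤ lab u + 1
  root_eq_of_lab_eq : ∀ u v, lab u ≠ 0 → lab u = lab v → root u = root v
  root_root : ∀ v, lab v ≠ 0 → lab (root v) ≠ 0 ∧ root (root v) = root v
  key_le_of_unfound : ∀ v, lab v ≠ 0 → ∀ u, lab u = 0 → key u ≤ key (root v)
  key_le : ∀ v, lab v ≠ 0 → key v ≤ key (root v)
  parent : ∀ v, lab v ≠ 0 → v ≠ root v →
    lab (root v) < lab v ∧ ∃ w, G.Adj w v ∧ lab w ≠ 0 ∧ lab v = lab w + 1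

namespace SearchInv

variable {G : SimpleGraph V} {key lab : V → ℕ} {done : Finset V} {root : V → V} {cur : ℕ}

theorem init (G : SimpleGraph V) (key : V → ℕ) : SearchInv G key (fun _ => 0) ∅ id 0 := by
  constructor <;> simp

/-- Waiting vertices carry the label `cur` or `cur + 1`. As `x` has the least of their labels, they
all lie in the window that starts at `lab x`. -/
theorem select_found (h : SearchInv G key lab done root cur) {x : V} (hx : x ∉ done)
    (hl : lab x ≠ 0) (hmin : ∀ u ∉ done, lab u ≠ 0 → lab x ≤ lab u) :
    SearchInv G key lab done root (lab x) where
  found := h.found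
  le_cur u hu := (h.le_cur u hu).trans (h.near_cur x hx hl).1
  near_cur u hu hlu := ⟨hmin u hu hlu, (h.near_cur u hu hlu).2.trans
    (Nat.add_le_add_right (h.near_cur x hx hl).1 1)⟩
  root_eq := h.root_eq
  handled := h.handled
  root_eq_of_lab_eq := h.root_eq_of_lab_eq
  root_root := h.root_root
  key_le_of_unfound := h.key_le_of_unfound
  key_le := h.key_le
  parent := h.parent

/-- When nothing is waiting, all labels in use are at most `cur`, so `cur + 1` is fresh and
separates the new component from the old ones. The new root dominates the keys of all unfound
vertices, among them the rest of its component. -/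
theorem select_new [DecidableEq V] (h : SearchInv G key lab done root cur) {x : V}
    (hl : lab x = 0) (hno : ∀ u ∉ done, lab u = 0) (hmax : ∀ u, lab u = 0 → key u ≤ key x) :
    SearchInv G key (Function.update lab x (cur + 1)) done (Function.update root x x)
      (cur + 1) := by
  have hx : x ∉ done := fun hx => h.found x hx hl
  have hne : ∀ v, lab v ≠ 0 → v ≠ x := by rintro v hv rfl; exact hv hl
  have hd : ∀ u, u ∉ done → u ≠ x → Function.update lab x (cur + 1) u = 0 := by
    intro u hu hux
    rw [Function.update_of_ne hux, hno u hu]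
  have hf : ∀ u, u ≠ x → Function.update lab x (cur + 1) u ≠ 0 → lab u ≠ 0 := by
    intro u hux
    rw [Function.update_of_ne hux]
    exact id
  have hdone : ∀ u, lab u ≠ 0 → u ∈ done := fun u hu => by
    by_contra hc; exact hu (hno u hc)
  constructor
  · intro u hu
    rw [Function.update_of_ne (hne u (h.found u hu))]
    exact h.found u hu
  · intro u hu
    rw [Function.update_of_ne (hne u (h.found u hu))]
    exact (h.le_cur u hu).trans (Nat.le_succ _)
  · intro u hu hlu
    by_cases hux : u = x
    · subst hux; simp
    · exact absurd (hd u hu hux) hlu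
  · intro u hu v hv hlu hlv
    by_cases hux : u = x
    · by_cases hvx : v = x
      · rw [hux, hvx]
      · exact absurd (hd v hv hvx) hlv
    · exact absurd (hd u hu hux) hlu
  · intro u hu v huv
    have h1 := h.handled u hu v huv
    rw [Function.update_of_ne (hne u (h.found u hu)), Function.update_of_ne (hne v h1.1),
      Function.update_of_ne (hne u (h.found u hu)), Function.update_of_ne (hne v h1.1)]
    exact h1
  · intro u v hu huv
    by_cases hux : u = x <;> by_cases hvx : v = x
    · rw [hux, hvx]
    · subst hux
      rw [Function.update_self, Function.update_of_ne hvx] at huv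
      have := h.le_cur v (hdone v (by omega))
      omega
    · subst hvx
      rw [Function.update_self, Function.update_of_ne hux] at huv
      have := h.le_cur u (hdone u (by omega))
      omega
    · rw [Function.update_of_ne hux] at hu
      rw [Function.update_of_ne hux, Function.update_of_ne hvx] at huv ⊢
      exact h.root_eq_of_lab_eq u v hu huv
  · intro v hv
    by_cases hvx : v = x
    · subst hvx; simp
    · have h1 := h.root_root v (hf v hvx hv)
      rw [Function.update_of_ne hvx, Function.update_of_ne (hne _ h1.1),
        Function.update_of_ne (hne _ h1.1)]
      exact h1
  · intro v hv u hu
    have hux : u ≠ x := by rintro rfl; simp at hu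
    rw [Function.update_of_ne hux] at hu
    by_cases hvx : v = x
    · subst hvx; simpa using hmax u hu
    · rw [Function.update_of_ne hvx]
      exact h.key_le_of_unfound v (hf v hvx hv) u hu
  · intro v hv
    by_cases hvx : v = x
    · subst hvx; simp
    · rw [Function.update_of_ne hvx]
      exact h.key_le v (hf v hvx hv)
  · intro v hv hvr
    by_cases hvx : v = x
    · subst hvx; simp at hvr
    · rw [Function.update_of_ne hvx] at hv hvr ⊢
      obtain ⟨h1, w, h2, h3, h4⟩ := h.parent v hv hvr
      rw [Function.update_of_ne hvx, Function.update_of_ne (hne _ (h.root_root v hv).1)]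
      refine ⟨h1, w, h2, ?_⟩
      rw [Function.update_of_ne (hne w h3)]
      exact ⟨h3, h4⟩

/-- The label `cur + 1` can only be shared with waiting vertices, and these have the same root as
`x`. -/
theorem visit [DecidableEq V] (h : SearchInv G key lab done root cur) {x w : V} (hx : x ∉ done)
    (hlx : lab x = cur) (hcur : cur ≠ 0) (hxw : G.Adj x w) (hl : lab w = 0) :
    SearchInv G key (Function.update lab w (cur + 1)) done (Function.update root w (root x))
      cur := by
  have hx0 : lab x ≠ 0 := by omega
  have hne : ∀ v, lab v ≠ 0 → v ≠ w := by rintro v hv rfl; exact hv hl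
  have hf : ∀ u, u ≠ w → Function.update lab w (cur + 1) u ≠ 0 → lab u ≠ 0 := by
    intro u hux
    rw [Function.update_of_ne hux]
    exact id
  have hrx : ∀ v ∉ done, lab v ≠ 0 → root v = root x := fun v hv hlv =>
    h.root_eq v hv x hx hlv hx0
  have hrr := h.root_root x hx0
  have hroot : ∀ v ∉ done, Function.update lab w (cur + 1) v ≠ 0 →
      Function.update root w (root x) v = root x := by
    intro v hv hlv
    by_cases hvw : v = w
    · subst hvw; simp
    · rw [Function.update_of_ne hvw]
      exact hrx v hv (hf v hvw hlv)
  have hlr : lab (root x) ≤ cur := by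
    by_cases hc : x = root x
    · rw [← hc]; omega
    · have := (h.parent x hx0 hc).1
      omega
  constructor
  · intro u hu
    rw [Function.update_of_ne (hne u (h.found u hu))]
    exact h.found u hu
  · intro u hu
    rw [Function.update_of_ne (hne u (h.found u hu))]
    exact h.le_cur u hu
  · intro u hu hlu
    by_cases hux : u = w
    · subst hux; simp
    · rw [Function.update_of_ne hux] at hlu ⊢
      exact h.near_cur u hu hlu
  · intro u hu v hv hlu hlv
    rw [hroot u hu hlu, hroot v hv hlv]
  · intro u hu v huv
    have h1 := h.handled u hu v huv
    rw [Function.update_of_ne (hne u (h.found u hu)), Function.update_of_ne (hne v h1.1),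
      Function.update_of_ne (hne u (h.found u hu)), Function.update_of_ne (hne v h1.1)]
    exact h1
  · have key1 : ∀ v, v ≠ w → cur + 1 = lab v → root v = root x := by
      intro v hv hlv
      refine hrx v (fun hd => ?_) (by omega)
      have := h.le_cur v hd
      omega
    intro u v hu huv
    by_cases hux : u = w <;> by_cases hvx : v = w
    · rw [hux, hvx]
    · subst hux
      rw [Function.update_self, Function.update_of_ne hvx] at huv ⊢
      exact (key1 v hvx huv).symm
    · subst hvx
      rw [Function.update_self, Function.update_of_ne hux] at huv ⊢
      exact key1 u hux huv.symm
    · rw [Function.update_of_ne hux] at hu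
      rw [Function.update_of_ne hux, Function.update_of_ne hvx] at huv ⊢
      exact h.root_eq_of_lab_eq u v hu huv
  · intro v hv
    have : ∀ y, lab (root y) ≠ 0 ∧ root (root y) = root y →
        Function.update lab w (cur + 1) (root y) ≠ 0 ∧
          Function.update root w (root x) (root y) = root y := by
      intro y hy
      rw [Function.update_of_ne (hne _ hy.1), Function.update_of_ne (hne _ hy.1)]
      exact hy
    by_cases hvx : v = w
    · rw [hvx, Function.update_self]
      exact this x hrr
    · rw [Function.update_of_ne hvx]
      exact this v (h.root_root v (hf v hvx hv))
  · intro v hv u hu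
    have hux : u ≠ w := by rintro rfl; simp at hu
    rw [Function.update_of_ne hux] at hu
    by_cases hvx : v = w
    · rw [hvx, Function.update_self]
      exact h.key_le_of_unfound x hx0 u hu
    · rw [Function.update_of_ne hvx]
      exact h.key_le_of_unfound v (hf v hvx hv) u hu
  · intro v hv
    by_cases hvx : v = w
    · rw [hvx, Function.update_self]
      exact h.key_le_of_unfound x hx0 w hl
    · rw [Function.update_of_ne hvx]
      exact h.key_le v (hf v hvx hv)
  · intro v hv hvr
    by_cases hvx : v = w
    · rw [hvx, Function.update_self, Function.update_self, Function.update_of_ne (hne _ hrr.1)]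
      refine ⟨by omega, x, hxw, ?_⟩
      rw [Function.update_of_ne (hne x hx0)]
      exact ⟨hx0, by rw [hlx]⟩
    · rw [Function.update_of_ne hvx] at hv hvr ⊢
      obtain ⟨h1, y, h2, h3, h4⟩ := h.parent v hv hvr
      rw [Function.update_of_ne hvx, Function.update_of_ne (hne _ (h.root_root v hv).1)]
      refine ⟨h1, y, h2, ?_⟩
      rw [Function.update_of_ne (hne y h3)]
      exact ⟨h3, h4⟩

/-- A neighbour of `x` that is done has a label at most `cur` and, by symmetry of adjacency, the
right root; any other neighbour is waiting, so its label is at most `cur + 1`. -/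
theorem finish [DecidableEq V] (h : SearchInv G key lab done root cur) {x : V} (hx : x ∉ done)
    (hlx : lab x = cur) (hcur : cur ≠ 0) (hnb : ∀ v, G.Adj x v → lab v ≠ 0) :
    SearchInv G key lab (insert x done) root cur where
  found u hu := by
    rcases Finset.mem_insert.1 hu with rfl | hu
    · omega
    · exact h.found u hu
  le_cur u hu := by
    rcases Finset.mem_insert.1 hu with rfl | hu
    · omega
    · exact h.le_cur u hu
  near_cur u hu := h.near_cur u fun hc => hu (Finset.mem_insert_of_mem hc)
  root_eq u hu v hv := h.root_eq u (fun hc => hu (Finset.mem_insert_of_mem hc)) v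
    (fun hc => hv (Finset.mem_insert_of_mem hc))
  handled u hu v huv := by
    rcases Finset.mem_insert.1 hu with rfl | hu
    · have hv := hnb v huv
      refine ⟨hv, ?_⟩
      by_cases hd : v ∈ done
      · have := h.le_cur v hd
        exact ⟨(h.handled v hd u huv.symm).2.1.symm, by omega⟩
      · have := h.near_cur v hd hv
        exact ⟨h.root_eq v hd u hx hv (by omega), by omega⟩
    · exact h.handled u hu v huv
  root_eq_of_lab_eq := h.root_eq_of_lab_eq
  root_root := h.root_root
  key_le_of_unfound := h.key_le_of_unfound
  key_le := h.key_le
  parent := h.parent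

theorem isLayering [Fintype V] (h : SearchInv G key lab Finset.univ root cur) :
    IsLayering G key root lab where
  root_eq_of_adj u v huv := (h.handled u (Finset.mem_univ u) v huv).2.1.symm
  root_eq_of_lab_eq u v := h.root_eq_of_lab_eq u v (h.found u (Finset.mem_univ u))
  root_root v := (h.root_root v (h.found v (Finset.mem_univ v))).2
  key_le v := h.key_le v (h.found v (Finset.mem_univ v))
  lab_root_lt v hv := (h.parent v (h.found v (Finset.mem_univ v)) hv).1
  exists_parent v hv := by
    obtain ⟨w, h1, -, h2⟩ := (h.parent v (h.found v (Finset.mem_univ v)) hv).2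
    exact ⟨w, h1, h2⟩
  lab_le u v huv := (h.handled u (Finset.mem_univ u) v huv).2.2

end SearchInv

/-- The priority of a vertex in the search: found vertices come before the others, by
increasing label. -/
def searchPriority [DecidableEq V] (M : ℕ) (key lab : V → ℕ) (done : Finset V) (v : V) : ℕ :=
  if v ∈ done then 0 else if lab v = 0 then key v else M - lab v

/-! ### Priorities that realise the order of the search. -/

variable {n : ℕ} {G : SimpleGraph (Fin n)} {key : Fin n → ℕ}

theorem SearchInv.lab_le {lab done root cur h} (hs : SearchInv G key lab done root cur)
    (hcur : cur ≤ h) (v : Fin n) : lab v ≤ h + 1 := by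
  by_cases hv : v ∈ done
  · have := hs.le_cur v hv; omega
  · by_cases h0 : lab v = 0
    · omega
    · have := hs.near_cur v hv h0; omega

theorem searchPriority_le {lab : Fin n → ℕ} {M : ℕ} {done : Finset (Fin n)}
    (hkey : ∀ v, key v ≤ M) (v : Fin n) : searchPriority M key lab done v ≤ M := by
  unfold searchPriority
  split_ifs
  · exact Nat.zero_le _
  · exact hkey v
  · exact Nat.sub_le _ _

theorem searchPriority_visit {lab : Fin n → ℕ} {M c : ℕ} {used : Finset (Fin n)} {w : Fin n}
    (hw : w ∉ used) : searchPriority M key (Function.update lab w (c + 1)) used =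
      Function.update (searchPriority M key lab used) w (M - (c + 1)) := by
  funext v
  by_cases hvw : v = w
  · subst hvw
    simp [searchPriority, hw]
  · simp [searchPriority, Function.update_of_ne hvw]

theorem searchPriority_insert {lab lab' : Fin n → ℕ} {M : ℕ} {done : Finset (Fin n)} {x : Fin n}
    (h : ∀ v, v ≠ x → lab' v = lab v) : searchPriority M key lab' (insert x done) =
      Function.update (searchPriority M key lab done) x 0 := by
  funext v
  by_cases hvx : v = x
  · subst hvx
    simp [searchPriority]
  · simp [searchPriority, hvx, h v hvx]

/-- What is known about a vertex of maximal priority. -/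
theorem SearchInv.of_searchPriority_max {lab : Fin n → ℕ} {done root cur}
    (h : SearchInv G key lab done root cur) (hkey : ∀ v, 0 < key v ∧ key v ≤ n * (n + 1) + n)
    (hcur : cur < n) (hcard : done.card < n) {x : Fin n}
    (hmax : ∀ v, searchPriority ((n + 2) * (n + 2)) key lab done v ≤
      searchPriority ((n + 2) * (n + 2)) key lab done x) :
    x ∉ done ∧ (lab x ≠ 0 → ∀ u ∉ done, lab u ≠ 0 → lab x ≤ lab u) ∧
      (lab x = 0 → (∀ u ∉ done, lab u = 0) ∧ ∀ u, lab u = 0 → key u ≤ key x) := by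
  -- Labels are so small that every found vertex that is not done has a higher priority than any
  -- key, and keys are positive, so done vertices come last.
  have hM : n * (n + 1) + n + (n + 1) < (n + 2) * (n + 2) := by nlinarith
  have hlab := h.lab_le le_rfl
  have hx : x ∉ done := by
    intro hx
    obtain ⟨u, hu⟩ : ∃ u, u ∉ done := by
      by_contra! hc
      rw [Finset.eq_univ_iff_forall.2 hc, Finset.card_univ, Fintype.card_fin] at hcard
      omega
    have h1 := hmax u
    have h2 := hlab u
    have h3 := (hkey u).1
    simp only [searchPriority, hx, hu, if_true, if_false] at h1
    split_ifs at h1 <;> omega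
  refine ⟨hx, fun hl u hu hlu => ?_, fun hl => ⟨fun u hu => ?_, fun u hlu => ?_⟩⟩
  · have h1 := hmax u
    have h2 := hlab u
    simp only [searchPriority, hx, hu, hl, hlu, if_false] at h1
    omega
  · by_contra hlu
    have h1 := hmax u
    have h2 := hlab u
    have h3 := (hkey x).2
    simp only [searchPriority, hx, hu, hl, hlu, if_false, if_true] at h1
    omega
  · have h1 := hmax u
    have hu : u ∉ done := fun hu => h.found u hu hlu
    simpa only [searchPriority, hx, hu, hl, hlu, if_false, if_true] using h1

end Search

/-! ### The search as a program. -/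

namespace WordRAM

/-- The states `σ` and `τ` differ at most in the banks `b` and `c` and in registers from `3`
to `8`. -/
structure AgreeTwo (b c : ℕ) (σ τ : State) : Prop where
  reg : ∀ r, (r < 3 ∨ 8 < r) → τ.reg r = σ.reg r
  mem : ∀ b', b' ≠ b → b' ≠ c → τ.mem b' = σ.mem b'

theorem AgreeTwo.refl (b c : ℕ) (σ : State) : AgreeTwo b c σ σ :=
  ⟨fun _ _ => rfl, fun _ _ _ => rfl⟩

theorem AgreeTwo.setReg {b c r : ℕ} {σ τ : State} (h : AgreeTwo b c σ τ) (hr : 3 ≤ r ∧ r ≤ 8)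
    (x : ℕ) : AgreeTwo b c σ (τ.setReg r x) := by
  refine ⟨fun r' hr' => ?_, h.mem⟩
  rw [State.setReg_reg, if_neg (by omega), h.reg r' hr']

theorem AgreeTwo.setMem {b c d : ℕ} {σ τ : State} (h : AgreeTwo b c σ τ) (hd : d = b ∨ d = c)
    (i x : ℕ) : AgreeTwo b c σ (τ.setMem d i x) :=
  ⟨h.reg, fun b' hb hc => by
    rw [State.setMem_mem, if_neg (by rintro rfl; exact hd.elim hb hc), h.mem b' hb hc]⟩

theorem Holds.setReg {n b r x : ℕ} {f : Fin n → ℕ} {σ : State} (h : Holds σ b f) :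
    Holds (σ.setReg r x) b f := h

theorem Holds.setMem_of_ne {n b c i x : ℕ} {f : Fin n → ℕ} {σ : State} (h : Holds σ b f)
    (hb : b ≠ c) : Holds (σ.setMem c i x) b f := fun v => by
  rw [State.setMem_mem, if_neg hb]; exact h v

theorem Holds.setMem {n b x : ℕ} {f : Fin n → ℕ} {σ : State} (h : Holds σ b f) (i : Fin n) :
    Holds (σ.setMem b i.val x) b (Function.update f i x) := fun v => by
  rw [State.setMem_mem, if_pos rfl, Function.update_apply, Function.update_apply]
  simp only [← Fin.ext_iff]
  split_ifs
  · rfl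
  · exact h v

/-- Breadth-first search: the keys in bank `kb` are turned into priorities, and the labels are
written to bank `lb`. Register `3` holds the vertex that is taken up, register `6` a large
number, and register `7` the current label. -/
def searchLoop (kb lb : ℕ) : Program :=
  forLoop 5 0 (.seq (.assign 3 (.const 0)) (.seq
    (forLoop 4 0 (.ite (.op .less (.load kb (.reg 3)) (.load kb (.reg 4)))
      (.assign 3 (.reg 4)) .skip)) (.seq
    (.ite (.load lb (.reg 3)) .skip (.store lb (.reg 3) (.op .plus (.reg 7) (.const 1)))) (.seq
    (.assign 7 (.load lb (.reg 3))) (.seq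
    (.store kb (.reg 3) (.const 0))
    (forLoop 4 0 (.ite (.op .times adjTerm (.op .equal (.load lb (.reg 4)) (.const 0)))
      (.seq (.store lb (.reg 4) (.op .plus (.reg 7) (.const 1)))
        (.store kb (.reg 4) (.op .minus (.reg 6) (.op .plus (.reg 7) (.const 1)))))
      .skip)))))))

/-- Breadth-first search. -/
def search (kb lb : ℕ) : Program :=
  .seq (.assign 6 (.op .times (.op .plus (.reg 0) (.const 2)) (.op .plus (.reg 0) (.const 2))))
    (.seq (.assign 7 (.const 0)) (searchLoop kb lb))

section SearchProgram

variable {n W : ℕ} {G : SimpleGraph (Fin n)} {σ : State} {key : Fin n → ℕ} {kb lb : ℕ}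

/-- The situation during a search. -/
structure Searching (G : SimpleGraph (Fin n)) (key : Fin n → ℕ) (kb lb : ℕ) (σ τ : State)
    (lab : Fin n → ℕ) (done : Finset (Fin n)) (root : Fin n → Fin n) (cur h : ℕ) :
    Prop where
  reg0 : τ.reg 0 = n
  reg5 : τ.reg 5 = h
  reg6 : τ.reg 6 = (n + 2) * (n + 2)
  reg7 : τ.reg 7 = cur
  agree : AgreeTwo kb lb σ τ
  inv : SearchInv G key lab done root cur
  labs : Holds τ lb lab

theorem Searching.setReg {τ : State} {lab done root cur h}
    (hs : Searching G key kb lb σ τ lab done root cur h) {r : ℕ} (hr : r = 3 ∨ r = 4)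
    (x : ℕ) : Searching G key kb lb σ (τ.setReg r x) lab done root cur h where
  reg0 := by rw [State.setReg_reg, if_neg (by omega), hs.reg0]
  reg5 := by rw [State.setReg_reg, if_neg (by omega), hs.reg5]
  reg6 := by rw [State.setReg_reg, if_neg (by omega), hs.reg6]
  reg7 := by rw [State.setReg_reg, if_neg (by omega), hs.reg7]
  agree := hs.agree.setReg (by omega) x
  inv := hs.inv
  labs := hs.labs

/-- The scan for a vertex of maximal priority. -/
theorem runs_selectMax (hW : Large n W) (hn : 0 < n) (h0 : σ.reg 0 = n) {f : Fin n → ℕ}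
    (hf : ∀ v, f v < W) (hσ : Holds σ kb f) (h3 : σ.reg 3 = 0) :
    Runs W (forLoop 4 0 (.ite (.op .less (.load kb (.reg 3)) (.load kb (.reg 4)))
      (.assign 3 (.reg 4)) .skip)) σ (18 * n + 6) fun τ => ∃ x : Fin n,
        τ = (σ.setReg 3 x.val).setReg 4 n ∧ ∀ v, f v ≤ f x := by
  have hl := hW.lt
  have hset : ∀ (x y x' y' : ℕ), (((σ.setReg 3 x).setReg 4 y).setReg 3 x').setReg 4 y' =
      (σ.setReg 3 x').setReg 4 y' := by
    intro x y x' y'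
    simp only [State.setReg, State.mk.injEq, and_true]
    funext r
    simp only [Function.update_apply]
    split_ifs <;> rfl
  have hset' : ∀ (x y y' : ℕ), ((σ.setReg 3 x).setReg 4 y).setReg 4 y' =
      (σ.setReg 3 x).setReg 4 y' := by
    intro x y y'
    simp only [State.setReg, State.mk.injEq, and_true]
    funext r
    simp only [Function.update_apply]
    split_ifs <;> rfl
  have hself : σ = σ.setReg 3 0 := by
    obtain ⟨reg, mem⟩ := σ
    simp only [State.setReg, State.mk.injEq, and_true]
    funext r
    simp only [Function.update_apply]
    split_ifs with hr
    · rw [hr]; exact h3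
    · rfl
  refine Runs.forLoop (N := n) (c := 10) (fun m τ => ∃ x : Fin n,
    τ = (σ.setReg 3 x.val).setReg 4 m ∧ ∀ v : Fin n, v.val < m → f v ≤ f x) (by omega) ?_ ?_ ?_
    (by omega) ?_
  · exact ⟨⟨0, hn⟩, by rw [← hself], fun v hv => absurd hv (Nat.not_lt_zero _)⟩
  · rintro m τ ⟨x, rfl, -⟩
    simp [h0]
  · rintro m hm τ ⟨x, rfl, hx⟩
    have e1 := hσ x
    have e2 := hσ ⟨m, hm⟩
    have b1 := hf x
    have b2 := hf ⟨m, hm⟩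
    have b3 := x.isLt
    simp only at e2
    refine Runs.ite (T' := 3) ?_ (by simp [Term.cost]) (fun hc => ?_) (fun hc => ?_)
    · simp only [Term.Fits, Term.eval, Op.eval, State.setReg_reg, State.setReg_mem]
      simp only [if_true, (by decide : ¬ (3 = 4)), if_false, e1, e2]
      refine ⟨⟨by omega, b1⟩, ⟨by omega, b2⟩, ?_⟩
      split_ifs <;> omega
    · have hlt : f x < f ⟨m, hm⟩ := by
        by_contra hlt
        apply hc
        simp [Term.eval, Op.eval, e1, e2, hlt]
      refine Runs.assign ?_ (by simp [Term.cost]) ?_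
      · simp [Term.Fits]; omega
      · refine ⟨by simp [Term.eval], ⟨m, hm⟩, ?_, fun v hv => ?_⟩
        · rw [hset]; simp [Term.eval]
        · rcases Nat.lt_succ_iff_lt_or_eq.1 hv with hv | hv
          · exact (hx v hv).trans hlt.le
          · rw [(Fin.ext hv : v = ⟨m, hm⟩)]
    · have hlt : f ⟨m, hm⟩ ≤ f x := by
        by_contra hlt
        rw [not_le] at hlt
        simp [Term.eval, Op.eval, e1, e2, hlt] at hc
      refine Runs.skip (by omega) ⟨by simp, x, hset' _ _ _, fun v hv => ?_⟩
      rcases Nat.lt_succ_iff_lt_or_eq.1 hv with hv | hv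
      · exact hx v hv
      · rw [(Fin.ext hv : v = ⟨m, hm⟩)]
        exact hlt
  · rintro τ ⟨x, rfl, hx⟩
    exact ⟨x, rfl, fun v => hx v v.isLt⟩

/-- Finding the neighbours of the vertex in register `3`. -/
theorem runs_visitAll (hW : Large n W) (hG : σ.mem 0 = adjacencyCell G) {τ : State}
    {lab done root cur h} (hk : 0 ≠ kb) (hl : 0 ≠ lb) (hkl : kb ≠ lb) {x : Fin n}
    (hs : Searching G key kb lb σ τ lab done root cur h)
    (hp : Holds τ kb (searchPriority ((n + 2) * (n + 2)) key lab (insert x done))) (hx : x ∉ done)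
    (hlx : lab x = cur) (hcur : cur ≠ 0) (hcn : cur ≤ n) (h3 : τ.reg 3 = x.val) :
    Runs W (forLoop 4 0 (.ite (.op .times adjTerm (.op .equal (.load lb (.reg 4)) (.const 0)))
      (.seq (.store lb (.reg 4) (.op .plus (.reg 7) (.const 1)))
        (.store kb (.reg 4) (.op .minus (.reg 6) (.op .plus (.reg 7) (.const 1)))))
      .skip)) τ (50 * n + 6) fun ρ => ∃ lab' root',
        Searching G key kb lb σ ρ lab' (insert x done) root' cur h ∧
        Holds ρ kb (searchPriority ((n + 2) * (n + 2)) key lab' (insert x done)) := by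
  classical
  have hlt := hW.lt
  have hM : (n + 2) * (n + 2) < W := by unfold Large at hW; nlinarith
  -- During the scan `x` counts as done for the priorities, whose entry for `x` has already been
  -- cleared, but not for the search invariant, which would require that all neighbours of `x` have
  -- been found.
  refine Runs.forLoop (N := n) (c := 42) (fun m ρ => (ρ.reg 4 = m ∧ ρ.reg 0 = n) ∧
    ρ.reg 3 = x.val ∧ ∃ lab' root',
      Searching G key kb lb σ ρ lab' done root' cur h ∧
      Holds ρ kb (searchPriority ((n + 2) * (n + 2)) key lab' (insert x done)) ∧ lab' x = cur ∧
      ∀ v : Fin n, v.val < m → G.Adj x v → lab' v ≠ 0) (by omega) ?_ (fun m ρ h => h.1) ?_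
      (by omega) ?_
  · exact ⟨by simpa using hs.reg0, by simpa using h3, lab, root, hs.setReg (by omega) _, hp, hlx,
      fun v hv => absurd hv (Nat.not_lt_zero _)⟩
  · rintro m hm ρ ⟨⟨g4, g0⟩, g3, lab', root', hs', hp', hlx', hnb⟩
    obtain ⟨a1, a2⟩ := adjTerm_spec (G := G) (v := ⟨m, hm⟩) hW g0
      (by rw [hs'.agree.mem 0 hk hl, hG]) g3 g4
    have e1 : ρ.mem lb m = lab' ⟨m, hm⟩ := hs'.labs ⟨m, hm⟩
    have b1 := hs'.inv.lab_le le_rfl ⟨m, hm⟩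
    refine Runs.ite (T' := 14) ?_ (by simp [Term.cost, adjTerm]) (fun hc => ?_) (fun hc => ?_)
    · simp only [Term.Fits, Term.eval, Op.eval, g4, e1, a1, a2]
      by_cases c1 : G.Adj x ⟨m, hm⟩ <;> by_cases c2 : lab' ⟨m, hm⟩ = 0 <;> simp [c1, c2] <;> omega
    · have hc' : G.Adj x ⟨m, hm⟩ ∧ lab' ⟨m, hm⟩ = 0 := by
        simp only [Term.eval, Op.eval, g4, e1, a2] at hc
        by_contra hne
        apply hc
        rcases not_and_or.1 hne with hne | hne <;> simp [hne]
      obtain ⟨hadj, hl0⟩ := hc'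
      have hne : (⟨m, hm⟩ : Fin n) ≠ x := by
        intro he; rw [he] at hl0; omega
      have hwd : (⟨m, hm⟩ : Fin n) ∉ insert x done := by
        rw [Finset.mem_insert, not_or]
        exact ⟨hne, fun hd => hs'.inv.found _ hd hl0⟩
      have hv1 : Term.eval ρ (.op .plus (.reg 7) (.const 1)) = cur + 1 := by
        simp [Term.eval, Op.eval, hs'.reg7]
      refine Runs.seq (T₁ := 5) (T₂ := 7) (Runs.store ?_ ?_ (by simp [Term.cost]) ?_) (by omega)
      · simp only [Term.Fits]; omega
      · simp only [Term.Fits, Term.eval, Op.eval, hs'.reg7]; omega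
      refine Runs.store ?_ ?_ (by simp [Term.cost]) ?_
      · simp only [Term.Fits, State.setMem_reg]; omega
      · simp only [Term.Fits, Term.eval, Op.eval, State.setMem_reg, hs'.reg7, hs'.reg6]; omega
      · have hv2 : Term.eval (ρ.setMem lb (Term.eval ρ (.reg 4)) (Term.eval ρ
            (.op .plus (.reg 7) (.const 1)))) (.op .minus (.reg 6) (.op .plus (.reg 7) (.const 1))) =
            (n + 2) * (n + 2) - (cur + 1) := by
          simp [Term.eval, Op.eval, hs'.reg7, hs'.reg6]
        rw [hv2, hv1]
        simp only [Term.eval, State.setMem_reg, g4]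
        refine ⟨trivial, ⟨by simp, by simpa using g0⟩, by simpa using g3,
          Function.update lab' ⟨m, hm⟩ (cur + 1), Function.update root' ⟨m, hm⟩ (root' x),
          Searching.setReg ?_ (Or.inr rfl) _, ?_, ?_, ?_⟩
        · exact ⟨g0, hs'.reg5, hs'.reg6, hs'.reg7,
            (hs'.agree.setMem (Or.inr rfl) _ _).setMem (Or.inl rfl) _ _,
            hs'.inv.visit hx hlx' hcur hadj hl0,
            (hs'.labs.setMem ⟨m, hm⟩).setMem_of_ne hkl.symm⟩
        · rw [searchPriority_visit hwd]
          exact (hp'.setMem_of_ne hkl).setMem ⟨m, hm⟩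
        · rw [Function.update_of_ne hne.symm, hlx']
        · intro v hv hxv
          by_cases hvm : v = ⟨m, hm⟩
          · rw [hvm, Function.update_self]; omega
          · rw [Function.update_of_ne hvm]
            refine hnb v ?_ hxv
            have : v.val ≠ m := fun hc => hvm (Fin.ext hc)
            omega
    · refine Runs.skip (by omega) ⟨g4, ⟨by simp, by simpa using g0⟩, by simpa using g3, lab',
        root', hs'.setReg (by omega) _, hp', hlx', fun v hv hxv => ?_⟩
      by_cases hvm : v = ⟨m, hm⟩
      · subst hvm
        simp only [Term.eval, Op.eval, g4, e1, a2, hxv, if_true] at hc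
        intro h0
        simp [h0] at hc
      · refine hnb v ?_ hxv
        have : v.val ≠ m := fun hc => hvm (Fin.ext hc)
        omega
  · rintro ρ ⟨-, -, lab', root', hs', hp', hlx', hnb⟩
    exact ⟨lab', root', ⟨hs'.reg0, hs'.reg5, hs'.reg6, hs'.reg7, hs'.agree,
      hs'.inv.finish hx hlx' hcur (fun v => hnb v v.isLt), hs'.labs⟩, hp'⟩

/-- Every round takes up exactly one vertex. A linear scan for the highest priority replaces the
queue and another finds the neighbours, so `n` rounds are quadratic in total and leave every vertex
done. -/
theorem runs_search (hW : Large n W) (hn : 0 < n) (h0 : σ.reg 0 = n)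
    (hG : σ.mem 0 = adjacencyCell G) (hk : 0 ≠ kb) (hl : 0 ≠ lb) (hkl : kb ≠ lb)
    (hkey : ∀ v, 0 < key v ∧ key v ≤ n * (n + 1) + n) (hσ : Holds σ kb key)
    (hz : Holds (n := n) σ lb fun _ => 0) :
    Runs W (search kb lb) σ (300 * n ^ 2) fun τ => AgreeTwo kb lb σ τ ∧
      ∃ lab root, IsLayering G key root lab ∧ (∀ v, lab v ≤ n) ∧ Holds τ lb lab := by
  have hlt := hW.lt
  have hM : (n + 2) * (n + 2) < W := by unfold Large at hW; nlinarith
  have hkM : ∀ v, key v ≤ (n + 2) * (n + 2) := fun v => (hkey v).2.trans (by nlinarith)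
  have hnn : n ≤ n ^ 2 := Nat.le_self_pow (by omega) n
  have hmul : n * (68 * n + 80 + 8) = 68 * n ^ 2 + 88 * n := by ring
  refine Runs.seq (T₁ := 8) (T₂ := 300 * n ^ 2 - 8) (Runs.assign ?_ (by simp [Term.cost]) ?_)
    (by omega)
  · simp only [Term.Fits, Term.eval, Op.eval, h0]; omega
  refine Runs.seq (T₁ := 2) (T₂ := 300 * n ^ 2 - 10) (Runs.assign ?_ (by simp [Term.cost]) ?_)
    (by omega)
  · simp only [Term.Fits]; omega
  refine Runs.forLoop (N := n) (c := 68 * n + 80) (fun h τ => ∃ lab done root cur,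
    Searching G key kb lb σ τ lab done root cur h ∧
    Holds τ kb (searchPriority ((n + 2) * (n + 2)) key lab done) ∧ done.card = h ∧ cur ≤ h) (by omega)
    ?_ ?_ ?_ ?_ ?_
  · refine ⟨fun _ => 0, ∅, id, 0, ⟨?_, ?_, ?_, ?_, ?_, .init G key, hz⟩, ?_, rfl, le_rfl⟩
    · simp [h0]
    · simp
    · simp [Term.eval, Op.eval, h0]
    · simp [Term.eval]
    · exact (((AgreeTwo.refl kb lb σ).setReg (by omega) _).setReg (by omega) _).setReg (by omega) _
    · intro v
      simpa [searchPriority] using hσ v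
  · rintro m τ ⟨lab, done, root, cur, hs, -⟩
    exact ⟨hs.reg5, hs.reg0⟩
  · rintro m hm τ ⟨lab, done, root, cur, hs, hp, hcard, hcur⟩
    refine Runs.seq (T₁ := 2) (T₂ := 68 * n + 78) (Runs.assign ?_ (by simp [Term.cost]) ?_)
      (by omega)
    · simp only [Term.Fits]; omega
    have hs1 := hs.setReg (r := 3) (Or.inl rfl) 0
    refine Runs.seq (T₁ := 18 * n + 6) (T₂ := 50 * n + 72) (Runs.mono (runs_selectMax (kb := kb) hW hn hs1.reg0
      (fun v => (searchPriority_le hkM v).trans_lt hM) hp (by simp)) le_rfl ?_) (by omega)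
    rintro _ ⟨x, rfl, hmax⟩
    obtain ⟨hx, hfound, hnew⟩ := hs.inv.of_searchPriority_max hkey (by omega) (by omega) hmax
    have hs2 := (hs1.setReg (r := 3) (Or.inl rfl) x.val).setReg (r := 4) (Or.inr rfl) n
    have hp2 : Holds (((τ.setReg 3 0).setReg 3 x.val).setReg 4 n) kb
      (searchPriority ((n + 2) * (n + 2)) key lab done) := hp
    set τ₂ := ((((τ.setReg 3 0).setReg 3 x.val).setReg 4 n)) with hτ₂
    have g3 : τ₂.reg 3 = x.val := by simp [hτ₂]
    clear_value τ₂
    clear hτ₂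
    have hxW := x.isLt
    have elx := hs2.labs x
    have blx := hs2.inv.lab_le hcur x
    -- The two branches meet before register `7` is updated, so the situation is stated for the
    -- state after the update that follows.
    refine Runs.seq (T₁ := 20) (T₂ := 50 * n + 52) (Q := _) (Runs.mono (T := 20)
      (Q := fun ρ => ∃ lab' root' cur', Searching G key kb lb σ (ρ.setReg 7 cur') lab' done root'
        cur' m ∧ Holds ρ kb (searchPriority ((n + 2) * (n + 2)) key lab done) ∧
        (∀ v, v ≠ x → lab' v = lab v) ∧ lab' x = cur' ∧ cur' ≠ 0 ∧ cur' ≤ m + 1 ∧ ρ.reg 3 = x.val)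
      ?_ le_rfl ?_) (by omega)
    · refine Runs.ite (T' := 10) ?_ (by simp [Term.cost]) (fun hc => ?_) (fun hc => ?_)
      · simp only [Term.Fits, Term.eval, g3, elx]; omega
      · simp only [Term.eval, g3, elx] at hc
        refine Runs.skip (by omega) ⟨lab, root, lab x, ?_, hp2, fun _ _ => rfl, rfl, hc, by omega, g3⟩
        refine ⟨by simpa using hs2.reg0, by simpa using hs2.reg5, by simpa using hs2.reg6,
          by simp, hs2.agree.setReg (by omega) _, hs2.inv.select_found hx hc (hfound hc), hs2.labs⟩
      · simp only [Term.eval, g3, elx] at hc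
        obtain ⟨hno, hmx⟩ := hnew hc
        refine Runs.store ?_ ?_ (by simp [Term.cost]) ?_
        · simp only [Term.Fits, g3]; omega
        · simp only [Term.Fits, Term.eval, Op.eval, hs2.reg7]; omega
        simp only [Term.eval, Op.eval, g3, hs2.reg7]
        refine ⟨_, _, cur + 1, ⟨?_, ?_, ?_, ?_,
          (hs2.agree.setMem (Or.inr rfl) _ _).setReg (by omega) _,
          hs2.inv.select_new hc hno hmx, (hs2.labs.setMem x).setReg⟩, hp2.setMem_of_ne hkl,
          fun v hv => Function.update_of_ne hv _ _, by simp, by omega, by omega, g3⟩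
        · simpa using hs2.reg0
        · simpa using hs2.reg5
        · simpa using hs2.reg6
        · simp
    · rintro ρ ⟨lab', root', cur', hs3, hp3, hlab, hlx, hc0, hcm, f3⟩
      have elx' : ρ.mem lb x.val = lab' x := hs3.labs x
      refine Runs.seq (T₁ := 3) (T₂ := 50 * n + 49) (Runs.assign ?_ (by simp [Term.cost]) ?_)
        (by omega)
      · simp only [Term.Fits, Term.eval, f3, elx']; omega
      simp only [Term.eval, f3, elx', hlx]
      refine Runs.seq (T₁ := 3) (T₂ := 50 * n + 46) (Runs.store ?_ ?_ (by simp [Term.cost]) ?_)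
        (by omega)
      · simp [Term.Fits, f3]; omega
      · simp only [Term.Fits]; omega
      simp only [Term.eval, State.setReg_reg, f3, (by decide : ¬ (3 = 7)), if_false]
      refine Runs.mono (runs_visitAll hW hG (x := x) (done := done) (lab := lab') (h := m) hk hl hkl
        ⟨hs3.reg0, hs3.reg5, hs3.reg6, hs3.reg7, hs3.agree.setMem (Or.inl rfl) _ _, hs3.inv,
          hs3.labs.setMem_of_ne hkl.symm⟩ ?_ hx hlx hc0 (by omega) (by simpa using f3))
        (by omega) ?_
      · rw [searchPriority_insert hlab]
        exact hp3.setReg.setMem x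
      · rintro ρ' ⟨lab'', root'', hs4, hp4⟩
        refine ⟨hs4.reg5, lab'', insert x done, root'', cur', ⟨?_, ?_, ?_, ?_,
          hs4.agree.setReg (by omega) _, hs4.inv, hs4.labs⟩, hp4, ?_, hcm⟩
        · simpa using hs4.reg0
        · simp
        · simpa using hs4.reg6
        · simpa using hs4.reg7
        · rw [Finset.card_insert_of_notMem hx, hcard]
  · omega
  · rintro τ ⟨lab, done, root, cur, hs, hp, hcard, hcur⟩
    have hd : done = Finset.univ :=
      Finset.eq_univ_of_card _ (by rw [hcard, Fintype.card_fin])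
    subst hd
    refine ⟨hs.agree, lab, root, hs.inv.isLayering, fun v => ?_, hs.labs⟩
    exact (hs.inv.le_cur v (Finset.mem_univ v)).trans hcur

end SearchProgram

end WordRAM

/-! ### The dynamic program -/

namespace WordRAM

section Cuts

open scoped Classical in
/-- The number of vertices with property `P` that end at `y`. -/
noncomputable def endCard {n : ℕ} (P : Fin n → Prop) (B : Fin n → ℕ) (y : ℕ) : ℕ :=
  (Finset.univ.filter fun v => P v ∧ B v = y).card

open scoped Classical in
/-- The number of vertices with property `P` that end before `y`. -/
noncomputable def endBelowCard {n : ℕ} (P : Fin n → Prop) (B : Fin n → ℕ) (y : ℕ) : ℕ :=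
  (Finset.univ.filter fun v => P v ∧ B v < y).card

theorem endBelowCard_succ {n : ℕ} (P : Fin n → Prop) (B : Fin n → ℕ) (y : ℕ) :
    endBelowCard P B (y + 1) = endBelowCard P B y + endCard P B y := by
  classical
  unfold endBelowCard endCard
  rw [← Finset.card_union_of_disjoint]
  · congr 1
    ext v
    simp only [Finset.mem_filter, Finset.mem_univ, true_and, Finset.mem_union, Nat.lt_succ_iff,
      le_iff_lt_or_eq]
    tauto
  · rw [Finset.disjoint_left]
    intro v
    simp only [Finset.mem_filter, Finset.mem_univ, true_and]
    omega

theorem endBelowCard_le {n : ℕ} (P : Fin n → Prop) (B : Fin n → ℕ) (y : ℕ) :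
    endBelowCard P B y ≤ n := (Finset.card_le_univ _).trans (by simp)

/-- The vertex in register `5` lies to the right of the cut in register `3`, and its closed
neighbourhood may get the colour in register `4`. -/
def blockTerm (ab mb cb : ℕ) : Term :=
  .op .times (.op .less (.reg 3) (.op .plus (.load ab (.reg 5)) (.const 1)))
    (.op .times (.op .equal (.load cb (.reg 5)) (.const 0))
      (.op .plus (.op .equal (.load mb (.reg 5)) (.const 0))
        (.op .equal (.load mb (.reg 5)) (.op .plus (.reg 4) (.const 1)))))

/-- Count the vertices of the blocks of the colour in register `4` that start at the cut in
register `3` by their right ends. -/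
def countEnds (ab rb mb cb hb : ℕ) : Program :=
  .seq (forLoop 5 6 (.store hb (.reg 5) (.const 0)))
    (forLoop 5 0 (.ite (blockTerm ab mb cb)
      (.store hb (.load rb (.reg 5)) (.op .plus (.load hb (.load rb (.reg 5))) (.const 1))) .skip))

/-- Improve the values of the cuts by these blocks. -/
def relaxLoop (hb db : ℕ) : Program :=
  forLoop 5 6 (.seq (.assign 7 (.op .plus (.reg 7) (.load hb (.reg 5))))
    (.ite (.op .times (.op .less (.reg 3) (.reg 5))
        (.op .less (.load db (.reg 5)) (.op .plus (.load db (.reg 3)) (.reg 7))))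
      (.store db (.reg 5) (.op .plus (.load db (.reg 3)) (.reg 7))) .skip))

/-- Compute `cutValue` in bank `db`. -/
def cutProgram (ab rb mb cb hb db : ℕ) : Program :=
  .seq (.assign 6 (.op .plus (.reg 0) (.const 1)))
    (forLoop 3 6 (forLoop 4 1
      (.seq (countEnds ab rb mb cb hb) (.seq (.assign 7 (.const 0)) (relaxLoop hb db)))))

variable {n l W : ℕ} {σ : State} {ab rb mb cb hb db : ℕ} {A B mx cf : Fin n → ℕ}

/-- The registers during the dynamic program. -/
structure AtBlock (n l hb db : ℕ) (σ τ : State) (x j : ℕ) : Prop where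
  reg0 : τ.reg 0 = n
  reg1 : τ.reg 1 = l
  reg3 : τ.reg 3 = x
  reg4 : τ.reg 4 = j
  reg6 : τ.reg 6 = n + 1
  agree : AgreeTwo hb db σ τ

theorem AtBlock.setReg {τ : State} {x j r : ℕ} (h : AtBlock n l hb db σ τ x j)
    (hr : r = 5 ∨ r = 7) (y : ℕ) : AtBlock n l hb db σ (τ.setReg r y) x j where
  reg0 := by rw [State.setReg_reg, if_neg (by omega), h.reg0]
  reg1 := by rw [State.setReg_reg, if_neg (by omega), h.reg1]
  reg3 := by rw [State.setReg_reg, if_neg (by omega), h.reg3]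
  reg4 := by rw [State.setReg_reg, if_neg (by omega), h.reg4]
  reg6 := by rw [State.setReg_reg, if_neg (by omega), h.reg6]
  agree := h.agree.setReg (by omega) y

theorem AtBlock.setMem {τ : State} {x j b : ℕ} (h : AtBlock n l hb db σ τ x j)
    (hb' : b = hb ∨ b = db) (i y : ℕ) : AtBlock n l hb db σ (τ.setMem b i y) x j :=
  ⟨h.reg0, h.reg1, h.reg3, h.reg4, h.reg6, h.agree.setMem hb' i y⟩

/-- Bucketing by right end: one pass over the vertices serves all right cuts at once. -/
theorem runs_countEnds (hW : Large n W) (hlW : l + 1 < W) (hne : hb ≠ db)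
    (hab : ab ≠ hb ∧ ab ≠ db) (hrb : rb ≠ hb ∧ rb ≠ db) (hmb : mb ≠ hb ∧ mb ≠ db)
    (hcb : cb ≠ hb ∧ cb ≠ db) (hA : Holds σ ab A) (hB : Holds σ rb B) (hm : Holds σ mb mx)
    (hc : Holds σ cb cf) (hAn : ∀ v, A v ≤ n) (hBn : ∀ v, B v ≤ n) (hmW : ∀ v, mx v < W)
    (hcn : ∀ v, cf v ≤ n) {τ : State} {x j : ℕ} (hx : x ≤ n) (hj : j < l)
    (hτ : AtBlock n l hb db σ τ x j) {D : ℕ → ℕ} (hD : ∀ y ≤ n, τ.mem db y = D y)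
    {P : Fin n → Prop} (hP : ∀ v, P v ↔ x ≤ A v ∧ cf v = 0 ∧ (mx v = 0 ∨ mx v = j + 1)) :
    Runs W (countEnds ab rb mb cb hb) τ (59 * n + 23) fun ρ => AtBlock n l hb db σ ρ x j ∧
      (∀ y ≤ n, ρ.mem db y = D y) ∧ ∀ y ≤ n, ρ.mem hb y = endCard P B y := by
  classical
  have hlt := hW.lt
  refine Runs.seq (T₁ := 11 * n + 17) (T₂ := 48 * n + 6) ?_ (by omega)
  refine Runs.forLoop (N := n + 1) (c := 3) (fun m ρ => ρ.reg 5 = m ∧ AtBlock n l hb db σ ρ x j ∧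
    (∀ y ≤ n, ρ.mem db y = D y) ∧ ∀ y < m, ρ.mem hb y = 0) (by omega) ?_ ?_ ?_ (by omega) ?_
  · exact ⟨by simp, hτ.setReg (by omega) _, hD, fun y hy => absurd hy (Nat.not_lt_zero _)⟩
  · exact fun m ρ h => ⟨h.1, h.2.1.reg6⟩
  · rintro m hm ρ ⟨g5, hρ, gD, gh⟩
    refine Runs.store ?_ ?_ (by simp [Term.cost]) ⟨g5, by simp,
      (hρ.setMem (Or.inl rfl) _ _).setReg (by omega) _, fun y hy => ?_, fun y hy => ?_⟩
    · simp only [Term.Fits]; omega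
    · simp only [Term.Fits]; omega
    · rw [State.setReg_mem, State.setMem_mem, if_neg hne.symm]
      exact gD y hy
    · simp only [State.setReg_mem, State.setMem_mem, if_true, Term.eval, g5,
        Function.update_apply]
      split_ifs with hym
      · rfl
      · exact gh y (by omega)
  rintro τ' ⟨-, hτ', hD', hh⟩
  refine Runs.forLoop (N := n) (c := 40) (fun m ρ => ρ.reg 5 = m ∧ AtBlock n l hb db σ ρ x j ∧
    (∀ y ≤ n, ρ.mem db y = D y) ∧
    ∀ y ≤ n, ρ.mem hb y = countBelow (fun v => P v ∧ B v = y) m) (by omega) ?_ ?_ ?_ (by omega) ?_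
  · exact ⟨by simp, hτ'.setReg (by omega) _, hD', fun y hy => by
      rw [countBelow_zero]; exact hh y (by omega)⟩
  · exact fun m ρ h => ⟨h.1, h.2.1.reg0⟩
  · rintro m hm' ρ ⟨g5, hρ, gD, gh⟩
    have e1 : ρ.mem ab m = A ⟨m, hm'⟩ := by
      rw [hρ.agree.mem ab hab.1 hab.2]; exact hA ⟨m, hm'⟩
    have e2 : ρ.mem rb m = B ⟨m, hm'⟩ := by
      rw [hρ.agree.mem rb hrb.1 hrb.2]; exact hB ⟨m, hm'⟩
    have e3 : ρ.mem mb m = mx ⟨m, hm'⟩ := by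
      rw [hρ.agree.mem mb hmb.1 hmb.2]; exact hm ⟨m, hm'⟩
    have e4 : ρ.mem cb m = cf ⟨m, hm'⟩ := by
      rw [hρ.agree.mem cb hcb.1 hcb.2]; exact hc ⟨m, hm'⟩
    have b1 := hAn ⟨m, hm'⟩
    have b2 := hBn ⟨m, hm'⟩
    have b3 := hmW ⟨m, hm'⟩
    have b4 := hcn ⟨m, hm'⟩
    have e5 := gh _ b2
    have b5 := countBelow_le (P := fun v => P v ∧ B v = B ⟨m, hm'⟩) m
    have hcond : (blockTerm ab mb cb).Fits W ρ ∧ ((blockTerm ab mb cb).eval ρ ≠ 0 ↔ P ⟨m, hm'⟩) := by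
      rw [hP]
      simp only [blockTerm, Term.Fits, Term.eval, Op.eval, hρ.reg3, hρ.reg4, g5, e1, e3, e4]
      by_cases c1 : x ≤ A ⟨m, hm'⟩ <;> by_cases c2 : cf ⟨m, hm'⟩ = 0 <;>
        by_cases c3 : mx ⟨m, hm'⟩ = 0 <;> by_cases c4 : mx ⟨m, hm'⟩ = j + 1 <;>
        simp [c1, c2, c3, c4] <;> omega
    refine Runs.ite (T' := 12) hcond.1 (by simp [Term.cost, blockTerm]) (fun hc => ?_) (fun hc => ?_)
    · have hPm := hcond.2.1 hc
      refine Runs.store ?_ ?_ (by simp [Term.cost]) ⟨g5, by simp,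
        (hρ.setMem (Or.inl rfl) _ _).setReg (by omega) _, fun y hy => ?_, fun y hy => ?_⟩
      · simp only [Term.Fits, Term.eval, g5, e2]; omega
      · simp only [Term.Fits, Term.eval, Op.eval, g5, e2, e5]; omega
      · rw [State.setReg_mem, State.setMem_mem, if_neg hne.symm]
        exact gD y hy
      · simp only [State.setReg_mem, State.setMem_mem, if_true, Term.eval, Op.eval, g5, e2, e5,
          Function.update_apply]
        rw [countBelow_succ ⟨m, hm'⟩]
        by_cases hy' : y = B ⟨m, hm'⟩
        · subst hy'; simp [hPm]
        · simp [hy', Ne.symm hy', gh y hy]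
    · have hPm : ¬ P ⟨m, hm'⟩ := fun h => hcond.2.2 h hc
      refine Runs.skip (by omega) ⟨g5, by simp, hρ.setReg (by omega) _, gD, fun y hy => ?_⟩
      rw [countBelow_succ ⟨m, hm'⟩]
      simp [hPm, gh y hy]
  · rintro ρ ⟨-, hρ, gD, gh⟩
    refine ⟨hρ, gD, fun y hy => ?_⟩
    rw [gh y hy, countBelow_eq]
    unfold endCard
    congr

/-- Register `7` holds the prefix sum of the buckets, which is the value of the block that ends at
the current cut, so all right cuts together take linear time. -/
theorem runs_relaxLoop (hW : Large n W) (hne : hb ≠ db) {τ : State} {x j : ℕ} (hx : x ≤ n)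
    (hτ : AtBlock n l hb db σ τ x j) {D : ℕ → ℕ} (hD : ∀ y ≤ n, τ.mem db y = D y)
    {P : Fin n → Prop} (hh : ∀ y ≤ n, τ.mem hb y = endCard P B y) (h7 : τ.reg 7 = 0)
    (hDn : ∀ y, D y ≤ (n + 1) * n) :
    Runs W (relaxLoop hb db) τ (38 * n + 44) fun ρ => AtBlock n l hb db σ ρ x j ∧
      ∀ y ≤ n, ρ.mem db y = relaxCuts (fun y => endBelowCard P B (y + 1)) x D y := by
  have hlt := hW.lt
  have hDW : ∀ y z, D y + endBelowCard P B z < W := fun y z => by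
    have h1 := hDn y
    have h2 := endBelowCard_le P B z
    unfold Large at hW
    nlinarith
  refine Runs.forLoop (N := n + 1) (c := 30) (fun m ρ => ρ.reg 5 = m ∧ AtBlock n l hb db σ ρ x j ∧
    ρ.reg 7 = endBelowCard P B m ∧ (∀ y ≤ n, ρ.mem hb y = endCard P B y) ∧
    ∀ y ≤ n, ρ.mem db y = if y < m then relaxCuts (fun y => endBelowCard P B (y + 1)) x D y
      else D y) (by omega) ?_ ?_ ?_ (by omega) ?_
  · exact ⟨by simp, hτ.setReg (by omega) _, by simpa [endBelowCard] using h7, hh, by simpa using hD⟩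
  · exact fun m ρ h => ⟨h.1, h.2.1.reg6⟩
  · rintro m hm ρ ⟨g5, hρ, g7, gh, gD⟩
    have b1 := hDW m (m + 1)
    have b2 := hDW x (m + 1)
    have b3 := hDW 0 m
    have b4 := endBelowCard_succ P B m
    have b5 := endBelowCard_le P B (m + 1)
    have e1 := gh m (by omega)
    have e2 := gD m (by omega)
    rw [if_neg (lt_irrefl _)] at e2
    -- The cut `x` never improves itself, so its original value can be read throughout the loop.
    have e3 : ρ.mem db x = D x := by
      rw [gD x hx]
      simp [relaxCuts]
    refine Runs.seq (T₁ := 5) (T₂ := 25) (Runs.assign ?_ (by simp [Term.cost]) ?_) (by omega)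
    · simp only [Term.Fits, Term.eval, Op.eval, g5, g7, e1]; omega
    simp only [Term.eval, Op.eval, g5, g7, e1, ← b4]
    refine Runs.ite (T' := 8) ?_ (by simp [Term.cost]) (fun hc => ?_) (fun hc => ?_)
    · simp only [Term.Fits, Term.eval, Op.eval, State.setReg_reg, State.setReg_mem, g5, hρ.reg3]
      simp only [(by decide : ¬ (3 = 7)), (by decide : ¬ (5 = 7)), if_false, if_true, e2, e3]
      by_cases c1 : x < m <;> by_cases c2 : D m < D x + endBelowCard P B (m + 1) <;>
        simp [c1, c2] <;> omega
    · have hc' : x < m ∧ D m < D x + endBelowCard P B (m + 1) := by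
        by_contra hcon
        apply hc
        simp only [Term.eval, Op.eval, State.setReg_reg, State.setReg_mem, g5, hρ.reg3,
          (by decide : ¬ (3 = 7)), (by decide : ¬ (5 = 7)), if_false, if_true, e2, e3]
        rcases not_and_or.1 hcon with hcon | hcon <;> simp [hcon]
      refine Runs.store ?_ ?_ (by simp [Term.cost]) ⟨by simpa using g5, by simp,
        ((hρ.setReg (Or.inr rfl) _).setMem (Or.inr rfl) _ _).setReg (Or.inl rfl) _, by simp,
        fun y hy => ?_, fun y hy => ?_⟩
      · simp [Term.Fits, g5]; omega
      · simp [Term.Fits, Term.eval, Op.eval, hρ.reg3, e3]; omega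
      · rw [State.setReg_mem, State.setMem_mem, if_neg hne]
        exact gh y hy
      · simp only [State.setReg_mem, State.setMem_mem, if_true, Term.eval, Op.eval,
          State.setReg_reg, g5, hρ.reg3, (by decide : ¬ (3 = 7)), (by decide : ¬ (5 = 7)),
          if_false, e3, Function.update_apply]
        by_cases hym : y = m
        · subst hym
          simp only [if_true, Nat.lt_succ_self, relaxCuts, hc'.1]
          exact (max_eq_right hc'.2.le).symm
        · rw [if_neg hym, gD y hy]
          exact if_congr (by omega) rfl rfl
    · have hc' : ¬ (x < m ∧ D m < D x + endBelowCard P B (m + 1)) := by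
        rintro ⟨c1, c2⟩
        simp only [Term.eval, Op.eval, State.setReg_reg, State.setReg_mem, g5, hρ.reg3,
          (by decide : ¬ (3 = 7)), (by decide : ¬ (5 = 7)), if_false, if_true, e2, e3, c1, c2] at hc
        omega
      refine Runs.skip (by omega) ⟨by simpa using g5, by simp,
        (hρ.setReg (Or.inr rfl) _).setReg (Or.inl rfl) _, by simp, gh, fun y hy => ?_⟩
      rw [State.setReg_mem, State.setReg_mem, gD y hy]
      by_cases hym : y = m
      · subst hym
        simp only [lt_irrefl, if_false, Nat.lt_succ_self, if_true, relaxCuts]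
        split_ifs with hxy
        · exact (max_eq_left (by omega)).symm
        · rfl
      · exact if_congr (by omega) rfl rfl
  · rintro ρ ⟨-, hρ, -, -, gD⟩
    refine ⟨hρ, fun y hy => ?_⟩
    rw [gD y hy, if_pos (by omega)]

theorem runs_cutProgram {G : SimpleGraph (Fin n)} {p : Fin n → Option (Fin l)} (hW : Large n W)
    (hn : 0 < n) (hl : 0 < l) (hlW : l + 1 < W) (h0 : σ.reg 0 = n) (h1 : σ.reg 1 = l)
    (hne : hb ≠ db)
    (hab : ab ≠ hb ∧ ab ≠ db) (hrb : rb ≠ hb ∧ rb ≠ db) (hmb : mb ≠ hb ∧ mb ≠ db)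
    (hcb : cb ≠ hb ∧ cb ≠ db) (hA : Holds σ ab A) (hB : Holds σ rb B) (hm : Holds σ mb mx)
    (hc : Holds σ cb cf) (hAn : ∀ v, A v ≤ n) (hBn : ∀ v, B v ≤ n) (hmW : ∀ v, mx v < W)
    (hcn : ∀ v, cf v ≤ n)
    (hok : ∀ v j, cf v = 0 ∧ (mx v = 0 ∨ mx v = j + 1) ↔ IsCompatible G p v j)
    (hD : ∀ y ≤ n, σ.mem db y = 0) :
    Runs W (cutProgram ab rb mb cb hb db) σ (500 * (l * n ^ 2)) fun τ => AgreeTwo hb db σ τ ∧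
      ∀ y ≤ n, τ.mem db y = cutValue (blockCard G p A B) l (n + 1) y := by
  have hlt := hW.lt
  have hf : ∀ j x y, blockCard G p A B j x y ≤ n := fun j x y =>
    (blockCard_le j x y).trans (by simp)
  have hnl : n ≤ l * n ^ 2 := (Nat.le_self_pow (by omega) n).trans (Nat.le_mul_of_pos_left _ hl)
  have hnl' : l * n ≤ l * n ^ 2 := Nat.mul_le_mul_left _ (Nat.le_self_pow (by omega) n)
  have hl2 : l ≤ l * n := Nat.le_mul_of_pos_right _ hn
  have hmul : (n + 1) * (l * (97 * n + 80 + 8) + 6 + 8) + 6 =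
    97 * (l * n ^ 2) + 185 * (l * n) + 88 * l + 14 * n + 20 := by ring
  refine Runs.seq (T₁ := 4) (T₂ := 500 * (l * n ^ 2) - 4) (Runs.assign ?_ (by simp [Term.cost]) ?_)
    (by omega)
  · simp only [Term.Fits, Term.eval, Op.eval, h0]; omega
  refine Runs.forLoop (N := n + 1) (c := l * (97 * n + 80 + 8) + 6)
    -- Register `4` keeps whatever the inner loop left in it, hence the existential quantifier.
    (fun x τ => (∃ j, AtBlock n l hb db σ τ x j) ∧
    ∀ y ≤ n, τ.mem db y = cutValue (blockCard G p A B) l x y) (by omega) ?_ ?_ ?_ (by omega) ?_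
  · refine ⟨⟨σ.reg 4, ?_⟩, hD⟩
    refine ⟨by simpa using h0, by simpa using h1, by simp, by simp,
      by simp [Term.eval, Op.eval, h0], ?_⟩
    exact ((AgreeTwo.refl hb db σ).setReg (by omega) _).setReg (by omega) _
  · rintro x τ ⟨⟨j, hτ⟩, -⟩
    exact ⟨hτ.reg3, hτ.reg6⟩
  · rintro x hx τ ⟨⟨j₀, hτ⟩, gD⟩
    refine Runs.forLoop (N := l) (c := 97 * n + 80) (fun j ρ => AtBlock n l hb db σ ρ x j ∧
      ∀ y ≤ n, ρ.mem db y = relaxColors (blockCard G p A B) x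
        (cutValue (blockCard G p A B) l x) j y) (by omega) ?_ ?_ ?_ le_rfl ?_
    · refine ⟨⟨by simpa using hτ.reg0, by simpa using hτ.reg1, by simpa using hτ.reg3, by simp,
        by simpa using hτ.reg6, hτ.agree.setReg (by omega) _⟩, gD⟩
    · exact fun j ρ h => ⟨h.1.reg4, h.1.reg1⟩
    · rintro j hj ρ ⟨hρ, hDρ⟩
      refine Runs.seq (T₁ := 59 * n + 23) (T₂ := 38 * n + 46) (Runs.mono
        (runs_countEnds hW hlW hne hab hrb hmb hcb hA hB hm hc hAn hBn hmW hcn (by omega) hj hρ hDρ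
          (P := fun v => x ≤ A v ∧ IsCompatible G p v j) (fun v => by rw [hok])) le_rfl ?_)
        (by omega)
      rintro ρ' ⟨hρ', hD', hh'⟩
      refine Runs.seq (T₁ := 2) (T₂ := 38 * n + 44) (Runs.assign ?_ (by simp [Term.cost]) ?_)
        (by omega)
      · simp only [Term.Fits]; omega
      refine Runs.mono (runs_relaxLoop (B := B) (P := fun v => x ≤ A v ∧ IsCompatible G p v j) hW hne
        (by omega) (hρ'.setReg (Or.inr rfl) _) hD' hh' (by simp [Term.eval]) fun y => ?_) le_rfl ?_
      · exact (relaxColors_le hf (fun y => cutValue_le hf x y) j y).trans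
          (Nat.mul_le_mul_right _ hx)
      · rintro ρ'' ⟨h'', hD''⟩
        refine ⟨h''.reg4, ⟨by simpa using h''.reg0, by simpa using h''.reg1,
          by simpa using h''.reg3, by simp, by simpa using h''.reg6,
          h''.agree.setReg (by omega) _⟩, fun y hy => ?_⟩
        rw [State.setReg_mem, hD'' y hy, relaxColors]
        have : (fun y => endBelowCard (fun v => x ≤ A v ∧ IsCompatible G p v j) B (y + 1)) =
            blockCard G p A B j x := by
          funext y
          unfold endBelowCard blockCard
          congr 1
          ext v
          simp
        rw [this]
    · rintro ρ ⟨hρ, hDρ⟩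
      refine ⟨hρ.reg3, ⟨l, ⟨by simpa using hρ.reg0, by simpa using hρ.reg1, by simp,
        by simpa using hρ.reg4, by simpa using hρ.reg6, hρ.agree.setReg (by omega) _⟩⟩, hDρ⟩
  · rintro τ ⟨⟨j, hτ⟩, gD⟩
    exact ⟨hτ.agree, gD⟩

end Cuts

end WordRAM

/-! ### The algorithm -/

namespace WordRAM

section Main

variable {n l k W : ℕ} {G : SimpleGraph (Fin n)} {p : Fin n → Option (Fin l)}

/-! ### Compatibility with a colour, read off from the tables. -/

theorem precoloringCell_of_none {v : Fin n} (h : p v = none) : precoloringCell p v = 0 := by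
  simp [precoloringCell, h]

theorem precoloringCell_of_some {v : Fin n} {i : Fin l} (h : p v = some i) :
    precoloringCell p v = i.val + 1 := by
  simp [precoloringCell, h]

theorem precoloringCell_le (v : Fin n) : precoloringCell p v ≤ l := by
  rcases h : p v with - | i
  · rw [precoloringCell_of_none h]; exact Nat.zero_le _
  · rw [precoloringCell_of_some h]; exact i.isLt

/-- No conflicts means that all precoloured vertices of the closed neighbourhood carry the maximal
number, so at most one colour occurs. It is absent if the maximum is zero, and colour `j` is stored
as `j + 1`. This makes the test of a vertex and a colour a constant-time one. -/
theorem conflicts_eq_zero_iff (v : Fin n) (j : ℕ) :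
    conflicts G (fun v => precoloringCell p v) v = 0 ∧
      (maxColor G (fun v => precoloringCell p v) v = 0 ∨
        maxColor G (fun v => precoloringCell p v) v = j + 1) ↔ IsCompatible G p v j := by
  classical
  have hle : ∀ w, (w = v ∨ G.Adj w v) →
      precoloringCell p w ≤ maxColor G (fun v => precoloringCell p v) v := fun w hw =>
    Finset.le_sup (f := fun v : Fin n => precoloringCell p v) (by simpa using hw)
  constructor
  · rintro ⟨h1, h2⟩ w hw i hi
    have h3 := hle w hw
    rw [conflicts, Finset.card_eq_zero, Finset.filter_eq_empty_iff] at h1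
    have h4 := h1 (Finset.mem_univ w)
    simp only [hw, true_and, precoloringCell_of_some hi] at h4
    rw [precoloringCell_of_some hi] at h3
    omega
  · intro h
    have hq : ∀ w, (w = v ∨ G.Adj w v) → precoloringCell p w = 0 ∨ precoloringCell p w = j + 1 := by
      intro w hw
      rcases hp : p w with - | i
      · exact Or.inl (precoloringCell_of_none hp)
      · right
        rw [precoloringCell_of_some hp, h w hw i hp]
    have hmax : maxColor G (fun v => precoloringCell p v) v ≤ j + 1 := by
      refine Finset.sup_le fun w hw => ?_
      have := hq w (by simpa using hw)
      omega
    constructor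
    · rw [conflicts, Finset.card_eq_zero, Finset.filter_eq_empty_iff]
      rintro w - ⟨hw, h1, h2⟩
      have := hq w hw
      omega
    · obtain ⟨w, hw, hwm⟩ := Finset.exists_mem_eq_sup
        (Finset.univ.filter fun w => w = v ∨ G.Adj w v) ⟨v, by simp⟩
        (fun v : Fin n => precoloringCell p v)
      have := hq w (by simpa using hw)
      rw [maxColor, hwm]
      exact this

/-- A vertex is not its own neighbour, so its `downDegree` is less than the number of vertices. The
search needs positive keys because priority zero marks done vertices. -/
theorem layerKey_pos (G : SimpleGraph (Fin n)) (lab : Fin n → ℕ) (v : Fin n) :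
    0 < layerKey G lab v := by
  classical
  have : downDegree G lab v < Fintype.card (Fin n) := by
    rw [← Finset.card_univ]
    refine Finset.card_lt_card (Finset.ssubset_univ_iff.2 fun h => ?_)
    have := Finset.mem_univ v
    rw [← h] at this
    simp at this
  unfold layerKey
  omega

/-- The input is still there, and the banks from `m` on have not been used. -/
structure Ready (G : SimpleGraph (Fin n)) (p : Fin n → Option (Fin l)) (k m : ℕ) (τ : State) :
    Prop where
  reg0 : τ.reg 0 = n
  reg1 : τ.reg 1 = l
  reg2 : τ.reg 2 = k
  mem0 : τ.mem 0 = adjacencyCell G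
  mem1 : Holds τ 1 fun v : Fin n => precoloringCell p v
  zero : ∀ b, m ≤ b → τ.mem b = fun _ => 0

theorem Ready.agreeTwo {m m' b c : ℕ} {σ τ : State} (h : Ready G p k m σ) (ha : AgreeTwo b c σ τ)
    (hb : 2 ≤ b ∧ b < m') (hc : 2 ≤ c ∧ c < m') (hm : m ≤ m') : Ready G p k m' τ where
  reg0 := by rw [ha.reg 0 (by omega), h.reg0]
  reg1 := by rw [ha.reg 1 (by omega), h.reg1]
  reg2 := by rw [ha.reg 2 (by omega), h.reg2]
  mem0 := by rw [ha.mem 0 (by omega) (by omega), h.mem0]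
  mem1 v := by rw [ha.mem 1 (by omega) (by omega)]; exact h.mem1 v
  zero d hd := by rw [ha.mem d (by omega) (by omega), h.zero d (by omega)]

theorem Agree.agreeTwo {b : ℕ} {σ τ : State} (h : Agree b σ τ) : AgreeTwo b b σ τ :=
  ⟨h.reg, fun b' hb _ => h.mem b' hb⟩

theorem Ready.agree {m m' b : ℕ} {σ τ : State} (h : Ready G p k m σ) (ha : Agree b σ τ)
    (hb : 2 ≤ b ∧ b < m') (hm : m ≤ m') : Ready G p k m' τ :=
  h.agreeTwo ha.agreeTwo hb hb hm

/-- The search for the layers: the second search starts in the last layers of the first one. -/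
def layerProgram : Program :=
  .seq (keyTable 2 3) (.seq (search 3 4) (.seq (keyTable 4 5) (search 5 6)))

theorem runs_layerProgram (hG : IsIntervalGraph G) (hW : Large n W) (hn : 0 < n) {σ : State}
    (hσ : Ready G p k 2 σ) : Runs W layerProgram σ (1040 * n ^ 2) fun τ => Ready G p k 7 τ ∧
      ∃ lab, IsTidy G lab ∧ (∀ v, lab v ≤ n) ∧ Holds τ 6 lab := by
  -- Bank `2` is never written and serves as a table of zero labels. All keys of the first search
  -- are then equal to `n`; its starts are arbitrary, and only positivity of the keys matters.
  refine Runs.seq (T₁ := 220 * n ^ 2) (T₂ := 820 * n ^ 2) (Runs.mono (runs_keyTable (G := G)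
    (lab := fun _ => 0) hW hn hσ.reg0 hσ.mem0 (fun _ => Nat.zero_le _)
    (fun v => by rw [hσ.zero 2 le_rfl]) (by decide) (by decide)) le_rfl ?_) (by omega)
  rintro τ₁ ⟨a₁, k₁⟩
  have r₁ := hσ.agree (m' := 4) a₁ (by decide) (by decide)
  refine Runs.seq (T₁ := 300 * n ^ 2) (T₂ := 520 * n ^ 2) (Runs.mono (runs_search (G := G)
    hW hn r₁.reg0 r₁.mem0 (by decide) (by decide) (by decide)
    (fun v => ⟨layerKey_pos _ _ _, layerKey_le (fun _ => Nat.zero_le _) v⟩) k₁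
    (fun v => by rw [r₁.zero 4 le_rfl])) le_rfl ?_) (by omega)
  rintro τ₂ ⟨a₂, lab₁, root₁, hl₁, hb₁, k₂⟩
  have r₂ := r₁.agreeTwo (m' := 5) a₂ (by decide) (by decide) (by decide)
  refine Runs.seq (T₁ := 220 * n ^ 2) (T₂ := 300 * n ^ 2) (Runs.mono (runs_keyTable (G := G)
    hW hn r₂.reg0 r₂.mem0 hb₁ k₂ (by decide) (by decide)) le_rfl ?_) (by omega)
  rintro τ₃ ⟨a₃, k₃⟩
  have r₃ := r₂.agree (m' := 6) a₃ (by decide) (by decide)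
  refine Runs.mono (runs_search (G := G)
    hW hn r₃.reg0 r₃.mem0 (by decide) (by decide) (by decide)
    (fun v => ⟨layerKey_pos _ _ _, layerKey_le hb₁ v⟩) k₃
    (fun v => by rw [r₃.zero 6 le_rfl])) le_rfl ?_
  rintro τ₄ ⟨a₄, lab₂, root₂, hl₂, hb₂, k₄⟩
  exact ⟨r₃.agreeTwo (m' := 7) a₄ (by decide) (by decide) (by decide), lab₂,
    hl₁.isTidy_of_layerKey hG hl₂, hb₂, k₄⟩

/-- The tables for the dynamic program. -/
def tableProgram : Program :=
  .seq (keyTable 6 7) (.seq (upTable 6 8) (.seq (baseTable 6 8 9) (.seq (rightTable 6 8 9 10)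
    (.seq (leftTable 7 11) (.seq (maxColorTable 12) (conflictTable 12 13))))))

theorem runs_tableProgram (hW : Large n W) (hn : 0 < n) (hlW : l + 1 < W) {σ : State}
    (hσ : Ready G p k 7 σ) {lab : Fin n → ℕ} (hlab : ∀ v, lab v ≤ n) (h6 : Holds σ 6 lab) :
    Runs W tableProgram σ (1540 * n ^ 2) fun τ => Ready G p k 14 τ ∧
      Holds τ 10 (rightEnd G lab) ∧ Holds τ 11 (leftEnd G lab) ∧
      Holds τ 12 (maxColor G fun v : Fin n => precoloringCell p v) ∧
      Holds τ 13 (conflicts G fun v : Fin n => precoloringCell p v) := by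
  have hq : ∀ v : Fin n, precoloringCell p v < W := fun v =>
    (precoloringCell_le v).trans_lt (by omega)
  refine Runs.seq (T₁ := 220 * n ^ 2) (T₂ := 1320 * n ^ 2) (Runs.mono (runs_keyTable (G := G)
    hW hn hσ.reg0 hσ.mem0 hlab h6 (by decide) (by decide)) le_rfl ?_) (by omega)
  rintro τ₁ ⟨a₁, h7⟩
  replace hσ := hσ.agree (m' := 8) a₁ (by decide) (by decide)
  replace h6 := h6.of_agree a₁ (by decide)
  refine Runs.seq (T₁ := 220 * n ^ 2) (T₂ := 1100 * n ^ 2) (Runs.mono (runs_upTable (G := G)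
    hW hn hσ.reg0 hσ.mem0 hlab h6 (by decide) (by decide)) le_rfl ?_) (by omega)
  rintro τ₂ ⟨a₂, h8⟩
  replace hσ := hσ.agree (m' := 9) a₂ (by decide) (by decide)
  replace h6 := h6.of_agree a₂ (by decide)
  replace h7 := h7.of_agree a₂ (by decide)
  refine Runs.seq (T₁ := 220 * n ^ 2) (T₂ := 880 * n ^ 2) (Runs.mono (runs_baseTable (G := G)
    hW hn hσ.reg0 hlab h6 h8 (by decide) (by decide)) le_rfl ?_) (by omega)
  rintro τ₃ ⟨a₃, h9⟩
  replace hσ := hσ.agree (m' := 10) a₃ (by decide) (by decide)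
  replace h6 := h6.of_agree a₃ (by decide)
  replace h7 := h7.of_agree a₃ (by decide)
  replace h8 := h8.of_agree a₃ (by decide)
  refine Runs.seq (T₁ := 220 * n ^ 2) (T₂ := 660 * n ^ 2) (Runs.mono (runs_rightTable (G := G)
    hW hn hσ.reg0 hσ.mem0 hlab h6 h8 h9 (by decide) (by decide) (by decide) (by decide)) le_rfl ?_)
    (by omega)
  rintro τ₄ ⟨a₄, h10⟩
  replace hσ := hσ.agree (m' := 11) a₄ (by decide) (by decide)
  replace h7 := h7.of_agree a₄ (by decide)
  refine Runs.seq (T₁ := 220 * n ^ 2) (T₂ := 440 * n ^ 2) (Runs.mono (runs_leftTable (G := G)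
    hW hn hσ.reg0 hlab h7 (by decide)) le_rfl ?_) (by omega)
  rintro τ₅ ⟨a₅, h11⟩
  replace hσ := hσ.agree (m' := 12) a₅ (by decide) (by decide)
  replace h10 := h10.of_agree a₅ (by decide)
  refine Runs.seq (T₁ := 220 * n ^ 2) (T₂ := 220 * n ^ 2) (Runs.mono (runs_maxColorTable (G := G)
    hW hn hσ.reg0 hσ.mem0 hq hσ.mem1 (by decide) (by decide)) le_rfl ?_) (by omega)
  rintro τ₆ ⟨a₆, h12⟩
  replace hσ := hσ.agree (m' := 13) a₆ (by decide) (by decide)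
  replace h10 := h10.of_agree a₆ (by decide)
  replace h11 := h11.of_agree a₆ (by decide)
  refine Runs.mono (runs_conflictTable (G := G)
    hW hn hσ.reg0 hσ.mem0 hq hσ.mem1 h12 (by decide) (by decide) (by decide)) le_rfl ?_
  rintro τ₇ ⟨a₇, h13⟩
  exact ⟨hσ.agree (m' := 14) a₇ (by decide) (by decide), h10.of_agree a₇ (by decide),
    h11.of_agree a₇ (by decide), h12.of_agree a₇ (by decide), h13⟩

/-- The program for instances with at least one vertex and at least one colour. -/
def mainProgram : Program :=
  .seq layerProgram (.seq tableProgram (.seq (cutProgram 11 10 12 13 14 15)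
    (.assign 0 (.op .equal (.op .less (.load 15 (.reg 0)) (.reg 2)) (.const 0)))))

open scoped Classical in
theorem runs_mainProgram (hG : IsIntervalGraph G) (hW : Large n W) (hn : 0 < n) (hl : 0 < l)
    (hlW : l + 1 < W) (hkW : k < W) {σ : State} (hσ : Ready G p k 2 σ) :
    Runs W mainProgram σ (3090 * (l * n ^ 2)) fun τ =>
      τ.reg 0 = if IsYesMHV G p k then 1 else 0 := by
  have hnl : n ^ 2 ≤ l * n ^ 2 := Nat.le_mul_of_pos_left _ hl
  have hpos : 0 < n ^ 2 := Nat.pow_pos hn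
  refine Runs.seq (T₁ := 1040 * n ^ 2) (T₂ := 2040 * (l * n ^ 2) + 10) (Runs.mono
    (runs_layerProgram hG hW hn hσ) le_rfl ?_) (by omega)
  rintro τ₁ ⟨r₁, lab, htidy, hlab, h6⟩
  refine Runs.seq (T₁ := 1540 * n ^ 2) (T₂ := 500 * (l * n ^ 2) + 10) (Runs.mono
    (runs_tableProgram hW hn hlW r₁ hlab h6) le_rfl ?_) (by omega)
  rintro τ₂ ⟨r₂, h10, h11, h12, h13⟩
  have hB : ∀ v, rightEnd G lab v ≤ n := fun v => (rightEnd_le G lab v).trans (by simp)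
  refine Runs.seq (T₁ := 500 * (l * n ^ 2)) (T₂ := 10) (Runs.mono
    (runs_cutProgram (G := G) (p := p) hW hn hl hlW r₂.reg0 r₂.reg1 (by decide) (by decide)
      (by decide) (by decide) (by decide) h11 h10 h12 h13
      (fun v => (Finset.card_le_univ _).trans (by simp)) hB
      (fun v => ?_) (fun v => (Finset.card_le_univ _).trans (by simp)) conflicts_eq_zero_iff
      (fun y _ => by rw [r₂.zero 15 (by decide)])) le_rfl ?_) (by omega)
  · have : maxColor G (fun v => precoloringCell p v) v ≤ l :=
      Finset.sup_le fun w _ => precoloringCell_le w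
    omega
  rintro τ₃ ⟨a₃, hD⟩
  have r₃ := r₂.agreeTwo (m' := 16) a₃ (by decide) (by decide) (by decide)
  have hDn := hD n le_rfl
  have hval := le_cutValue_iff (p := p) (A := leftEnd G lab) (B := rightEnd G lab) (N := n)
    (fun u v => by rw [htidy.close_iff, and_comm]) hB hl k
  have hDW : cutValue (blockCard G p (leftEnd G lab) (rightEnd G lab)) l (n + 1) n < W := by
    have := cutValue_le (l := l) (f := blockCard G p (leftEnd G lab) (rightEnd G lab)) (N := n)
      (fun j x y => (blockCard_le j x y).trans (by simp)) (n + 1) n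
    unfold Large at hW
    nlinarith
  have hlt := hW.lt
  refine Runs.assign ?_ (by simp [Term.cost]) ?_
  · simp only [Term.Fits, Term.eval, Op.eval, r₃.reg0, r₃.reg2, hDn]
    refine ⟨⟨⟨by omega, hDW⟩, hkW, ?_⟩, by omega, ?_⟩ <;> split_ifs <;> omega
  · simp only [State.setReg_reg, if_true, Term.eval, Op.eval, r₃.reg0, r₃.reg2, hDn]
    by_cases hy : IsYesMHV G p k
    · simp [hy, hval.2 hy]
    · simp [hy, not_le.1 fun h => hy (hval.1 h)]

/-- The program for Maximum Happy Vertices on interval graphs. -/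
def happyProgram : Program :=
  .ite (.reg 0) (.ite (.reg 1) mainProgram (.assign 0 (.const 0)))
    (.assign 0 (.op .equal (.reg 2) (.const 0)))

theorem ready_encodeMHV (G : SimpleGraph (Fin n)) (p : Fin n → Option (Fin l)) (k : ℕ) :
    Ready G p k 2 (encodeMHV G p k) where
  reg0 := by simp [encodeMHV]
  reg1 := by simp [encodeMHV]
  reg2 := by simp [encodeMHV]
  mem0 := by simp [encodeMHV]
  mem1 v := by simp [encodeMHV]
  zero b hb := by
    simp only [encodeMHV]
    rw [if_neg (by omega), if_neg (by omega)]
    rfl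

theorem isYesMHV_of_isEmpty (G : SimpleGraph (Fin 0)) (p : Fin 0 → Option (Fin l)) (k : ℕ) :
    IsYesMHV G p k ↔ k = 0 := by
  constructor
  · rintro ⟨c, -, hk⟩
    rw [Set.eq_empty_of_isEmpty (happyVertices G c), Set.ncard_empty] at hk
    omega
  · rintro rfl
    exact ⟨fun v => v.elim0, fun v => v.elim0, Nat.zero_le _⟩

open scoped Classical in
theorem runs_happyProgram (hG : IsIntervalGraph G) :
    Runs ((n + l + k + 2) ^ 4) happyProgram (encodeMHV G p k) (3100 * (l * n ^ 2 + 1)) fun τ =>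
      τ.reg 0 = if IsYesMHV G p k then 1 else 0 := by
  have hσ := ready_encodeMHV G p k
  -- The fourth power leaves room for `k`, `l` and the constants; the bound `Large`, which covers
  -- keys, priorities and values of cuts, is checked below.
  have h1 : (n + l + k + 2) * 8 ≤ (n + l + k + 2) ^ 4 := by
    have : 2 ^ 3 ≤ (n + l + k + 2) ^ 3 := Nat.pow_le_pow_left (by omega) 3
    rw [pow_succ' _ 3]
    exact Nat.mul_le_mul_left _ this
  refine Runs.ite (T' := 3100 * (l * n ^ 2) + 3000) ?_ (by simp [Term.cost]; omega)
    (fun hn => ?_) (fun hn => ?_)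
  · simp only [Term.Fits, hσ.reg0]; omega
  · simp only [Term.eval, hσ.reg0] at hn
    refine Runs.ite (T' := 3100 * (l * n ^ 2) + 2900) ?_ (by simp [Term.cost]; omega)
      (fun hl => ?_) (fun hl => ?_)
    · simp only [Term.Fits, hσ.reg1]; omega
    · simp only [Term.eval, hσ.reg1] at hl
      refine Runs.mono (runs_mainProgram hG ?_ (by omega) (by omega) (by omega) (by omega) hσ)
        (by omega) fun _ h => h
      have h2 : 2 ^ 2 * (n + 2) ^ 2 ≤ (n + l + k + 2) ^ 2 * (n + l + k + 2) ^ 2 :=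
        Nat.mul_le_mul (Nat.pow_le_pow_left (by omega) 2) (Nat.pow_le_pow_left (by omega) 2)
      unfold Large
      calc 4 * ((n + 2) * (n + 2)) = 2 ^ 2 * (n + 2) ^ 2 := by ring
        _ ≤ _ := h2
        _ = _ := by ring
    · simp only [Term.eval, hσ.reg1] at hl
      subst hl
      refine Runs.assign ?_ (by simp [Term.cost]) ?_
      · simp only [Term.Fits]; omega
      · have : ¬ IsYesMHV G p k := by
          rintro ⟨c, -⟩
          exact (c ⟨0, by omega⟩).elim0
        simp [this, Term.eval]
  · simp only [Term.eval, hσ.reg0] at hn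
    subst hn
    refine Runs.assign ?_ (by simp [Term.cost]) ?_
    · simp only [Term.Fits, Term.eval, Op.eval, hσ.reg2]
      refine ⟨by omega, by omega, ?_⟩
      split_ifs <;> omega
    · simp [Term.eval, Op.eval, hσ.reg2, isYesMHV_of_isEmpty]

end Main

end WordRAM

theorem mainTheorem2 :
    ∃ (P : WordRAM.Program) (d C : ℕ),
      ∀ (n ℓ k : ℕ) (G : SimpleGraph (Fin n)) (p : Fin n → Option (Fin ℓ)),
        IsIntervalGraph G →
          ∃ (τ : WordRAM.State) (T : ℕ),
            WordRAM.Exec ((n + ℓ + k + 2) ^ d) P (encodeMHV G p k) τ T ∧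
            T ≤ C * (ℓ * n ^ 2 + 1) ∧
            (IsYesMHV G p k → τ.reg 0 = 1) ∧
            (¬ IsYesMHV G p k → τ.reg 0 = 0) := by
  refine ⟨WordRAM.happyProgram, 4, 3100, fun n ℓ k G p hG => ?_⟩
  obtain ⟨τ, T, h1, h2, h3⟩ := WordRAM.runs_happyProgram (p := p) (k := k) hG
  exact ⟨τ, T, h1, h2, fun h => by rw [h3, if_pos h], fun h => by rw [h3, if_neg h]⟩
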